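/- Let $\mu$ denote the product measure $\bigotimes_{j=1}^d\frac{\lambda}{2}$ on $[-1,1]^d$, where $\lambda$ is the Lebesgue measure on $[-1,1]$. For $\boldsymbol\delta\in(0,\infty)^d$ let $\mathcal B_{\boldsymbol\delta}([-1,1])=\{z\in\mathbb C^d:\forall j\ \exists y\in[-1,1],\ |z_j-y|<\delta_j\}$, and write $x_{[k]}=(x_1,\dots,x_k)$. Let $0<M<L<\infty$. There exist constants $C_6,C_7>0$ depending only on $M$ and $L$ such that the following holds for all $d\in\mathbb N$, $d\ge 1$, all $\boldsymbol\delta\in(0,\infty)^d$ and all $f_\rho,f_\pi$. Assume that for each $*\in\{\rho,\pi\}$: (a) $f_*:[-1,1]^d\to(0,\infty)$ is measurable with $\int f_*\,d\mu=1$, and $f_*$ extends to a complex continuously differentiable function (again denoted $f_*$) on $\mathcal B_{\boldsymbol\delta}([-1,1])$; (b) $M\le|f_*(z)|\le L$ for all $z\in\mathcal B_{\boldsymbol\delta}([-1,1])$; (c) $|f_*(x+y)-f_*(x)|\le C_6$ for all $x\in[-1,1]^d$ and all $y\in\mathbb C^d$ with $|y_j|<\delta_j$ for all $j$; (d) for every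 $k\in\{1,\dots,d-1\}$, $|f_*(x+y)-f_*(x)|\le C_6\delta_{k+1}$ for all $x\in[-1,1]^d$ and all $y\in\mathbb C^d$ with $|y_j|<\delta_j$ for $j\le k$ and $y_j=0$ for $j>k$. Let $T=(T_k)_{k=1}^d$ be the Knothe--Rosenblatt transport from $f_\rho\,d\mu$ to $f_\pi\,d\mu$, i.e., recursively $T_k(x_{[k-1]},\cdot)=F_{\pi;k}(T_1(x_1),\dots,T_{k-1}(x_{[k-1]}),\cdot)^{-1}\circ F_{\rho;k}(x_{[k-1]},\cdot)$ on $[-1,1]$, where $F_{*;k}(x_{[k]})=\int_{-1}^{x_k}\frac{\hat f_{*,k}(x_{[k-1]},t)}{\hat f_{*,k-1}(x_{[k-1]})}\,dt$ and $\hat f_{*,k}$ is the marginal of $f_*$ (w.r.t. $\mu$) in the first $k$ variables. Then $T$ is a bijection of $[-1,1]^d$ that is triangular ($T_k$ depends only on $x_{[k]}$) and monotone ($T_k$ is strictly increasing in $x_k$). Let $S=T^{-1}$ be its inverse. Set $$\xi_j=1+C_7\delta_j,\qquad \beta=\Big((d-1)!\prod_{j=1}^d\log\xi_j\Big)^{1/d},$$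 $$\Lambda_{k,\varepsilon}=\Big\{\nu\in\mathbb N_0^k:\ \xi_k^{-\max\{1,\nu_k\}}\prod_{j=1}^{k-1}\xi_j^{-\nu_j}\ge\varepsilon\Big\},\qquad N_\varepsilon=\sum_{k=1}^d|\Lambda_{k,\varepsilon}|,$$ and let $\mathbb P_{\Lambda_{k,\varepsilon}}$ be the real span of the monomials $x^\nu$, $\nu\in\Lambda_{k,\varepsilon}$ ($\{0\}$ if $\Lambda_{k,\varepsilon}=\emptyset$). Then for every $m\in\mathbb N_0$ and every $\tau\in(0,1)$ there exists $C=C(\boldsymbol\xi,m,d,\tau,f_\rho,f_\pi)>0$ such that for every $\varepsilon\in(0,1)$ there exist polynomials $p_k\in\mathbb P_{\Lambda_{k,\varepsilon}}$, $k\in\{1,\dots,d\}$, with the following property. With $$\tilde T_k(x_{[k]})=-1+\frac{2}{c_k(x_{[k-1]})}\int_{-1}^{x_k}\big(1+p_k(x_{[k-1]},t)\big)^2\,dt,\qquad c_k(x_{[k-1]})=\int_{-1}^{1}\big(1+p_k(x_{[k-1]},t)\big)^2\,dt,$$ the map $\tilde T=(\tilde T_k)_{k=1}^d$ is a monotone triangular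 bijection of $[-1,1]^d$, and $$\|T_k-\tilde T_k\|_{W^{m,\infty}([-1,1]^d)}\le C\exp\big(-\tau\beta N_\varepsilon^{1/d}\big)\qquad\text{for all }k\in\{1,\dots,d\},$$ where $\|u\|_{W^{m,\infty}}=\max_{|\nu|\le m}\|\partial^\nu u\|_{L^\infty}$. The same holds with $T$ replaced by $S$: for every $\varepsilon\in(0,1)$ there are (other) polynomials $p_k\in\mathbb P_{\Lambda_{k,\varepsilon}}$ such that the maps $\tilde S_k$, defined from them by the same formula, form a monotone triangular bijection $\tilde S$ of $[-1,1]^d$ and satisfy $\|S_k-\tilde S_k\|_{W^{m,\infty}([-1,1]^d)}\le C\exp(-\tau\beta N_\varepsilon^{1/d})$ for all $k$. -/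

import Mathlib

noncomputable section

open scoped NNReal ENNReal ContDiff

namespace KRApprox

open MeasureTheory Set

/-- The closed cube `[-1,1]^d`. -/
def cube (d : ℕ) : Set (Fin d → ℝ) := {x | ∀ j, x j ∈ Icc (-1 : ℝ) 1}

/-- The open cube `(-1,1)^d`. -/
def openCube (d : ℕ) : Set (Fin d → ℝ) := {x | ∀ j, x j ∈ Ioo (-1 : ℝ) 1}

/-- The `d`-fold product of the measure `λ / 2`, with `λ` the Lebesgue measure on `[-1,1]`. -/
def cubeMeasure (d : ℕ) : Measure (Fin d → ℝ) :=
  Measure.pi fun _ => (2 : ℝ≥0)⁻¹ • (volume : Measure ℝ).restrict (Icc (-1) 1)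

/-! ### Assumptions on the densities -/

/-- `f` restricts to a positive probability density on `[-1,1]^d` with respect to `cubeMeasure`. -/
structure IsProbDensity {d : ℕ} (f : (Fin d → ℝ) → ℝ) : Prop where
  measurable : Measurable fun x : cube d => f x
  pos : ∀ x ∈ cube d, 0 < f x
  integral_eq_one : ∫ x, f x ∂(cubeMeasure d) = 1

/-- The product over `j` of the complex `δ j`-neighbourhoods of `[-1,1]`. -/
def complexNhd {d : ℕ} (δ : Fin d → ℝ) : Set (Fin d → ℂ) :=
  {z | ∀ j, ∃ y ∈ Icc (-1 : ℝ) 1, ‖z j - (y : ℂ)‖ < δ j}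

/-- A real vector, seen as a complex one. -/
def toComplex {d : ℕ} (x : Fin d → ℝ) : Fin d → ℂ := fun j => (x j : ℂ)

/-- The regularity assumption on one density `f`, with constants `M`, `L`, `C₆` and radii `δ`:
`f` is a probability density on `[-1,1]^d` that has a complex differentiable extension `F` to the
neighbourhood `complexNhd δ`, with two-sided bounds and smallness conditions on its variation.
In the last condition coordinates are counted from `0`: only the coordinates `j < k` are
perturbed, and the bound involves the radius of the next coordinate `k`. -/
def DensityAssumption {d : ℕ} (M L C₆ : ℝ) (δ : Fin d → ℝ) (f : (Fin d → ℝ) → ℝ) : Prop :=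
  IsProbDensity f ∧
  ∃ F : (Fin d → ℂ) → ℂ,
    (∀ x ∈ cube d, F (toComplex x) = (f x : ℂ)) ∧
    ContDiffOn ℂ 1 F (complexNhd δ) ∧
    (∀ z ∈ complexNhd δ, M ≤ ‖F z‖ ∧ ‖F z‖ ≤ L) ∧
    (∀ x ∈ cube d, ∀ y : Fin d → ℂ, (∀ j, ‖y j‖ < δ j) →
      ‖F (toComplex x + y) - F (toComplex x)‖ ≤ C₆) ∧
    (∀ k : Fin d, 0 < (k : ℕ) → ∀ x ∈ cube d, ∀ y : Fin d → ℂ,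
      (∀ j, j < k → ‖y j‖ < δ j) → (∀ j, k ≤ j → y j = 0) →
        ‖F (toComplex x + y) - F (toComplex x)‖ ≤ C₆ * δ k)

/-! ### The Knothe–Rosenblatt transport -/

/-- The marginal density of the first `k` variables, as a function of the full vector `x` (of which
only the first `k` coordinates enter). The integration variable `t` runs over the whole cube; its
first `k` coordinates do not enter the integrand, and the measure has total mass one. -/
def marginal {d : ℕ} (f : (Fin d → ℝ) → ℝ) (k : ℕ) (x : Fin d → ℝ) : ℝ :=
  ∫ t, f (fun j => if (j : ℕ) < k then x j else t j) ∂(cubeMeasure d)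

/-- The density of the variable `k` (counted from `0`) conditioned on the variables before it. -/
def condDensity {d : ℕ} (f : (Fin d → ℝ) → ℝ) (k : Fin d) (x : Fin d → ℝ) : ℝ :=
  marginal f (k + 1) x / marginal f k x

/-- The conditional distribution function `s ↦ ∫_{-1}^s f_k(x_0, …, x_{k-1}, t) dt`. -/
def condCDF {d : ℕ} (f : (Fin d → ℝ) → ℝ) (k : Fin d) (x : Fin d → ℝ) (s : ℝ) : ℝ :=
  ∫ t in (-1 : ℝ)..s, condDensity f k (Function.update x k t)

/-- The vector whose first `n` coordinates are the first `n` components of the Knothe–Rosenblatt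
map at `x`. Component `n` is obtained from the earlier ones by applying the inverse, on `[-1,1]`,
of the conditional distribution function of the target to the one of the reference. -/
def transportAux {d : ℕ} (fρ fπ : (Fin d → ℝ) → ℝ) (x : Fin d → ℝ) : ℕ → Fin d → ℝ
  | 0 => x
  | n + 1 =>
    if h : n < d then
      Function.update (transportAux fρ fπ x n) ⟨n, h⟩
        (Function.invFunOn (condCDF fπ ⟨n, h⟩ (transportAux fρ fπ x n)) (Icc (-1) 1)
          (condCDF fρ ⟨n, h⟩ x (x ⟨n, h⟩)))
    else transportAux fρ fπ x n

/-- The Knothe–Rosenblatt transport from the measure with density `fρ` to the one with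
density `fπ`. -/
def transport {d : ℕ} (fρ fπ : (Fin d → ℝ) → ℝ) (x : Fin d → ℝ) : Fin d → ℝ :=
  transportAux fρ fπ x d

/-- The inverse on `[-1,1]^d` of the Knothe–Rosenblatt transport. -/
def invTransport {d : ℕ} (fρ fπ : (Fin d → ℝ) → ℝ) : (Fin d → ℝ) → (Fin d → ℝ) :=
  Function.invFunOn (transport fρ fπ) (cube d)

/-- `T` maps `[-1,1]^d` bijectively to itself, its component `k` depends only on the coordinates
up to `k`, and is increasing in the coordinate `k`. -/
structure IsMonotoneTriangularBijection {d : ℕ} (T : (Fin d → ℝ) → (Fin d → ℝ)) : Prop where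
  triangular : ∀ k, ∀ x ∈ cube d, ∀ y ∈ cube d, (∀ j ≤ k, x j = y j) → T x k = T y k
  monotone : ∀ k, ∀ x ∈ cube d,
    StrictMonoOn (fun s => T (Function.update x k s) k) (Icc (-1) 1)
  bijOn : BijOn T (cube d) (cube d)

/-! ### The polynomial spaces and the rational maps -/

/-- The first `k + 1` entries of a vector, that is, those with index `≤ k`. -/
def initialSegment {d : ℕ} (k : Fin d) (x : Fin d → ℝ) : Fin ((k : ℕ) + 1) → ℝ :=
  fun j => x (Fin.castLE k.isLt j)

/-- `γ(ξ, ν) = ξ_n ^ (-max {1, ν_n}) * ∏_{j < n} ξ_j ^ (-ν_j)`, for `n + 1` variables. -/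
def gammaWeight {n : ℕ} (ξ : Fin (n + 1) → ℝ) (ν : Fin (n + 1) →₀ ℕ) : ℝ :=
  (ξ (Fin.last n) ^ max 1 (ν (Fin.last n)))⁻¹ * ∏ j : Fin n, (ξ j.castSucc ^ ν j.castSucc)⁻¹

/-- The set of multi-indices `ν` with `γ(ξ, ν) ≥ ε`, for the variables with index `≤ k`. -/
def indexSet {d : ℕ} (ξ : Fin d → ℝ) (k : Fin d) (ε : ℝ) : Set (Fin ((k : ℕ) + 1) →₀ ℕ) :=
  {ν | ε ≤ gammaWeight (initialSegment k ξ) ν}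

/-- The total number of degrees of freedom. -/
def totalCard {d : ℕ} (ξ : Fin d → ℝ) (ε : ℝ) : ℕ := ∑ k : Fin d, (indexSet ξ k ε).ncard

/-- `β = ((d-1)! ∏_j log ξ_j)^(1/d)`. -/
def rate {d : ℕ} (ξ : Fin d → ℝ) : ℝ :=
  (((d - 1).factorial : ℝ) * ∏ j, Real.log (ξ j)) ^ (1 / (d : ℝ))

/-- `∫_{-1}^s (1 + p(x_0, …, x_{k-1}, t))² dt`. -/
def squareIntegral {d : ℕ} (k : Fin d) (p : MvPolynomial (Fin ((k : ℕ) + 1)) ℝ)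
    (x : Fin d → ℝ) (s : ℝ) : ℝ :=
  ∫ t in (-1 : ℝ)..s, (1 + MvPolynomial.eval (initialSegment k (Function.update x k t)) p) ^ 2

/-- The map with components
`x ↦ -1 + (2 / c_k) ∫_{-1}^{x_k} (1 + p_k(x_0, …, x_{k-1}, t))² dt`,
where `c_k = ∫_{-1}^1 (1 + p_k(x_0, …, x_{k-1}, t))² dt`. -/
def rationalMap {d : ℕ} (p : (k : Fin d) → MvPolynomial (Fin ((k : ℕ) + 1)) ℝ)
    (x : Fin d → ℝ) : Fin d → ℝ :=
  fun k => -1 + 2 / squareIntegral k (p k) x 1 * squareIntegral k (p k) x (x k)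

/-! ### The Sobolev norm -/

/-- The partial derivative in the direction of the coordinate `j`. -/
def partialDeriv {d : ℕ} (j : Fin d) (φ : (Fin d → ℝ) → ℝ) : (Fin d → ℝ) → ℝ :=
  fun x => fderiv ℝ φ x (Pi.single j 1)

/-- The mixed partial derivative `∂_0^{ν_0} ⋯ ∂_{d-1}^{ν_{d-1}} φ`. -/
def mixedPartial {d : ℕ} (ν : Fin d → ℕ) (φ : (Fin d → ℝ) → ℝ) : (Fin d → ℝ) → ℝ :=
  (List.finRange d).foldr (fun j g => (partialDeriv j)^[ν j] g) φ

/-- `v` is the weak derivative of order `ν` of `u` on the open cube. -/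
def IsWeakDeriv {d : ℕ} (ν : Fin d → ℕ) (u v : (Fin d → ℝ) → ℝ) : Prop :=
  LocallyIntegrableOn u (openCube d) ∧ LocallyIntegrableOn v (openCube d) ∧
  ∀ φ : (Fin d → ℝ) → ℝ, ContDiff ℝ ∞ φ → HasCompactSupport φ → tsupport φ ⊆ openCube d →
    ∫ x in openCube d, u x * mixedPartial ν φ x =
      (-1) ^ (∑ j, ν j) * ∫ x in openCube d, v x * φ x

/-- The norm of `W^{m,∞}([-1,1]^d)`: the maximum over `|ν| ≤ m` of the `L^∞` norms of the weak
derivatives of order `ν`. Weak derivatives are unique almost everywhere, so the infimum picks the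
norm of the weak derivative if there is one, and it is `∞` if there is none. -/
def sobolevNorm {d : ℕ} (m : ℕ) (u : (Fin d → ℝ) → ℝ) : ℝ≥0∞ :=
  ⨆ (ν : Fin d → ℕ) (_ : ∑ j, ν j ≤ m),
    ⨅ (v : (Fin d → ℝ) → ℝ) (_ : IsWeakDeriv ν u v),
      eLpNorm v ∞ (volume.restrict (openCube d))

/-- For every `ε ∈ (0,1)` there are polynomials `p_k` in the span of the monomials with exponents in
`Λ_{k,ε}` for which `rationalMap p` is a monotone triangular bijection of the cube whose components
approximate those of `T` in `W^{m,∞}` with error at most `C exp(-τ β N_ε^{1/d})`. -/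
def HasRationalApprox {d : ℕ} (ξ : Fin d → ℝ) (m : ℕ) (τ C : ℝ)
    (T : (Fin d → ℝ) → (Fin d → ℝ)) : Prop :=
  ∀ ε ∈ Ioo (0 : ℝ) 1,
    ∃ p : (k : Fin d) → MvPolynomial (Fin ((k : ℕ) + 1)) ℝ,
      (∀ k, p k ∈ MvPolynomial.restrictSupport ℝ (indexSet ξ k ε)) ∧
      IsMonotoneTriangularBijection (rationalMap p) ∧
      ∀ k, sobolevNorm m (fun x => T x k - rationalMap p x k) ≤
        ENNReal.ofReal
          (C * Real.exp (-(τ * rate ξ * (totalCard ξ ε : ℝ) ^ (1 / (d : ℝ)))))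

end KRApprox

end

noncomputable section

open scoped NNReal ENNReal ContDiff Topology

namespace KRApprox

open MeasureTheory Set Metric

section


/-! ### Parametric integrals -/

section ParametricIntegral

/-! The quantity to approximate is not `T_k` but the square root `R` of `∂_k T_k`: `T_k = -1 + ∫ R²`
with `∫_{-1}^1 R² = 2`, and the rational map is the same expression with `R` replaced by `1 + p`,
renormalised. Monotonicity and bijectivity are then automatic once `1 + p > 0` on the cube, and
everything reduces to a polynomial that is close to `R - 1` on a complex neighbourhood of the cube.

Holomorphy of `R` on the polydisc-like neighbourhood with radii `C₇ δ_j` is the analytic core. Let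
`a_k`, `b_k` be the complexified marginals of `fρ`, `fπ`, and let `P_a`, `P_b` be the primitives of
`a_{k+1}`, `b_{k+1}` in the variable `k`. The transport `W` solves `P_b(W) = b_k(W) P_a(z) /
a_k(z)`, one component after the other. The variation bound (c) gives `Re b_{k+1} ≥ M / 2`, so `P_b`
is expanding and hence injective in its variable, and a quantitative open mapping theorem makes it
cover a disc of radius `M δ_k / 8` about each value taken on `[-1,1]`. By (d) the right-hand side is
within a small multiple of `δ_k` of such a value. So a unique solution exists (`exists_near_target`,
`exists_segPrimitive_eq`), and the implicit function theorem makes it holomorphic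
(`PartialExtension.exists_succ`). Differentiating the equation expresses `∂_k W_k` through `a`, `b`
and `W`, which gives a bounded `R` (`exists_rootExtension`).

A bounded holomorphic function on the neighbourhood with radii `ρ_j - 1` has Chebyshev coefficients
of size `∏ ρ_j^{-ν_j}`. Expanding one variable at a time gives polynomials of weighted degree `≤ ℓ`,
with weights `log ρ_j`, and error `exp(-τℓ)` on a thinner complex neighbourhood
(`exists_polynomial_approx`). Sup bounds there become `W^{m,∞}` bounds by Cauchy's inequality
(`exists_sobolevNorm_le`), and the passage from `R` to `T_k` is Lipschitz
(`RootExtension.exists_stability`).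

Finally, `Λ_{k,ε}` contains the weighted simplex of level `log(1/ε) - log ξ_k`, while counting
lattice points gives `β N_ε^{1/d} ≤ log(1/ε) + K` (`exists_rate_mul_le`). The bounded shifts are
absorbed in `C`. On the cube the inverse `S` is the transport with `fρ` and `fπ` exchanged, so the
same argument covers it. -/

theorem exists_closedBall_bound {E X G : Type*} [NormedAddCommGroup E] [ProperSpace E]
    [TopologicalSpace X] [NormedAddCommGroup G] {K : Set X} {U : Set E}
    (hK : IsCompact K) (hU : IsOpen U) {Ψ : E → X → G}
    (hc : ContinuousOn (Function.uncurry Ψ) (U ×ˢ K)) {z : E} (hz : z ∈ U) :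
    ∃ r > 0, closedBall z r ⊆ U ∧ ∃ C, ∀ w ∈ closedBall z r, ∀ t ∈ K, ‖Ψ w t‖ ≤ C := by
  obtain ⟨r, hr, hrU⟩ := Metric.nhds_basis_closedBall.mem_iff.1 (hU.mem_nhds hz)
  obtain ⟨C, hC⟩ := ((isCompact_closedBall z r).prod hK).exists_bound_of_continuousOn
    (hc.mono (Set.prod_mono hrU subset_rfl))
  exact ⟨r, hr, hrU, C, fun w hw t ht => hC (w, t) ⟨hw, ht⟩⟩

theorem continuousOn_uncurry_right {E X G : Type*} [TopologicalSpace E] [TopologicalSpace X]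
    [TopologicalSpace G] {K : Set X} {U : Set E} {Ψ : E → X → G}
    (hc : ContinuousOn (Function.uncurry Ψ) (U ×ˢ K)) {z : E} (hz : z ∈ U) :
    ContinuousOn (Ψ z) K :=
  hc.comp (f := fun t => (z, t)) (by fun_prop) fun t ht => ⟨hz, ht⟩

variable {E X G : Type*} [NormedAddCommGroup E] [ProperSpace E]
  [TopologicalSpace X] [SecondCountableTopology X] [MeasurableSpace X] [OpensMeasurableSpace X]
  [NormedAddCommGroup G] [NormedSpace ℝ G]
  {μ : Measure X} [IsFiniteMeasureOnCompacts μ] {K : Set X} {U : Set E}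

theorem continuousOn_setIntegral (hK : IsCompact K) (hKm : MeasurableSet K) (hU : IsOpen U)
    {Ψ : E → X → G} (hc : ContinuousOn (Function.uncurry Ψ) (U ×ˢ K)) :
    ContinuousOn (fun z => ∫ t in K, Ψ z t ∂μ) U := by
  intro z hz
  obtain ⟨r, hr, hrU, C, hC⟩ := exists_closedBall_bound hK hU hc hz
  refine ContinuousAt.continuousWithinAt ?_
  apply continuousAt_of_dominated (bound := fun _ => C)
  · filter_upwards [hU.mem_nhds hz] with w hw
    exact (continuousOn_uncurry_right hc hw).aestronglyMeasurable hKm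
  · filter_upwards [closedBall_mem_nhds z hr] with w hw
    exact (ae_restrict_iff' hKm).2 (Filter.Eventually.of_forall fun t ht => hC w hw t ht)
  · exact integrableOn_const hK.measure_ne_top
  · refine (ae_restrict_iff' hKm).2 (Filter.Eventually.of_forall fun t ht => ?_)
    have : ContinuousOn (fun w => Ψ w t) U :=
      hc.comp (f := fun w => (w, t)) (by fun_prop) fun w hw => ⟨hw, ht⟩
    exact this.continuousAt (hU.mem_nhds hz)

variable [NormedSpace ℂ E]

theorem contDiffOn_one_iff_fderiv {E' : Type*} [NormedAddCommGroup E'] [NormedSpace ℂ E']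
    {F : E' → ℂ} {Ω : Set E'} (hΩ : IsOpen Ω) :
    ContDiffOn ℂ 1 F Ω ↔ DifferentiableOn ℂ F Ω ∧ ContinuousOn (fderiv ℂ F) Ω := by
  rw [← zero_add 1, contDiffOn_succ_iff_fderiv_of_isOpen hΩ]
  simp [contDiffOn_zero]

theorem hasFDerivAt_setIntegral (hK : IsCompact K) (hKm : MeasurableSet K) (hU : IsOpen U)
    {Φ : E → X → ℂ} {Φ' : E → X → E →L[ℂ] ℂ}
    (hd : ∀ z ∈ U, ∀ t ∈ K, HasFDerivAt (fun w => Φ w t) (Φ' z t) z)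
    (hc : ContinuousOn (Function.uncurry Φ) (U ×ˢ K))
    (hc' : ContinuousOn (Function.uncurry Φ') (U ×ˢ K)) {z : E} (hz : z ∈ U) :
    HasFDerivAt (fun w => ∫ t in K, Φ w t ∂μ) (∫ t in K, Φ' z t ∂μ) z := by
  obtain ⟨r, hr, hrU, C, hC⟩ := exists_closedBall_bound hK hU hc' hz
  apply hasFDerivAt_integral_of_dominated_of_fderiv_le (bound := fun _ => C)
    (closedBall_mem_nhds z hr)
  · filter_upwards [hU.mem_nhds hz] with w hw
    exact (continuousOn_uncurry_right hc hw).aestronglyMeasurable hKm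
  · exact (continuousOn_uncurry_right hc hz).integrableOn_compact' hK hKm
  · exact (continuousOn_uncurry_right hc' hz).aestronglyMeasurable hKm
  · exact (ae_restrict_iff' hKm).2 (Filter.Eventually.of_forall fun t ht w hw => hC w hw t ht)
  · exact integrableOn_const hK.measure_ne_top
  · exact (ae_restrict_iff' hKm).2 (Filter.Eventually.of_forall fun t ht w hw =>
      hd w (hrU hw) t ht)

/-- Compactness of `K` and local compactness of the parameter space bound the derivative locally
uniformly, so differentiation under the integral needs no further domination hypothesis. Its affine
special case below serves Chebyshev coefficients, Cauchy integrals, marginals and primitives alike.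
-/
theorem contDiffOn_setIntegral (hK : IsCompact K) (hKm : MeasurableSet K) (hU : IsOpen U)
    {Φ : E → X → ℂ} {Φ' : E → X → E →L[ℂ] ℂ}
    (hd : ∀ z ∈ U, ∀ t ∈ K, HasFDerivAt (fun w => Φ w t) (Φ' z t) z)
    (hc : ContinuousOn (Function.uncurry Φ) (U ×ˢ K))
    (hc' : ContinuousOn (Function.uncurry Φ') (U ×ˢ K)) :
    ContDiffOn ℂ 1 (fun w => ∫ t in K, Φ w t ∂μ) U := by
  have h := fun z hz => hasFDerivAt_setIntegral (μ := μ) hK hKm hU hd hc hc' (z := z) hz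
  rw [contDiffOn_one_iff_fderiv hU]
  refine ⟨fun z hz => (h z hz).differentiableAt.differentiableWithinAt, ?_⟩
  exact (continuousOn_setIntegral hK hKm hU hc').congr fun z hz => (h z hz).fderiv

/-- Integrals of a holomorphic function along a family of affine maps depend holomorphically on
the parameter. -/
theorem contDiffOn_setIntegral_comp_affine {E' : Type*} [NormedAddCommGroup E'] [NormedSpace ℂ E']
    (hK : IsCompact K) (hKm : MeasurableSet K) (hU : IsOpen U)
    {F : E' → ℂ} {Ω : Set E'} (hΩ : IsOpen Ω) (hF : ContDiffOn ℂ 1 F Ω)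
    {A : X → E →L[ℂ] E'} (hA : ContinuousOn A K) {c : X → E'} (hcc : ContinuousOn c K)
    {φ : X → ℂ} (hφ : ContinuousOn φ K)
    (hm : ∀ z ∈ U, ∀ t ∈ K, A t z + c t ∈ Ω) :
    ContDiffOn ℂ 1 (fun z => ∫ t in K, φ t * F (A t z + c t) ∂μ) U := by
  have hin : ContinuousOn (fun q : E × X => A q.2 q.1 + c q.2) (U ×ˢ K) := by
    have h1 : ContinuousOn (fun q : E × X => A q.2) (U ×ˢ K) :=
      hA.comp continuousOn_snd fun q hq => hq.2
    have h2 : ContinuousOn (fun q : E × X => c q.2) (U ×ˢ K) :=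
      hcc.comp continuousOn_snd fun q hq => hq.2
    exact (h1.clm_apply continuousOn_fst).add h2
  have hmaps : MapsTo (fun q : E × X => A q.2 q.1 + c q.2) (U ×ˢ K) Ω :=
    fun q hq => hm q.1 hq.1 q.2 hq.2
  have hφ' : ContinuousOn (fun q : E × X => φ q.2) (U ×ˢ K) :=
    hφ.comp continuousOn_snd fun q hq => hq.2
  have hA' : ContinuousOn (fun q : E × X => A q.2) (U ×ˢ K) :=
    hA.comp continuousOn_snd fun q hq => hq.2
  obtain ⟨hFd, hFc⟩ := (contDiffOn_one_iff_fderiv hΩ).1 hF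
  refine contDiffOn_setIntegral hK hKm hU
    (Φ' := fun z t => φ t • (fderiv ℂ F (A t z + c t)).comp (A t)) ?_ ?_ ?_
  · intro z hz t ht
    have h1 : HasFDerivAt F (fderiv ℂ F (A t z + c t)) (A t z + c t) :=
      (hFd.differentiableAt (hΩ.mem_nhds (hm z hz t ht))).hasFDerivAt
    have h2 : HasFDerivAt (fun w => A t w + c t) (A t) z := (A t).hasFDerivAt.add_const _
    exact (h1.comp z h2).const_mul _
  · exact hφ'.mul (hF.continuousOn.comp hin hmaps)
  · exact hφ'.smul ((hFc.comp hin hmaps).clm_comp hA')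

end ParametricIntegral

/-! ### Complex neighbourhoods of the cube -/

/-- The open `r`-neighbourhood of `[-1,1]` in the complex plane. -/
def intervalNhd (r : ℝ) : Set ℂ := {z | ∃ y ∈ Icc (-1 : ℝ) 1, ‖z - (y : ℂ)‖ < r}

theorem intervalNhd_eq (r : ℝ) :
    intervalNhd r = thickening r ((fun y : ℝ => (y : ℂ)) '' Icc (-1) 1) := by
  ext z
  simp [intervalNhd, mem_thickening_iff, dist_eq_norm]

theorem isOpen_intervalNhd (r : ℝ) : IsOpen (intervalNhd r) := by
  rw [intervalNhd_eq]; exact isOpen_thickening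

theorem convex_intervalNhd (r : ℝ) : Convex ℝ (intervalNhd r) := by
  rw [intervalNhd_eq]
  exact ((convex_Icc (-1 : ℝ) 1).linear_image Complex.ofRealCLM.toLinearMap).thickening r

theorem intervalNhd_mono {r s : ℝ} (h : r ≤ s) : intervalNhd r ⊆ intervalNhd s :=
  fun _ ⟨y, hy, hz⟩ => ⟨y, hy, hz.trans_le h⟩

theorem ofReal_mem_intervalNhd {r : ℝ} (hr : 0 < r) {x : ℝ} (hx : x ∈ Icc (-1 : ℝ) 1) :
    (x : ℂ) ∈ intervalNhd r := ⟨x, hx, by simpa using hr⟩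

variable {d : ℕ}

theorem complexNhd_eq_pi (δ : Fin d → ℝ) :
    complexNhd δ = Set.pi univ fun j => intervalNhd (δ j) := by
  ext z; simp [complexNhd, intervalNhd]

theorem mem_complexNhd_iff {δ : Fin d → ℝ} {z : Fin d → ℂ} :
    z ∈ complexNhd δ ↔ ∀ j, z j ∈ intervalNhd (δ j) := Iff.rfl

theorem isOpen_complexNhd (δ : Fin d → ℝ) : IsOpen (complexNhd δ) := by
  rw [complexNhd_eq_pi]
  exact isOpen_set_pi finite_univ fun j _ => isOpen_intervalNhd _

theorem complexNhd_mono {δ δ' : Fin d → ℝ} (h : ∀ j, δ j ≤ δ' j) :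
    complexNhd δ ⊆ complexNhd δ' :=
  fun _ hz j => intervalNhd_mono (h j) (hz j)

theorem exists_cube_near {δ : Fin d → ℝ} {z : Fin d → ℂ} (hz : z ∈ complexNhd δ) :
    ∃ x ∈ cube d, ∀ j, ‖z j - (x j : ℂ)‖ < δ j := by
  choose x hx hxz using hz
  exact ⟨x, hx, hxz⟩

theorem toComplex_mem_complexNhd {δ : Fin d → ℝ} (hδ : ∀ j, 0 < δ j) {x : Fin d → ℝ}
    (hx : x ∈ cube d) : toComplex x ∈ complexNhd δ :=
  fun j => ofReal_mem_intervalNhd (hδ j) (hx j)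

theorem update_mem_complexNhd {δ : Fin d → ℝ} {z : Fin d → ℂ} (hz : z ∈ complexNhd δ) {k : Fin d}
    {s : ℂ} (hs : s ∈ intervalNhd (δ k)) : Function.update z k s ∈ complexNhd δ := by
  rw [mem_complexNhd_iff] at hz ⊢
  intro j
  rcases eq_or_ne j k with rfl | h
  · simpa using hs
  · simpa [h] using hz j

theorem update_mem_cube {x : Fin d → ℝ} (hx : x ∈ cube d) {k : Fin d}
    {s : ℝ} (hs : s ∈ Icc (-1 : ℝ) 1) : Function.update x k s ∈ cube d := by
  intro j
  rcases eq_or_ne j k with rfl | h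
  · simpa using hs
  · simpa [h] using hx j

theorem toComplex_update (x : Fin d → ℝ) (k : Fin d) (s : ℝ) :
    toComplex (Function.update x k s) = Function.update (toComplex x) k (s : ℂ) := by
  ext j
  rcases eq_or_ne j k with rfl | h
  · simp [toComplex]
  · simp [toComplex, h]

theorem cube_eq_pi (d : ℕ) : cube d = Set.pi univ fun _ => Icc (-1 : ℝ) 1 := by
  ext x; simp only [cube, mem_ofPred_eq, mem_univ_pi]

theorem openCube_eq_pi (d : ℕ) : openCube d = Set.pi univ fun _ => Ioo (-1 : ℝ) 1 := by
  ext x; simp only [openCube, mem_ofPred_eq, mem_univ_pi]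

theorem isCompact_cube (d : ℕ) : IsCompact (cube d) := by
  rw [cube_eq_pi]; exact isCompact_univ_pi fun _ => isCompact_Icc

theorem measurableSet_cube (d : ℕ) : MeasurableSet (cube d) := (isCompact_cube d).measurableSet

theorem isOpen_openCube (d : ℕ) : IsOpen (openCube d) := by
  rw [openCube_eq_pi]; exact isOpen_set_pi finite_univ fun _ _ => isOpen_Ioo

theorem openCube_subset_cube (d : ℕ) : openCube d ⊆ cube d :=
  fun _ hx j => Ioo_subset_Icc_self (hx j)

theorem continuous_toComplex : Continuous (toComplex : (Fin d → ℝ) → Fin d → ℂ) := by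
  unfold toComplex; fun_prop

/-- A neighbourhood of the cube contains a complex neighbourhood of uniform radius. -/
theorem exists_complexNhd_subset {U : Set (Fin d → ℂ)} (hU : IsOpen U)
    (h : ∀ x ∈ cube d, toComplex x ∈ U) : ∃ r > 0, complexNhd (fun _ : Fin d => r) ⊆ U := by
  obtain ⟨r, hr, hrU⟩ := ((isCompact_cube d).image continuous_toComplex).exists_thickening_subset_open
    hU (by rintro _ ⟨x, hx, rfl⟩; exact h x hx)
  refine ⟨r, hr, fun z hz => hrU ?_⟩
  obtain ⟨x, hx, hxz⟩ := exists_cube_near hz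
  refine mem_thickening_iff.2 ⟨_, mem_image_of_mem _ hx, ?_⟩
  rw [dist_pi_lt_iff hr]
  intro j
  rw [dist_eq_norm]
  exact hxz j

end

section


/-! ### Chebyshev expansions in one variable -/

theorem le_of_add_inv_le {s σ : ℝ} (hs : 0 < s) (hσ : 1 ≤ σ) (h : s + s⁻¹ ≤ σ + σ⁻¹) : s ≤ σ := by
  by_contra! hlt
  have hσ0 : 0 < σ := by linarith
  have h1 : s + s⁻¹ - (σ + σ⁻¹) = (s - σ) * (s * σ - 1) / (s * σ) := by field_simp; ring
  have h2 : 0 < (s - σ) * (s * σ - 1) / (s * σ) := by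
    apply div_pos (mul_pos (by linarith) _) (by positivity)
    nlinarith
  linarith

/-- Chebyshev polynomials grow slowly close to `[-1,1]`. -/
theorem norm_eval_T_le {r σ : ℝ} (hσ : 1 ≤ σ) (hr : 2 + 2 * r ≤ σ + σ⁻¹) {z : ℂ}
    (hz : z ∈ intervalNhd r) (m : ℕ) : ‖(Polynomial.Chebyshev.T ℂ m).eval z‖ ≤ σ ^ m := by
  obtain ⟨ζ, rfl⟩ := Complex.cos_surjective z
  set w := Complex.exp (ζ * Complex.I) with hw
  have hw0 : w ≠ 0 := Complex.exp_ne_zero _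
  have hs0 : 0 < ‖w‖ := norm_pos_iff.2 hw0
  have hcos : Complex.cos ζ = (w + w⁻¹) / 2 := by
    rw [Complex.cos, hw, ← Complex.exp_neg]; ring_nf
  -- The focal property of the Bernstein ellipse: the distances from `(w + w⁻¹)/2` to `±1` add up to
  -- `‖w‖ + ‖w‖⁻¹`.
  have hsum : ‖Complex.cos ζ - 1‖ + ‖Complex.cos ζ + 1‖ = ‖w‖ + ‖w‖⁻¹ := by
    have e1 : Complex.cos ζ - 1 = (w - 1) ^ 2 / (2 * w) := by rw [hcos]; field_simp; ring
    have e2 : Complex.cos ζ + 1 = (w + 1) ^ 2 / (2 * w) := by rw [hcos]; field_simp; ring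
    have e3 := parallelogram_law_with_norm ℝ w 1
    rw [e1, e2, norm_div, norm_div, norm_pow, norm_pow, norm_mul]
    simp only [RCLike.norm_ofNat, norm_one] at e3 ⊢
    field_simp
    nlinarith
  obtain ⟨y, hy, hzy⟩ := hz
  have h1 : ‖Complex.cos ζ - 1‖ ≤ r + (1 - y) := by
    calc ‖Complex.cos ζ - 1‖ = ‖(Complex.cos ζ - y) + ((y - 1 : ℝ) : ℂ)‖ := by push_cast; ring_nf
      _ ≤ ‖Complex.cos ζ - y‖ + ‖((y - 1 : ℝ) : ℂ)‖ := norm_add_le _ _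
      _ ≤ r + (1 - y) := by
        rw [Complex.norm_real, Real.norm_eq_abs, abs_of_nonpos (by linarith [hy.2])]
        linarith
  have h2 : ‖Complex.cos ζ + 1‖ ≤ r + (1 + y) := by
    calc ‖Complex.cos ζ + 1‖ = ‖(Complex.cos ζ - y) + ((y + 1 : ℝ) : ℂ)‖ := by push_cast; ring_nf
      _ ≤ ‖Complex.cos ζ - y‖ + ‖((y + 1 : ℝ) : ℂ)‖ := norm_add_le _ _
      _ ≤ r + (1 + y) := by
        rw [Complex.norm_real, Real.norm_eq_abs, abs_of_nonneg (by linarith [hy.1])]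
        linarith
  have hle : ‖w‖ + ‖w‖⁻¹ ≤ σ + σ⁻¹ := by linarith
  have hs1 : ‖w‖ ≤ σ := le_of_add_inv_le hs0 hσ hle
  have hs2 : ‖w‖⁻¹ ≤ σ := le_of_add_inv_le (inv_pos.2 hs0) hσ (by rw [inv_inv]; linarith)
  have hT : (Polynomial.Chebyshev.T ℂ m).eval (Complex.cos ζ) = (w ^ m + w⁻¹ ^ m) / 2 := by
    rw [Polynomial.Chebyshev.T_complex_cos, Complex.cos, hw, ← Complex.exp_neg, ← Complex.exp_nat_mul,
      ← Complex.exp_nat_mul]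
    push_cast
    ring_nf
  rw [hT, norm_div, RCLike.norm_ofNat]
  have h3 : ‖w ^ m + w⁻¹ ^ m‖ ≤ σ ^ m + σ ^ m := by
    refine (norm_add_le _ _).trans ?_
    rw [norm_pow, norm_pow, norm_inv]
    gcongr
  linarith

/-- The Chebyshev coefficients of a function on `[-1,1]`. -/
def chebCoeff (f : ℂ → ℂ) (m : ℕ) : ℂ :=
  ∫ θ in Icc (0 : ℝ) (2 * Real.pi),
    (((if m = 0 then 1 else 2) / (2 * Real.pi) * Real.cos (m * θ) : ℝ) : ℂ) * f (Real.cos θ)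

/-- The Fourier coefficients of `f ∘ cos`. -/
def cosFourier (f : ℂ → ℂ) (n : ℤ) : ℂ :=
  (1 / (2 * Real.pi) : ℝ) • ∫ θ in (0 : ℝ)..2 * Real.pi,
    Complex.exp (-(n * θ * Complex.I)) * f (Real.cos θ)

theorem continuous_comp_cos {f : ℂ → ℂ} {r : ℝ} (hr : 0 < r) (hf : ContinuousOn f (intervalNhd r)) :
    Continuous fun θ : ℝ => f (Real.cos θ) := by
  rw [← continuousOn_univ]
  exact hf.comp (by fun_prop) fun θ _ => ofReal_mem_intervalNhd hr (Real.cos_mem_Icc θ)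

/-- Evenness of the cosine: substitute `θ ↦ 2π - θ`; the extra phase `2πin` is invisible to the
exponential. -/
theorem cosFourier_neg (f : ℂ → ℂ) (n : ℤ) : cosFourier f (-n) = cosFourier f n := by
  unfold cosFourier
  congr 1
  have h := intervalIntegral.integral_comp_sub_left (a := 0) (b := 2 * Real.pi)
    (fun θ : ℝ => Complex.exp (-(n * θ * Complex.I)) * f (Real.cos θ)) (2 * Real.pi)
  rw [sub_self, sub_zero] at h
  rw [← h]
  refine intervalIntegral.integral_congr fun θ _ => ?_
  simp only [Real.cos_two_pi_sub]
  congr 1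
  rw [Complex.exp_eq_exp_iff_exists_int]
  exact ⟨n, by push_cast; ring⟩

theorem chebCoeff_eq {f : ℂ → ℂ} {r : ℝ} (hr : 0 < r) (hf : ContinuousOn f (intervalNhd r))
    (m : ℕ) : chebCoeff f m = (if m = 0 then 1 else 2) * cosFourier f m := by
  have hc := continuous_comp_cos hr hf
  have h2 : cosFourier f m = (1 / (2 * Real.pi) : ℝ) • ∫ θ in (0 : ℝ)..2 * Real.pi,
      (Real.cos (m * θ) : ℂ) * f (Real.cos θ) := by
    have h1 : cosFourier f m = (1 / 2 : ℂ) * (cosFourier f m + cosFourier f (-m)) := by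
      rw [cosFourier_neg]; ring
    rw [h1]
    unfold cosFourier
    have hint : ∀ n : ℤ, IntervalIntegrable
        (fun θ : ℝ => Complex.exp (-(n * θ * Complex.I)) * f (Real.cos θ)) volume 0
        (2 * Real.pi) := fun n =>
      (Continuous.mul (by fun_prop) hc).intervalIntegrable _ _
    rw [← smul_add, ← intervalIntegral.integral_add (hint _) (hint _), mul_smul_comm,
      ← intervalIntegral.integral_const_mul]
    congr 1
    refine intervalIntegral.integral_congr fun θ _ => ?_
    simp only [Complex.ofReal_cos, Complex.cos]
    push_cast
    ring_nf
  rw [h2, chebCoeff, intervalIntegral.integral_of_le (by positivity), integral_Icc_eq_integral_Ioc,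
    Complex.real_smul, ← integral_const_mul, ← integral_const_mul]
  refine integral_congr_ae (Filter.Eventually.of_forall fun θ => ?_)
  simp only
  split_ifs <;> push_cast <;> ring

/-- The Bernstein ellipse of parameter `r < ρ` stays within `ρ - 1` of the interval. With `w = r u`
and `‖u‖ = 1`, the nearby real point is `Re u = (u + u⁻¹)/2`, and the displacement is at most `(r -
1)/2 + (1 - r⁻¹)/2 ≤ r - 1`. This is why a radius `C₇ δ_j` yields the base `ξ_j = 1 + C₇ δ_j`. -/
theorem add_inv_mem_intervalNhd {ρ r : ℝ} (h1 : 1 ≤ r) (h2 : r < ρ) {w : ℂ} (hw : ‖w‖ = r) :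
    (w + w⁻¹) / 2 ∈ intervalNhd (ρ - 1) := by
  have hr : 0 < r := by linarith
  have hw0 : w ≠ 0 := norm_pos_iff.1 (hw ▸ hr)
  set u : ℂ := w / r with hu
  have hrC : (r : ℂ) ≠ 0 := by exact_mod_cast hr.ne'
  have hun : ‖u‖ = 1 := by rw [hu, norm_div, hw, Complex.norm_real, Real.norm_of_nonneg hr.le,
    div_self hr.ne']
  have huinv : u⁻¹ = (starRingEnd ℂ) u := by
    rw [Complex.inv_def, Complex.normSq_eq_norm_sq, hun]; simp
  have hwu : w = r * u := by rw [hu]; field_simp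
  refine ⟨u.re, ?_, ?_⟩
  · have := Complex.abs_re_le_norm u
    rw [hun] at this
    exact abs_le.1 this
  · have hre : (u.re : ℂ) = (u + u⁻¹) / 2 := by rw [huinv, Complex.re_eq_add_conj]
    have hu0 : u ≠ 0 := norm_pos_iff.1 (by rw [hun]; norm_num)
    have e : (w + w⁻¹) / 2 - (u.re : ℂ)
        = (((r - 1) / 2 : ℝ) : ℂ) * u - (((1 - r⁻¹) / 2 : ℝ) : ℂ) * u⁻¹ := by
      rw [hre, hwu, mul_inv]; push_cast; ring
    rw [e]
    have hri : r⁻¹ ≤ 1 := inv_le_one_of_one_le₀ h1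
    refine (norm_sub_le _ _).trans_lt ?_
    rw [norm_mul, norm_mul, norm_inv, hun, Complex.norm_real, Complex.norm_real,
      Real.norm_of_nonneg (by linarith), Real.norm_of_nonneg (by linarith)]
    have : 1 - r⁻¹ ≤ r - 1 := by
      have : r + r⁻¹ - 2 = (r - 1) ^ 2 / r := by field_simp; ring
      have : 0 ≤ (r - 1) ^ 2 / r := by positivity
      linarith
    linarith

/-- Under `w = exp(iθ)` the coefficient becomes a contour integral of `f((w + w⁻¹)/2) w^{-m-1}` over
the unit circle. The integrand is holomorphic for `1 ≤ ‖w‖ < ρ`, so the contour may be moved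
outward, which gains `r^{-m}`. -/
theorem norm_cosFourier_le {f : ℂ → ℂ} {ρ B : ℝ} (hρ : 1 < ρ)
    (hf : DifferentiableOn ℂ f (intervalNhd (ρ - 1)))
    (hB : ∀ z ∈ intervalNhd (ρ - 1), ‖f z‖ ≤ B) (m : ℕ) :
    ‖cosFourier f m‖ ≤ B * (ρ ^ m)⁻¹ := by
  set g : ℂ → ℂ := fun w => f ((w + w⁻¹) / 2) * (w ^ (m + 1))⁻¹ with hg
  have hJ : ∀ w : ℂ, 1 ≤ ‖w‖ → ‖w‖ < ρ → (w + w⁻¹) / 2 ∈ intervalNhd (ρ - 1) :=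
    fun w h1 h2 => add_inv_mem_intervalNhd h1 h2 rfl
  have hgd : ∀ w : ℂ, 1 ≤ ‖w‖ → ‖w‖ < ρ → DifferentiableAt ℂ g w := by
    intro w h1 h2
    have hw0 : w ≠ 0 := norm_pos_iff.1 (by linarith)
    have hfd : DifferentiableAt ℂ f ((w + w⁻¹) / 2) :=
      hf.differentiableAt ((isOpen_intervalNhd _).mem_nhds (hJ w h1 h2))
    have h3 : DifferentiableAt ℂ (fun w : ℂ => (w + w⁻¹) / 2) w :=
      (differentiableAt_id.add (differentiableAt_inv hw0)).div_const _
    exact (hfd.comp w h3).mul ((differentiableAt_id.pow _).inv (pow_ne_zero _ hw0))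
  have hone : (∮ w in C(0, 1), g w) = (2 * Real.pi * Complex.I) * cosFourier f m := by
    rw [circleIntegral, cosFourier, Complex.real_smul, ← mul_assoc,
      ← intervalIntegral.integral_const_mul]
    refine intervalIntegral.integral_congr fun θ _ => ?_
    have hpi : (Real.pi : ℂ) ≠ 0 := by exact_mod_cast Real.pi_ne_zero
    have hc : (circleMap 0 1 θ + (circleMap 0 1 θ)⁻¹) / 2 = (Real.cos θ : ℂ) := by
      rw [circleMap_zero, Complex.ofReal_one, one_mul, ← Complex.exp_neg, Complex.ofReal_cos,
        Complex.cos]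
      ring_nf
    have he : Complex.exp (-(((m : ℕ) : ℤ) * θ * Complex.I)) = (Complex.exp (θ * Complex.I) ^ m)⁻¹ := by
      rw [← Complex.exp_nat_mul, ← Complex.exp_neg]; push_cast; ring_nf
    simp only [hg, deriv_circleMap, smul_eq_mul]
    rw [hc, circleMap_zero, Complex.ofReal_one, one_mul, he, pow_succ]
    have := Complex.exp_ne_zero (θ * Complex.I)
    push_cast
    field_simp
  have hbound : ∀ r ∈ Ioo 1 ρ, ‖cosFourier f m‖ ≤ B * (r ^ m)⁻¹ := by
    rintro r ⟨hr1, hr2⟩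
    have h0 : 0 < r := by linarith
    have heq : (∮ w in C(0, r), g w) = ∮ w in C(0, 1), g w := by
      refine Complex.circleIntegral_eq_of_differentiable_on_annulus_off_countable one_pos hr1.le
        countable_empty ?_ ?_
      · rintro w ⟨hw1, hw2⟩
        simp only [mem_closedBall, mem_ball, dist_zero_right, not_lt] at hw1 hw2
        exact (hgd w hw2 (by linarith)).continuousAt.continuousWithinAt
      · rintro w ⟨⟨hw1, hw2⟩, -⟩
        simp only [mem_closedBall, mem_ball, dist_zero_right, not_le] at hw1 hw2
        exact hgd w hw2.le (by linarith)
    have hle : ‖∮ w in C(0, r), g w‖ ≤ 2 * Real.pi * r * (B * (r ^ (m + 1))⁻¹) := by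
      refine circleIntegral.norm_integral_le_of_norm_le_const h0.le fun w hw => ?_
      have hwr : ‖w‖ = r := by simpa using hw
      rw [hg, norm_mul, norm_inv, norm_pow, hwr]
      gcongr
      exact hB _ (hJ w (by linarith) (by linarith))
    rw [heq, hone, norm_mul] at hle
    have hn : ‖(2 * Real.pi * Complex.I : ℂ)‖ = 2 * Real.pi := by
      simp [Real.pi_pos.le]
    rw [hn] at hle
    have h2 : 2 * Real.pi * r * (B * (r ^ (m + 1))⁻¹) = 2 * Real.pi * (B * (r ^ m)⁻¹) := by
      rw [pow_succ]; field_simp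
    rw [h2] at hle
    exact le_of_mul_le_mul_left hle (by positivity)
  -- The neighbourhood is open, so only radii `r < ρ` are admissible; the bound at `ρ` itself comes
  -- from letting `r` increase to `ρ`.
  have ht : Filter.Tendsto (fun r : ℝ => B * (r ^ m)⁻¹) (𝓝[<] ρ) (𝓝 (B * (ρ ^ m)⁻¹)) := by
    have : ContinuousAt (fun r : ℝ => B * (r ^ m)⁻¹) ρ :=
      continuousAt_const.mul ((continuousAt_id.pow m).inv₀ (pow_ne_zero _ (by simp; linarith)))
    exact this.mono_left nhdsWithin_le_nhds
  exact ge_of_tendsto ht (Filter.mem_of_superset (Ioo_mem_nhdsLT hρ) hbound)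

theorem norm_chebCoeff_le {f : ℂ → ℂ} {ρ B : ℝ} (hρ : 1 < ρ)
    (hf : DifferentiableOn ℂ f (intervalNhd (ρ - 1)))
    (hB : ∀ z ∈ intervalNhd (ρ - 1), ‖f z‖ ≤ B) (m : ℕ) :
    ‖chebCoeff f m‖ ≤ 2 * B * (ρ ^ m)⁻¹ := by
  rw [chebCoeff_eq (by linarith) hf.continuousOn, norm_mul, mul_assoc]
  refine mul_le_mul ?_ (norm_cosFourier_le hρ hf hB m) (norm_nonneg _) (by norm_num)
  split_ifs <;> simp

/-- The Chebyshev series of `f` on `[-1,1]`. -/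
theorem hasSum_chebCoeff_real {f : ℂ → ℂ} {ρ B : ℝ} (hρ : 1 < ρ)
    (hf : DifferentiableOn ℂ f (intervalNhd (ρ - 1)))
    (hB : ∀ z ∈ intervalNhd (ρ - 1), ‖f z‖ ≤ B) {x : ℝ} (hx : x ∈ Icc (-1 : ℝ) 1) :
    HasSum (fun m : ℕ => chebCoeff f m * (Polynomial.Chebyshev.T ℂ m).eval (x : ℂ)) (f x) := by
  have : Fact (0 < 2 * Real.pi) := ⟨by positivity⟩
  have hr : 0 < ρ - 1 := by linarith
  have hgc : Continuous fun θ : AddCircle (2 * Real.pi) => f (Real.Angle.cos θ) := by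
    rw [← continuousOn_univ]
    exact hf.continuousOn.comp (Complex.continuous_ofReal.comp Real.Angle.continuous_cos).continuousOn
      fun θ _ => by
        induction θ using Real.Angle.induction_on with
        | _ θ => exact ofReal_mem_intervalNhd hr (by simpa using Real.cos_mem_Icc θ)
  set g : C(AddCircle (2 * Real.pi), ℂ) := ⟨_, hgc⟩ with hg
  have hcoef : ∀ n : ℤ, fourierCoeff g n = cosFourier f n := by
    intro n
    rw [fourierCoeff_eq_intervalIntegral _ n 0, cosFourier, zero_add]
    congr 1
    refine intervalIntegral.integral_congr fun θ _ => ?_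
    have hpi : (Real.pi : ℂ) ≠ 0 := by exact_mod_cast Real.pi_ne_zero
    simp only [fourier_coe_apply, smul_eq_mul, hg, ContinuousMap.coe_mk]
    have e1 : Real.Angle.cos ((θ : ℝ) : AddCircle (2 * Real.pi)) = Real.cos θ := rfl
    rw [e1]
    congr 2
    push_cast
    field_simp
  have hgeo : Summable fun m : ℕ => B * (ρ ^ m)⁻¹ := by
    simp_rw [← inv_pow]
    exact (summable_geometric_of_lt_one (by positivity) (inv_lt_one_of_one_lt₀ hρ)).mul_left B
  have hsumm : Summable (fourierCoeff g) := by
    rw [show fourierCoeff g = cosFourier f from funext hcoef]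
    refine Summable.of_nat_of_neg ?_ ?_
    · exact hgeo.of_norm_bounded (norm_cosFourier_le hρ hf hB)
    · simp_rw [cosFourier_neg]
      exact hgeo.of_norm_bounded (norm_cosFourier_le hρ hf hB)
  obtain ⟨θ, rfl⟩ : ∃ θ, Real.cos θ = x := ⟨Real.arccos x, Real.cos_arccos hx.1 hx.2⟩
  have h1 := (has_pointwise_sum_fourier_series_of_summable hsumm (θ : AddCircle (2 * Real.pi))).nat_add_neg
  have e1 : g (θ : AddCircle (2 * Real.pi)) = f (Real.cos θ) := rfl
  rw [e1] at h1
  -- Pairing the frequencies `m` and `-m` counts the frequency zero twice; one copy is removed here.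
  have h2 := h1.sub (hasSum_ite_eq 0 (cosFourier f 0))
  simp only [hcoef, cosFourier_neg, smul_eq_mul, fourier_zero, mul_one, add_sub_cancel_right] at h2
  refine h2.congr_fun fun m => ?_
  have hpi : (Real.pi : ℂ) ≠ 0 := by exact_mod_cast Real.pi_ne_zero
  rw [chebCoeff_eq hr hf.continuousOn, Complex.ofReal_cos, Polynomial.Chebyshev.T_complex_cos,
    Complex.cos]
  rcases Nat.eq_zero_or_pos m with rfl | hm
  · simp
  · simp only [fourier_coe_apply, hm.ne', if_false, sub_zero]
    push_cast
    have e2 : 2 * Real.pi * Complex.I * m * θ / (2 * Real.pi) = m * θ * Complex.I := by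
      field_simp
    have e3 : 2 * Real.pi * Complex.I * (-m) * θ / (2 * Real.pi) = -(m * θ) * Complex.I := by
      field_simp
    rw [e2, e3]
    ring

end

section


theorem summable_chebCoeff_bound {B ρ σ : ℝ} (hσ : 1 ≤ σ) (hσρ : σ < ρ) :
    Summable fun m : ℕ => 2 * B * (ρ ^ m)⁻¹ * σ ^ m := by
  have : ∀ m : ℕ, 2 * B * (ρ ^ m)⁻¹ * σ ^ m = 2 * B * (σ / ρ) ^ m := fun m => by
    rw [div_pow]; ring
  simp_rw [this]
  exact (summable_geometric_of_lt_one (div_nonneg (by linarith) (by linarith))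
    ((div_lt_one (by linarith)).2 hσρ)).mul_left _

/-- The Chebyshev series of a holomorphic function in a complex neighbourhood of `[-1,1]`. -/
theorem hasSum_chebCoeff {f : ℂ → ℂ} {ρ σ r B : ℝ} (hσ : 1 ≤ σ) (hσρ : σ < ρ)
    (hf : DifferentiableOn ℂ f (intervalNhd (ρ - 1)))
    (hB : ∀ z ∈ intervalNhd (ρ - 1), ‖f z‖ ≤ B) (hr0 : 0 < r) (hrρ : r ≤ ρ - 1)
    (hr : 2 + 2 * r ≤ σ + σ⁻¹) {z : ℂ} (hz : z ∈ intervalNhd r) :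
    HasSum (fun m : ℕ => chebCoeff f m * (Polynomial.Chebyshev.T ℂ m).eval z) (f z) := by
  have hρ : 1 < ρ := by linarith
  have hbd : ∀ (m : ℕ), ∀ w ∈ intervalNhd r,
      ‖chebCoeff f m * (Polynomial.Chebyshev.T ℂ m).eval w‖ ≤ 2 * B * (ρ ^ m)⁻¹ * σ ^ m := by
    intro m w hw
    rw [norm_mul]
    have h1 := norm_chebCoeff_le hρ hf hB m
    exact mul_le_mul h1 (norm_eval_T_le hσ hr hw m) (norm_nonneg _) ((norm_nonneg _).trans h1)
  have hs := summable_chebCoeff_bound (B := B) hσ hσρ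
  set G : ℂ → ℂ := fun w => ∑' m : ℕ, chebCoeff f m * (Polynomial.Chebyshev.T ℂ m).eval w with hG
  have hGd : DifferentiableOn ℂ G (intervalNhd r) :=
    Complex.differentiableOn_tsum_of_summable_norm hs
      (fun m => ((Polynomial.differentiable _).const_mul _).differentiableOn)
      (isOpen_intervalNhd r) hbd
  have hreal : ∀ x : ℝ, x ∈ Icc (-1 : ℝ) 1 → f x = G x := fun x hx =>
    (hasSum_chebCoeff_real hρ hf hB hx).tsum_eq.symm
  -- Identity theorem: both sides are holomorphic on a convex set and agree at the points `1/(n+1)`,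
  -- which accumulate at `0`.
  have heq : EqOn f G (intervalNhd r) := by
    refine AnalyticOnNhd.eqOn_of_preconnected_of_frequently_eq
      ((hf.mono (intervalNhd_mono hrρ)).analyticOnNhd (isOpen_intervalNhd r))
      (hGd.analyticOnNhd (isOpen_intervalNhd r)) (convex_intervalNhd r).isPreconnected
      (z₀ := ((0 : ℝ) : ℂ)) (ofReal_mem_intervalNhd hr0 (by norm_num)) ?_
    have ht : Filter.Tendsto (fun n : ℕ => (((1 : ℝ) / ((n : ℝ) + 1) : ℝ) : ℂ)) Filter.atTop
        (𝓝[≠] ((0 : ℝ) : ℂ)) := by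
      refine tendsto_nhdsWithin_iff.2 ⟨?_, Filter.Eventually.of_forall fun n => ?_⟩
      · exact (Complex.continuous_ofReal.tendsto _).comp tendsto_one_div_add_atTop_nhds_zero_nat
      · have : (1 : ℝ) / ((n : ℝ) + 1) ≠ 0 := by positivity
        simpa only [mem_compl_iff, mem_singleton_iff, Complex.ofReal_inj] using this
    refine ht.frequently (Filter.Frequently.of_forall fun n => hreal _ ⟨?_, ?_⟩)
    · have : (0 : ℝ) ≤ 1 / ((n : ℝ) + 1) := by positivity
      linarith
    · rw [div_le_one (by positivity)]
      have : (0 : ℝ) ≤ n := by positivity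
      linarith
  rw [heq hz]
  exact (hs.of_norm_bounded fun m => hbd m z hz).hasSum

/-! ### Polynomial approximation in several variables -/

theorem cons_mem_complexNhd_iff {n : ℕ} {δ : Fin (n + 1) → ℝ} {ζ : ℂ} {z : Fin n → ℂ} :
    (Fin.cons ζ z : Fin (n + 1) → ℂ) ∈ complexNhd δ ↔
      ζ ∈ intervalNhd (δ 0) ∧ z ∈ complexNhd (Fin.tail δ) := by
  simp only [mem_complexNhd_iff, Fin.forall_fin_succ, Fin.cons_zero, Fin.cons_succ, Fin.tail]

/-- The linear embedding `z ↦ (0, z)`. -/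
def consZero (n : ℕ) : (Fin n → ℂ) →L[ℂ] (Fin (n + 1) → ℂ) :=
  ContinuousLinearMap.pi fun j =>
    Fin.cases (motive := fun _ => (Fin n → ℂ) →L[ℂ] ℂ) 0 (fun i => ContinuousLinearMap.proj i) j

theorem consZero_add_single {n : ℕ} (ζ : ℂ) (z : Fin n → ℂ) :
    consZero n z + Pi.single 0 ζ = Fin.cons ζ z := by
  ext j
  refine Fin.cases ?_ (fun i => ?_) j <;> simp [consZero]

section

variable {n : ℕ} {δ : Fin (n + 1) → ℝ} {R : (Fin (n + 1) → ℂ) → ℂ}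

theorem differentiableOn_cons (hR : ContDiffOn ℂ 1 R (complexNhd δ)) {z : Fin n → ℂ}
    (hz : z ∈ complexNhd (Fin.tail δ)) :
    DifferentiableOn ℂ (fun ζ => R (Fin.cons ζ z)) (intervalNhd (δ 0)) := by
  refine (hR.differentiableOn one_ne_zero).comp ?_
    fun ζ hζ => cons_mem_complexNhd_iff.2 ⟨hζ, hz⟩
  refine Differentiable.differentiableOn (differentiable_pi.2 fun j => ?_)
  refine Fin.cases ?_ (fun i => ?_) j
  · simp
  · simp

theorem contDiffOn_chebCoeff (hδ : 0 < δ 0) (hR : ContDiffOn ℂ 1 R (complexNhd δ)) (m : ℕ) :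
    ContDiffOn ℂ 1 (fun z : Fin n → ℂ => chebCoeff (fun ζ => R (Fin.cons ζ z)) m)
      (complexNhd (Fin.tail δ)) := by
  have h := contDiffOn_setIntegral_comp_affine (μ := volume) (K := Icc (0 : ℝ) (2 * Real.pi))
    isCompact_Icc measurableSet_Icc (isOpen_complexNhd (Fin.tail δ)) (isOpen_complexNhd δ) hR
    (A := fun _ => consZero n) continuousOn_const
    (c := fun θ => Pi.single 0 (Real.cos θ : ℂ)) ?_
    (φ := fun θ => (((if m = 0 then 1 else 2) / (2 * Real.pi) * Real.cos (m * θ) : ℝ) : ℂ)) ?_ ?_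
  · simpa only [consZero_add_single, chebCoeff] using h
  · exact ((ContinuousLinearMap.single ℂ (fun _ : Fin (n + 1) => ℂ) 0).continuous.comp
      (Complex.continuous_ofReal.comp Real.continuous_cos)).continuousOn
  · exact Continuous.continuousOn (by fun_prop)
  · intro z hz θ _
    rw [consZero_add_single]
    exact cons_mem_complexNhd_iff.2 ⟨ofReal_mem_intervalNhd hδ (Real.cos_mem_Icc θ), hz⟩

/-- Reality of the coefficients is carried through the induction on the number of variables, so that
the approximating polynomials have real coefficients. -/
theorem chebCoeff_real {f : ℂ → ℂ} (hf : ∀ x ∈ Icc (-1 : ℝ) 1, ∃ y : ℝ, f x = y) (m : ℕ) :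
    ∃ y : ℝ, chebCoeff f m = y := by
  have h : ∀ θ : ℝ, f (Real.cos θ) = ((f (Real.cos θ)).re : ℂ) := fun θ => by
    obtain ⟨y, hy⟩ := hf _ (Real.cos_mem_Icc θ)
    rw [hy, Complex.ofReal_re]
  unfold chebCoeff
  refine ⟨∫ θ in Icc (0 : ℝ) (2 * Real.pi),
    ((if m = 0 then 1 else 2) / (2 * Real.pi) * Real.cos (m * θ)) * (f (Real.cos θ)).re, ?_⟩
  rw [← integral_complex_ofReal]
  refine integral_congr_ae (Filter.Eventually.of_forall fun θ => ?_)
  simp only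
  rw [h θ, ← Complex.ofReal_mul, Complex.ofReal_re]

theorem mul_mem_restrictSupport {σ : Type*} {s t u : Set (σ →₀ ℕ)} {p q : MvPolynomial σ ℝ}
    (hp : p ∈ MvPolynomial.restrictSupport ℝ s) (hq : q ∈ MvPolynomial.restrictSupport ℝ t)
    (h : ∀ a ∈ s, ∀ b ∈ t, a + b ∈ u) : p * q ∈ MvPolynomial.restrictSupport ℝ u := by
  classical
  rw [MvPolynomial.mem_restrictSupport_iff] at hp hq ⊢
  intro ν hν
  obtain ⟨a, ha, b, hb, rfl⟩ := Finset.mem_add.1 (MvPolynomial.support_mul p q hν)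
  exact h a (hp ha) b (hq hb)

theorem aeval_T_mem_restrictSupport {σ : Type*} (i : σ) (m : ℕ) :
    Polynomial.aeval (MvPolynomial.X i) (Polynomial.Chebyshev.T ℝ m) ∈
      MvPolynomial.restrictSupport ℝ {ν : σ →₀ ℕ | ∃ l ≤ m, ν = Finsupp.single i l} := by
  rw [Polynomial.aeval_eq_sum_range]
  refine Submodule.sum_mem _ fun l hl => Submodule.smul_mem _ _ ?_
  rw [MvPolynomial.X_pow_eq_monomial, MvPolynomial.monomial_mem_restrictSupport]
  left
  rw [Polynomial.Chebyshev.natDegree_T, Finset.mem_range] at hl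
  exact ⟨l, by simpa using Nat.lt_succ_iff.1 hl, rfl⟩

theorem rename_mem_restrictSupport {σ τ : Type*} {f : σ → τ} {s : Set (σ →₀ ℕ)}
    {p : MvPolynomial σ ℝ} (hp : p ∈ MvPolynomial.restrictSupport ℝ s) :
    MvPolynomial.rename f p ∈
      MvPolynomial.restrictSupport ℝ (Finsupp.mapDomain f '' s) := by
  rw [MvPolynomial.mem_restrictSupport_iff] at hp ⊢
  classical
  intro ν hν
  obtain ⟨u, hu, hc⟩ := MvPolynomial.coeff_rename_ne_zero f p ν (MvPolynomial.mem_support_iff.1 hν)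
  exact ⟨u, hp (MvPolynomial.mem_support_iff.2 hc), hu⟩

end

/-- Multi-indices of weighted degree at most `ℓ`, with weights `log (ρ j)`. -/
def weightedSimplex {n : ℕ} (ρ : Fin n → ℝ) (ℓ : ℝ) : Set (Fin n →₀ ℕ) :=
  {ν | ∑ j, (ν j : ℝ) * Real.log (ρ j) ≤ ℓ}

/-- The monomials of `T_m` have exponents `l ≤ m`, so they cost at most `m log (ρ 0)`, precisely the
part of the budget `ℓ` withheld from the factor `q`. -/
theorem rename_mul_T_mem {n : ℕ} {ρ : Fin (n + 1) → ℝ} (hρ : 1 < ρ 0) {ℓ : ℝ} (m : ℕ)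
    {q : MvPolynomial (Fin n) ℝ}
    (hq : q ∈ MvPolynomial.restrictSupport ℝ
      (weightedSimplex (Fin.tail ρ) (ℓ - m * Real.log (ρ 0)))) :
    MvPolynomial.rename Fin.succ q *
      Polynomial.aeval (MvPolynomial.X 0) (Polynomial.Chebyshev.T ℝ m) ∈
      MvPolynomial.restrictSupport ℝ (weightedSimplex ρ ℓ) := by
  refine mul_mem_restrictSupport (rename_mem_restrictSupport hq) (aeval_T_mem_restrictSupport 0 m) ?_
  rintro _ ⟨a, ha, rfl⟩ _ ⟨l, hl, rfl⟩
  simp only [weightedSimplex, mem_ofPred_eq, Fin.tail] at ha ⊢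
  rw [Fin.sum_univ_succ]
  have h0 : Finsupp.mapDomain Fin.succ a 0 = 0 :=
    Finsupp.mapDomain_of_notMem_range a 0 (by simp)
  have hs : ∀ i : Fin n, Finsupp.mapDomain Fin.succ a i.succ = a i := fun i =>
    Finsupp.mapDomain_apply (Fin.succ_injective n) a i
  have e : ∀ i : Fin n,
      (Finsupp.mapDomain Fin.succ a + Finsupp.single 0 l : Fin (n + 1) →₀ ℕ) i.succ = a i := by
    intro i
    rw [Finsupp.add_apply, hs, Finsupp.single_eq_of_ne (by simp), add_zero]
  simp_rw [e]
  rw [Finsupp.add_apply, h0, zero_add, Finsupp.single_eq_same]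
  have hlog := Real.log_pos hρ
  have : (l : ℝ) * Real.log (ρ 0) ≤ m * Real.log (ρ 0) := by gcongr
  linarith

/-- Simultaneous polynomial approximation, at the rate of the weighted total degree, of functions
that are holomorphic and bounded in a complex neighbourhood of the cube. -/
theorem exists_polynomial_approx {τ : ℝ} (hτ0 : 0 < τ) (hτ1 : τ < 1) (n : ℕ) :
    ∀ ρ : Fin n → ℝ, (∀ j, 1 < ρ j) → ∃ C : ℝ, 0 ≤ C ∧ ∃ r > (0 : ℝ), (∀ j, r ≤ ρ j - 1) ∧
      ∀ (R : (Fin n → ℂ) → ℂ) (B : ℝ), ContDiffOn ℂ 1 R (complexNhd fun j => ρ j - 1) →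
        (∀ z ∈ complexNhd (fun j => ρ j - 1), ‖R z‖ ≤ B) →
        (∀ x ∈ cube n, ∃ y : ℝ, R (toComplex x) = y) → ∀ ℓ : ℝ, 0 ≤ ℓ →
        ∃ p ∈ MvPolynomial.restrictSupport ℝ (weightedSimplex ρ ℓ),
          ∀ z ∈ complexNhd (fun _ : Fin n => r),
            ‖R z - MvPolynomial.aeval z p‖ ≤ C * B * Real.exp (-(τ * ℓ)) := by
  induction n with
  | zero =>
    intro ρ _
    refine ⟨0, le_rfl, 1, one_pos, fun j => j.elim0, fun R B _ _ hre ℓ hℓ => ?_⟩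
    obtain ⟨y, hy⟩ := hre 0 fun j => j.elim0
    refine ⟨MvPolynomial.C y, ?_, fun z _ => ?_⟩
    · rw [MvPolynomial.C_apply, MvPolynomial.monomial_mem_restrictSupport]
      left
      simpa [weightedSimplex] using hℓ
    · rw [MvPolynomial.aeval_C, Subsingleton.elim z (toComplex 0), hy]
      simp
  | succ n ih =>
    intro ρ hρ
    obtain ⟨C', hC', r', hr', hr'ρ, IH⟩ := ih (Fin.tail ρ) fun j => hρ j.succ
    have hρ0 : 1 < ρ 0 := hρ 0
    set lam := Real.log (ρ 0) with hlam
    have hlam0 : 0 < lam := Real.log_pos hρ0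
    -- The loss `1 - τ` in the rate is split in two. One half pays for the growth `σ^m` of `T_m` off
    -- the interval, the other leaves a geometric factor `q^m` that makes the series summable.
    set σ := Real.exp ((1 - τ) / 2 * lam) with hσdef
    set q := Real.exp (-((1 - τ) / 2 * lam)) with hqdef
    have hhalf : 0 < (1 - τ) / 2 * lam := by
      have : 0 < (1 - τ) / 2 := by linarith
      positivity
    have hσ1 : 1 < σ := Real.one_lt_exp_iff.2 hhalf
    have hσρ : σ < ρ 0 := by
      rw [← Real.exp_log (zero_lt_one.trans hρ0), ← hlam]
      exact Real.exp_lt_exp.2 (by nlinarith)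
    have hq1 : q < 1 := by rw [hqdef, Real.exp_lt_one_iff]; linarith
    have hq0 : 0 < q := Real.exp_pos _
    have hσr : 0 < (σ + σ⁻¹ - 2) / 2 := by
      have : σ + σ⁻¹ - 2 = (σ - 1) ^ 2 / σ := by field_simp; ring
      rw [this]
      have : 0 < σ - 1 := by linarith
      positivity
    set r := min r' (min (ρ 0 - 1) ((σ + σ⁻¹ - 2) / 2)) with hrdef
    have hr0 : 0 < r := lt_min hr' (lt_min (by linarith) hσr)
    have hrr' : r ≤ r' := min_le_left _ _
    have hrρ : r ≤ ρ 0 - 1 := (min_le_right _ _).trans (min_le_left _ _)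
    have hrσ : 2 + 2 * r ≤ σ + σ⁻¹ := by
      have : r ≤ (σ + σ⁻¹ - 2) / 2 := (min_le_right _ _).trans (min_le_right _ _)
      linarith
    have hq1' : 0 < 1 - q := by linarith
    refine ⟨2 * (C' + 1) * (1 - q)⁻¹, by positivity, r, hr0,
      Fin.forall_fin_succ.2 ⟨hrρ, fun j => hrr'.trans (hr'ρ j)⟩, fun R B hR hB hre ℓ hℓ => ?_⟩
    have hB0 : 0 ≤ B := (norm_nonneg _).trans
      (hB (toComplex 0) (toComplex_mem_complexNhd (fun j => by linarith [hρ j]) (by simp [cube])))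
    set a : ℕ → (Fin n → ℂ) → ℂ := fun m z => chebCoeff (fun ζ => R (Fin.cons ζ z)) m with ha
    have hfd : ∀ z ∈ complexNhd (fun j => Fin.tail ρ j - 1),
        DifferentiableOn ℂ (fun ζ => R (Fin.cons ζ z)) (intervalNhd (ρ 0 - 1)) := fun z hz =>
      differentiableOn_cons hR hz
    have hfB : ∀ z ∈ complexNhd (fun j => Fin.tail ρ j - 1), ∀ ζ ∈ intervalNhd (ρ 0 - 1),
        ‖R (Fin.cons ζ z)‖ ≤ B := fun z hz ζ hζ =>
      hB _ (cons_mem_complexNhd_iff.2 ⟨hζ, hz⟩)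
    have haB : ∀ m, ∀ z ∈ complexNhd (fun j => Fin.tail ρ j - 1),
        ‖a m z‖ ≤ 2 * B * (ρ 0 ^ m)⁻¹ := fun m z hz =>
      norm_chebCoeff_le hρ0 (hfd z hz) (hfB z hz) m
    have hare : ∀ m, ∀ x ∈ cube n, ∃ y : ℝ, a m (toComplex x) = y := by
      intro m x hx
      refine chebCoeff_real (fun t ht => ?_) m
      have hmem : (Fin.cons t x : Fin (n + 1) → ℝ) ∈ cube (n + 1) := by
        intro j
        refine Fin.cases ?_ (fun i => ?_) j
        · simpa using ht
        · simpa using hx i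
      have e : toComplex (Fin.cons t x : Fin (n + 1) → ℝ) = Fin.cons (t : ℂ) (toComplex x) := by
        ext j
        refine Fin.cases ?_ (fun i => ?_) j <;> simp [toComplex]
      rw [← e]
      exact hre _ hmem
    -- The coefficient of `T_m` has size `ρ_0^{-m}`, so it only needs the remaining level `ℓ - m λ`
    -- with `λ = log ρ_0`; coefficients with `m λ > ℓ` are dropped, with the default `0`.
    have hex : ∀ m : ℕ, ∃ p : MvPolynomial (Fin n) ℝ, (m : ℝ) * lam ≤ ℓ →
        p ∈ MvPolynomial.restrictSupport ℝ (weightedSimplex (Fin.tail ρ) (ℓ - m * lam)) ∧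
        ∀ z ∈ complexNhd (fun _ : Fin n => r'), ‖a m z - MvPolynomial.aeval z p‖ ≤
          C' * (2 * B * (ρ 0 ^ m)⁻¹) * Real.exp (-(τ * (ℓ - m * lam))) := by
      intro m
      by_cases hm : (m : ℝ) * lam ≤ ℓ
      · obtain ⟨p, hp1, hp2⟩ := IH (a m) _ (contDiffOn_chebCoeff (by linarith) hR m) (haB m)
          (hare m) (ℓ - m * lam) (by linarith)
        exact ⟨p, fun _ => ⟨hp1, hp2⟩⟩
      · exact ⟨0, fun h => absurd h hm⟩
    choose p hp using hex
    have hmN : ∀ m : ℕ, m ∈ Finset.range (⌊ℓ / lam⌋₊ + 1) ↔ (m : ℝ) * lam ≤ ℓ := by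
      intro m
      rw [Finset.mem_range, Nat.lt_succ_iff, Nat.le_floor_iff (by positivity), le_div_iff₀ hlam0]
    refine ⟨∑ m ∈ Finset.range (⌊ℓ / lam⌋₊ + 1), MvPolynomial.rename Fin.succ (p m) *
      Polynomial.aeval (MvPolynomial.X 0) (Polynomial.Chebyshev.T ℝ m),
      Submodule.sum_mem _ fun m hm => rename_mul_T_mem hρ0 m (hp m ((hmN m).1 hm)).1,
      fun z hz => ?_⟩
    have hz0 : z 0 ∈ intervalNhd r := hz 0
    have hztail : Fin.tail z ∈ complexNhd (fun _ : Fin n => r) := fun j => hz j.succ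
    have hzr' : Fin.tail z ∈ complexNhd (fun _ : Fin n => r') :=
      complexNhd_mono (fun _ => hrr') hztail
    have hzρ : Fin.tail z ∈ complexNhd (fun j => Fin.tail ρ j - 1) :=
      complexNhd_mono hr'ρ hzr'
    have heval : MvPolynomial.aeval z (∑ m ∈ Finset.range (⌊ℓ / lam⌋₊ + 1),
        MvPolynomial.rename Fin.succ (p m) *
          Polynomial.aeval (MvPolynomial.X 0) (Polynomial.Chebyshev.T ℝ m)) =
        ∑ m ∈ Finset.range (⌊ℓ / lam⌋₊ + 1), (if (m : ℝ) * lam ≤ ℓ then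
          MvPolynomial.aeval (Fin.tail z) (p m) * (Polynomial.Chebyshev.T ℂ m).eval (z 0) else 0) := by
      rw [map_sum]
      refine Finset.sum_congr rfl fun m hm => ?_
      rw [if_pos ((hmN m).1 hm), map_mul, MvPolynomial.aeval_rename, ← Polynomial.aeval_algHom_apply,
        MvPolynomial.aeval_X, Polynomial.Chebyshev.aeval_T]
      rfl
    have h1 : HasSum (fun m : ℕ => a m (Fin.tail z) * (Polynomial.Chebyshev.T ℂ m).eval (z 0))
        (R z) := by
      have := hasSum_chebCoeff hσ1.le hσρ (hfd _ hzρ) (hfB _ hzρ) hr0 hrρ hrσ hz0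
      rwa [Fin.cons_self_tail] at this
    have h2 := h1.sub (hasSum_sum_of_ne_finset_zero (s := Finset.range (⌊ℓ / lam⌋₊ + 1))
      (f := fun m : ℕ => if (m : ℝ) * lam ≤ ℓ then
        MvPolynomial.aeval (Fin.tail z) (p m) * (Polynomial.Chebyshev.T ℂ m).eval (z 0) else 0)
      fun m hm => if_neg fun h => hm ((hmN m).2 h))
    rw [heval]
    have hexpρ : ∀ m : ℕ, (ρ 0 ^ m)⁻¹ = Real.exp (-(m * lam)) := fun m => by
      rw [Real.exp_neg, Real.exp_nat_mul, hlam, Real.exp_log (by linarith)]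
    have hσm : ∀ m : ℕ, σ ^ m = Real.exp (m * ((1 - τ) / 2 * lam)) := fun m => by
      rw [Real.exp_nat_mul]
    have hqm : ∀ m : ℕ, q ^ m = Real.exp (m * -((1 - τ) / 2 * lam)) := fun m => by
      rw [Real.exp_nat_mul]
    have hgeo : HasSum (fun m : ℕ => 2 * (C' + 1) * B * Real.exp (-(τ * ℓ)) * q ^ m)
        (2 * (C' + 1) * B * Real.exp (-(τ * ℓ)) * (1 - q)⁻¹) :=
      (hasSum_geometric_of_lt_one hq0.le hq1).mul_left _
    refine (h2.norm_le_of_bounded hgeo fun m => ?_).trans (le_of_eq (by ring))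
    have hT := norm_eval_T_le hσ1.le hrσ hz0 m
    -- In both cases the exponents combine to `exp(-τℓ) q^m`. For kept terms the `m`-dependence is
    -- `-mλ + τmλ + m(1-τ)λ/2`; for dropped terms `τmλ ≥ τℓ` supplies the decay.
    split_ifs with hm
    · rw [← sub_mul, norm_mul]
      calc _ ≤ (C' * (2 * B * (ρ 0 ^ m)⁻¹) * Real.exp (-(τ * (ℓ - m * lam)))) * σ ^ m :=
            mul_le_mul ((hp m hm).2 _ hzr') hT (norm_nonneg _) (by positivity)
        _ = 2 * C' * B * (Real.exp (-(m * lam)) * Real.exp (-(τ * (ℓ - m * lam))) *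
              Real.exp (m * ((1 - τ) / 2 * lam))) := by rw [hexpρ, hσm]; ring
        _ = 2 * C' * B * (Real.exp (-(τ * ℓ)) * q ^ m) := by
            rw [hqm, ← Real.exp_add, ← Real.exp_add, ← Real.exp_add]; ring_nf
        _ ≤ 2 * (C' + 1) * B * Real.exp (-(τ * ℓ)) * q ^ m := by
            have : 0 ≤ 2 * B * (Real.exp (-(τ * ℓ)) * q ^ m) := by positivity
            linarith
    · rw [sub_zero, norm_mul]
      calc _ ≤ (2 * B * (ρ 0 ^ m)⁻¹) * σ ^ m :=
            mul_le_mul (haB m _ hzρ) hT (norm_nonneg _) (by positivity)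
        _ = 2 * B * (Real.exp (-(τ * (m * lam))) * q ^ m) := by
            rw [hexpρ, hσm, hqm, mul_assoc, ← Real.exp_add, ← Real.exp_add]; ring_nf
        _ ≤ 2 * B * (Real.exp (-(τ * ℓ)) * q ^ m) := by
            have : τ * ℓ ≤ τ * (m * lam) := by
              gcongr
              linarith
            gcongr
        _ ≤ 2 * (C' + 1) * B * Real.exp (-(τ * ℓ)) * q ^ m := by
            have : 0 ≤ 2 * C' * B * (Real.exp (-(τ * ℓ)) * q ^ m) := by positivity
            linarith

end

section


/-! ### Counting multi-indices -/

/-- A form of Bernoulli's inequality. It serves twice: as a discrete integral comparison when slices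
of a simplex are summed, and to absorb lower-order terms into a shift of the base. -/
theorem pow_succ_add_le_add_pow {c a : ℝ} (hc : 0 ≤ c) (ha : 0 ≤ a) (n : ℕ) :
    c ^ (n + 1) + (n + 1) * a * c ^ n ≤ (c + a) ^ (n + 1) := by
  induction n with
  | zero => simp
  | succ n ih =>
    have h1 := mul_le_mul_of_nonneg_right ih (add_nonneg hc ha)
    rw [pow_succ (c + a) (n + 1)]
    refine le_trans ?_ h1
    have : 0 ≤ (n + 1) * a ^ 2 * c ^ n := by positivity
    push_cast
    ring_nf at this ⊢
    linarith

/-- The bound is the volume of the simplex enlarged by one unit cell. Slicing along the first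
coordinate gives simplices of level `ℓ - m a`, with `a` the first weight. The enclosing finset also
makes the cardinality bound meaningful, since it exhibits finiteness. -/
theorem exists_finset_weightedSimplex (n : ℕ) : ∀ (ρ : Fin n → ℝ), (∀ j, 1 < ρ j) → ∀ ℓ : ℝ, 0 ≤ ℓ →
    ∃ s : Finset (Fin n →₀ ℕ), weightedSimplex ρ ℓ ⊆ s ∧
      (s.card : ℝ) * (n.factorial * ∏ j, Real.log (ρ j)) ≤ (ℓ + ∑ j, Real.log (ρ j)) ^ n := by
  classical
  induction n with
  | zero =>
    intro ρ _ ℓ _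
    exact ⟨{0}, fun ν _ => by simpa using Subsingleton.elim ν 0, by simp⟩
  | succ n ih =>
    intro ρ hρ ℓ hℓ
    have hlog : ∀ j, 0 < Real.log (ρ j) := fun j => Real.log_pos (hρ j)
    set a := Real.log (ρ 0) with ha
    have ha0 : 0 < a := hlog 0
    set A := ∑ j : Fin n, Real.log (ρ j.succ) with hA
    have hA0 : 0 ≤ A := Finset.sum_nonneg fun j _ => (hlog _).le
    have hex : ∀ m : ℕ, ∃ s : Finset (Fin n →₀ ℕ), (m : ℝ) * a ≤ ℓ →
        weightedSimplex (Fin.tail ρ) (ℓ - m * a) ⊆ s ∧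
        (s.card : ℝ) * (n.factorial * ∏ j : Fin n, Real.log (ρ j.succ)) ≤
          (ℓ - m * a + A) ^ n := by
      intro m
      by_cases hm : (m : ℝ) * a ≤ ℓ
      · obtain ⟨s, hs⟩ := ih (Fin.tail ρ) (fun j => hρ j.succ) (ℓ - m * a) (by linarith)
        exact ⟨s, fun _ => hs⟩
      · exact ⟨∅, fun h => absurd h hm⟩
    choose s hs using hex
    set N := ⌊ℓ / a⌋₊
    have hmN : ∀ m : ℕ, m ∈ Finset.range (N + 1) ↔ (m : ℝ) * a ≤ ℓ := by
      intro m
      rw [Finset.mem_range, Nat.lt_succ_iff, Nat.le_floor_iff (by positivity), le_div_iff₀ ha0]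
    refine ⟨(Finset.range (N + 1)).biUnion fun m => (s m).image (Finsupp.cons m), ?_, ?_⟩
    · intro ν hν
      have hν' : (ν 0 : ℝ) * a + ∑ j : Fin n, (ν j.succ : ℝ) * Real.log (ρ j.succ) ≤ ℓ := by
        simpa [weightedSimplex, Fin.sum_univ_succ] using hν
      have h0 : 0 ≤ ∑ j : Fin n, (ν j.succ : ℝ) * Real.log (ρ j.succ) :=
        Finset.sum_nonneg fun j _ => mul_nonneg (Nat.cast_nonneg _) (hlog _).le
      have hm : (ν 0 : ℝ) * a ≤ ℓ := by linarith
      simp only [Finset.coe_biUnion, Finset.coe_image, mem_iUnion]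
      refine ⟨ν 0, by exact_mod_cast (hmN _).2 hm, Finsupp.tail ν, ?_, Finsupp.cons_tail ν⟩
      refine (hs _ hm).1 ?_
      simp only [weightedSimplex, mem_ofPred_eq, Finsupp.tail_apply, Fin.tail]
      linarith
    · set P := ∏ j : Fin n, Real.log (ρ j.succ) with hP
      have hP0 : 0 < P := Finset.prod_pos fun j _ => hlog _
      have hcard : ((((Finset.range (N + 1)).biUnion
          fun m => (s m).image (Finsupp.cons m)).card : ℕ) : ℝ) ≤
          ∑ m ∈ Finset.range (N + 1), ((s m).card : ℝ) := by
        rw [← Nat.cast_sum]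
        exact_mod_cast Finset.card_biUnion_le.trans
          (Finset.sum_le_sum fun m _ => Finset.card_image_le)
      rw [Fin.prod_univ_succ, Fin.sum_univ_succ, ← ha, ← hP, ← hA]
      -- Each slice contributes at most `u m - u (m + 1)`, so the sum telescopes.
      set u : ℕ → ℝ := fun m => (ℓ + A + a - m * a) ^ (n + 1) with hu
      calc _ ≤ (∑ m ∈ Finset.range (N + 1), ((s m).card : ℝ)) * ((n + 1).factorial * (a * P)) := by
            gcongr
        _ = ∑ m ∈ Finset.range (N + 1), (n + 1) * a * ((s m).card * (n.factorial * P)) := by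
            rw [Finset.sum_mul, Nat.factorial_succ]
            push_cast
            exact Finset.sum_congr rfl fun m _ => by ring
        _ ≤ ∑ m ∈ Finset.range (N + 1), (u m - u (m + 1)) := by
            refine Finset.sum_le_sum fun m hm => ?_
            have hm' := (hmN m).1 hm
            have h1 := pow_succ_add_le_add_pow (c := ℓ - m * a + A) (a := a) (by linarith) ha0.le n
            have h2 : (n + 1) * a * ((s m).card * (n.factorial * P)) ≤
                (n + 1) * a * (ℓ - m * a + A) ^ n := by
              gcongr
              exact (hs m hm').2
            simp only [hu]
            push_cast
            rw [show ℓ + A + a - m * a = ℓ - m * a + A + a by ring,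
              show ℓ + A + a - (m + 1) * a = ℓ - m * a + A by ring]
            linarith
        _ = u 0 - u (N + 1) := Finset.sum_range_sub' u (N + 1)
        _ ≤ u 0 := by
            have : 0 ≤ u (N + 1) := by
              have h := (hmN N).1 (by simp)
              simp only [hu]
              push_cast
              exact pow_nonneg (by linarith) _
            linarith
        _ = _ := by simp only [hu]; push_cast; ring

/-! ### The index sets `Λ_{k,ε}` compared with weighted simplices -/

section

variable {d : ℕ} {ξ : Fin d → ℝ}

theorem gammaWeight_pos {n : ℕ} {ξ : Fin (n + 1) → ℝ} (hξ : ∀ j, 1 < ξ j)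
    (ν : Fin (n + 1) →₀ ℕ) : 0 < gammaWeight ξ ν := by
  have h : ∀ j, 0 < ξ j := fun j => by linarith [hξ j]
  unfold gammaWeight
  exact mul_pos (inv_pos.2 (pow_pos (h _) _))
    (Finset.prod_pos fun j _ => inv_pos.2 (pow_pos (h _) _))

theorem log_gammaWeight {n : ℕ} {ξ : Fin (n + 1) → ℝ} (hξ : ∀ j, 1 < ξ j)
    (ν : Fin (n + 1) →₀ ℕ) : Real.log (gammaWeight ξ ν) =
      -((max 1 (ν (Fin.last n)) : ℕ) * Real.log (ξ (Fin.last n))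
        + ∑ j : Fin n, (ν j.castSucc : ℝ) * Real.log (ξ j.castSucc)) := by
  have h : ∀ j, ξ j ≠ 0 := fun j => by linarith [hξ j]
  unfold gammaWeight
  rw [Real.log_mul (inv_ne_zero (pow_ne_zero _ (h _)))
    (Finset.prod_ne_zero_iff.2 fun j _ => inv_ne_zero (pow_ne_zero _ (h _))), Real.log_inv,
    Real.log_pow, Real.log_prod fun j _ => inv_ne_zero (pow_ne_zero _ (h _))]
  simp only [Real.log_inv, Real.log_pow, Finset.sum_neg_distrib]
  ring

theorem indexSet_subset (hξ : ∀ j, 1 < ξ j) (k : Fin d) {ε : ℝ} (hε : 0 < ε) :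
    indexSet ξ k ε ⊆ weightedSimplex (initialSegment k ξ) (-Real.log ε) := by
  intro ν hν
  have h1 := Real.log_le_log hε hν
  rw [log_gammaWeight (ξ := initialSegment k ξ) fun j => hξ _] at h1
  simp only [weightedSimplex, mem_ofPred_eq]
  rw [Fin.sum_univ_castSucc]
  have h2 : (ν (Fin.last k) : ℝ) * Real.log (initialSegment k ξ (Fin.last k)) ≤
      (max 1 (ν (Fin.last k)) : ℕ) * Real.log (initialSegment k ξ (Fin.last k)) := by
    refine mul_le_mul_of_nonneg_right ?_ (Real.log_pos (hξ _)).le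
    exact_mod_cast le_max_right _ _
  linarith

/-- Since `max 1 ν_k ≤ 1 + ν_k`, the modified last exponent costs at most one additional `log ξ_k`,
a shift of the level that does not depend on `ε`. -/
theorem weightedSimplex_subset_indexSet (hξ : ∀ j, 1 < ξ j) (k : Fin d) {ε : ℝ} (hε : 0 < ε) :
    weightedSimplex (initialSegment k ξ) (-Real.log ε - Real.log (ξ k)) ⊆ indexSet ξ k ε := by
  intro ν hν
  simp only [weightedSimplex, mem_ofPred_eq] at hν
  rw [Fin.sum_univ_castSucc] at hν
  have hk : initialSegment k ξ (Fin.last k) = ξ k := rfl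
  have hpos := gammaWeight_pos (ξ := initialSegment k ξ) (fun j => hξ _) ν
  show ε ≤ gammaWeight (initialSegment k ξ) ν
  rw [← Real.log_le_log_iff hε hpos, log_gammaWeight (ξ := initialSegment k ξ) fun j => hξ _]
  have h2 : ((max 1 (ν (Fin.last k)) : ℕ) : ℝ) * Real.log (initialSegment k ξ (Fin.last k)) ≤
      (1 + (ν (Fin.last k) : ℝ)) * Real.log (initialSegment k ξ (Fin.last k)) := by
    refine mul_le_mul_of_nonneg_right ?_ (Real.log_pos (hξ _)).le
    have : max 1 (ν (Fin.last k)) ≤ 1 + ν (Fin.last k) := by omega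
    exact_mod_cast this
  rw [hk] at h2 hν ⊢
  linarith

theorem ncard_indexSet_le (hξ : ∀ j, 1 < ξ j) (k : Fin d) {ε : ℝ} (hε : 0 < ε) (hε1 : ε < 1) :
    ((indexSet ξ k ε).ncard : ℝ) *
      ((k + 1 : ℕ).factorial * ∏ j, Real.log (initialSegment k ξ j)) ≤
      (-Real.log ε + ∑ j, Real.log (ξ j)) ^ (k + 1 : ℕ) := by
  have hlog : ∀ j, 0 < Real.log (ξ j) := fun j => Real.log_pos (hξ j)
  have hℓ : 0 ≤ -Real.log ε := by linarith [Real.log_neg hε hε1]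
  obtain ⟨s, hs1, hs2⟩ := exists_finset_weightedSimplex (k + 1) (initialSegment k ξ)
    (fun j => hξ _) (-Real.log ε) hℓ
  have h1 : (indexSet ξ k ε).ncard ≤ s.card := by
    rw [← Set.ncard_coe_finset]
    exact Set.ncard_le_ncard ((indexSet_subset hξ k hε).trans hs1) s.finite_toSet
  have h2 : ∑ j, Real.log (initialSegment k ξ j) ≤ ∑ j, Real.log (ξ j) := by
    have : ∑ j, Real.log (initialSegment k ξ j) = ∑ j ∈ Finset.univ.map
        (Fin.castLEEmb k.isLt), Real.log (ξ j) := by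
      rw [Finset.sum_map]; rfl
    rw [this]
    exact Finset.sum_le_sum_of_subset_of_nonneg (Finset.subset_univ _) fun j _ _ => (hlog j).le
  have h3 : 0 ≤ ∑ j, Real.log (initialSegment k ξ j) :=
    Finset.sum_nonneg fun j _ => (hlog _).le
  have h4 : 0 < ∏ j, Real.log (initialSegment k ξ j) := Finset.prod_pos fun j _ => hlog _
  calc _ ≤ (s.card : ℝ) * ((k + 1 : ℕ).factorial * ∏ j, Real.log (initialSegment k ξ j)) := by
        gcongr
    _ ≤ _ := hs2
    _ ≤ _ := by gcongr

/-- The number of degrees of freedom grows at most like the `d`-th power of `log ε⁻¹`, with the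
constant that enters the rate. -/
theorem exists_rate_mul_le (hd : 1 ≤ d) (hξ : ∀ j, 1 < ξ j) : ∃ K : ℝ, ∀ ε ∈ Ioo (0 : ℝ) 1,
    rate ξ * (totalCard ξ ε : ℝ) ^ (1 / (d : ℝ)) ≤ -Real.log ε + K := by
  obtain ⟨e, rfl⟩ : ∃ e, d = e + 1 := ⟨d - 1, by omega⟩
  have hlog : ∀ j, 0 < Real.log (ξ j) := fun j => Real.log_pos (hξ j)
  set A := ∑ j, Real.log (ξ j) with hA
  have hA0 : 0 ≤ A := Finset.sum_nonneg fun j _ => (hlog j).le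
  set P := ∏ j, Real.log (ξ j) with hP
  have hP0 : 0 < P := Finset.prod_pos fun j _ => hlog j
  set D : Fin (e + 1) → ℝ := fun k =>
    ((k + 1 : ℕ).factorial * ∏ j, Real.log (initialSegment k ξ j))⁻¹ with hD
  have hDpos : ∀ k : Fin (e + 1), 0 < (((k : ℕ) + 1).factorial * ∏ j, Real.log (initialSegment k ξ j) : ℝ) :=
    fun k => mul_pos (by exact_mod_cast Nat.factorial_pos _) (Finset.prod_pos fun j _ => hlog _)
  have hD0 : ∀ k, 0 ≤ D k := fun k => (inv_pos.2 (hDpos k)).le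
  -- Only the last component has `X^d` many indices. The others contribute at most `X^{d-1}` up to a
  -- constant, and `Q` is that constant; Bernoulli turns it into the additive shift in `(X + Q)^d`.
  set Q := (e.factorial : ℝ) * P * ∑ k : Fin e, D k.castSucc with hQ
  have hQ0 : 0 ≤ Q := mul_nonneg (by positivity) (Finset.sum_nonneg fun k _ => hD0 _)
  refine ⟨A + 1 + Q, fun ε ⟨hε, hε1⟩ => ?_⟩
  have hℓ : 0 ≤ -Real.log ε := by linarith [Real.log_neg hε hε1]
  set X := -Real.log ε + A + 1 with hX
  have hX1 : 1 ≤ X := by linarith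
  have hk : ∀ k, ((indexSet ξ k ε).ncard : ℝ) ≤ D k * X ^ (k + 1 : ℕ) := by
    intro k
    rw [hD, inv_mul_eq_div, le_div_iff₀ (hDpos k)]
    refine (ncard_indexSet_le hξ k hε hε1).trans ?_
    gcongr
    linarith
  -- The simplex volume carries `d!` where the rate has `(d-1)!`, so the leading coefficient is
  -- `1/d`; the bound by `1` is all that is used.
  have hlast : (e.factorial : ℝ) * P * D (Fin.last e) ≤ 1 := by
    have : D (Fin.last e) = ((e + 1 : ℕ).factorial * P)⁻¹ := rfl
    rw [this, Nat.factorial_succ, ← div_eq_mul_inv, div_le_one (by positivity)]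
    push_cast
    have : 0 ≤ (e : ℝ) * e.factorial * P := by positivity
    linarith
  have hmain : (e.factorial : ℝ) * P * totalCard ξ ε ≤ (X + Q) ^ (e + 1) := by
    have h1 : (totalCard ξ ε : ℝ) ≤ (∑ k : Fin e, D k.castSucc) * X ^ e
        + D (Fin.last e) * X ^ (e + 1) := by
      rw [totalCard, Nat.cast_sum, Fin.sum_univ_castSucc, Finset.sum_mul]
      refine add_le_add (Finset.sum_le_sum fun k _ => (hk _).trans ?_) (hk _)
      refine mul_le_mul_of_nonneg_left (pow_le_pow_right₀ hX1 ?_) (hD0 _)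
      simp
    calc _ ≤ (e.factorial : ℝ) * P * ((∑ k : Fin e, D k.castSucc) * X ^ e
          + D (Fin.last e) * X ^ (e + 1)) := by gcongr
      _ = Q * X ^ e + ((e.factorial : ℝ) * P * D (Fin.last e)) * X ^ (e + 1) := by rw [hQ]; ring
      _ ≤ Q * X ^ e + 1 * X ^ (e + 1) := by gcongr
      _ ≤ X ^ (e + 1) + (e + 1) * Q * X ^ e := by
          have : 0 ≤ (e : ℝ) * Q * X ^ e := by positivity
          linarith
      _ ≤ _ := pow_succ_add_le_add_pow (by linarith) hQ0 e
  have hd0 : ((e + 1 : ℕ) : ℝ) ≠ 0 := by positivity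
  rw [rate, Nat.add_sub_cancel, ← Real.mul_rpow (by positivity) (by positivity)]
  calc _ ≤ ((X + Q) ^ (e + 1)) ^ (1 / ((e + 1 : ℕ) : ℝ)) := by
        exact Real.rpow_le_rpow (by positivity) hmain (by positivity)
    _ = X + Q := by
        rw [one_div, Real.pow_rpow_inv_natCast (by linarith) (by omega)]
    _ = _ := by rw [hX]; ring

end

end

section


/-! ### Sobolev norms of holomorphic functions -/

variable {d : ℕ}

theorem add_single_mem_complexNhd {r s : ℝ} (hs : 0 ≤ s) {z : Fin d → ℂ}
    (hz : z ∈ complexNhd fun _ : Fin d => r) (j : Fin d) {ζ : ℂ} (hζ : ‖ζ‖ ≤ s) :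
    z + Pi.single j ζ ∈ complexNhd fun _ : Fin d => r + s := by
  intro i
  obtain ⟨y, hy, hzy⟩ := hz i
  refine ⟨y, hy, ?_⟩
  rcases eq_or_ne i j with rfl | hij
  · rw [Pi.add_apply, Pi.single_eq_same, add_sub_right_comm]
    exact (norm_add_le _ _).trans_lt (by linarith)
  · rw [Pi.add_apply, Pi.single_eq_of_ne hij, add_zero]
    linarith

/-- Partial derivatives of holomorphic functions are holomorphic, with Cauchy's bound. -/
theorem contDiffOn_fderiv_single {r η : ℝ} (hr : 0 < r) {U : (Fin d → ℂ) → ℂ}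
    (hU : ContDiffOn ℂ 1 U (complexNhd fun _ : Fin d => r))
    (hη : ∀ z ∈ complexNhd (fun _ : Fin d => r), ‖U z‖ ≤ η) (j : Fin d) :
    ContDiffOn ℂ 1 (fun z => fderiv ℂ U z (Pi.single j 1)) (complexNhd fun _ : Fin d => r / 2) ∧
    ∀ z ∈ complexNhd (fun _ : Fin d => r / 2),
      ‖fderiv ℂ U z (Pi.single j 1)‖ ≤ η / (r / 2) := by
  have hr2 : 0 < r / 2 := by linarith
  have hmem : ∀ z ∈ complexNhd (fun _ : Fin d => r / 2), ∀ ζ : ℂ, ‖ζ‖ ≤ r / 2 →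
      z + Pi.single j ζ ∈ complexNhd fun _ : Fin d => r := by
    intro z hz ζ hζ
    have := add_single_mem_complexNhd hr2.le hz j hζ
    rwa [add_halves] at this
  have hlin : ∀ (z : Fin d → ℂ) (ζ : ℂ),
      HasFDerivAt (fun ζ : ℂ => z + Pi.single j ζ)
        (ContinuousLinearMap.single ℂ (fun _ : Fin d => ℂ) j) ζ := fun z ζ =>
    (ContinuousLinearMap.single ℂ (fun _ : Fin d => ℂ) j).hasFDerivAt.const_add z
  have hopen : ∀ z : Fin d → ℂ,
      IsOpen {ζ : ℂ | z + Pi.single j ζ ∈ complexNhd fun _ : Fin d => r} := fun z =>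
    (isOpen_complexNhd _).preimage
      (continuous_iff_continuousAt.2 fun ζ => (hlin z ζ).continuousAt)
  have hder : ∀ (z : Fin d → ℂ) (ζ : ℂ), z + Pi.single j ζ ∈ complexNhd (fun _ : Fin d => r) →
      HasDerivAt (fun ζ : ℂ => U (z + Pi.single j ζ))
        (fderiv ℂ U (z + Pi.single j ζ) (Pi.single j 1)) ζ := by
    intro z ζ h
    have h1 := ((hU.differentiableOn one_ne_zero).differentiableAt
      ((isOpen_complexNhd _).mem_nhds h)).hasFDerivAt
    have h2 : HasDerivAt (fun ζ : ℂ => U (z + Pi.single j ζ))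
        (((fderiv ℂ U (z + Pi.single j ζ)).comp
          (ContinuousLinearMap.single ℂ (fun _ : Fin d => ℂ) j)) 1) ζ :=
      (h1.comp ζ (hlin z ζ)).hasDerivAt
    simpa using h2
  have hdiff : ∀ z : Fin d → ℂ, DifferentiableOn ℂ (fun ζ : ℂ => U (z + Pi.single j ζ))
      {ζ : ℂ | z + Pi.single j ζ ∈ complexNhd fun _ : Fin d => r} := fun z ζ h =>
    (hder z ζ h).differentiableAt.differentiableWithinAt
  have hsub : ∀ z ∈ complexNhd (fun _ : Fin d => r / 2), closedBall (0 : ℂ) (r / 2) ⊆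
      {ζ : ℂ | z + Pi.single j ζ ∈ complexNhd fun _ : Fin d => r} := fun z hz ζ hζ =>
    hmem z hz ζ (by simpa using hζ)
  have hd0 : ∀ z ∈ complexNhd (fun _ : Fin d => r / 2),
      deriv (fun ζ : ℂ => U (z + Pi.single j ζ)) 0 = fderiv ℂ U z (Pi.single j 1) := by
    intro z hz
    have := (hder z 0 (hmem z hz 0 (by simpa using hr2.le))).deriv
    simpa using this
  constructor
  -- Cauchy's formula for the derivative in the variable `j` is an integral over a circle of radius
  -- `r/2` with `z` as a parameter, hence jointly holomorphic in `z`.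
  · have h := contDiffOn_setIntegral_comp_affine (μ := volume) (K := Icc (0 : ℝ) (2 * Real.pi))
      isCompact_Icc measurableSet_Icc (isOpen_complexNhd fun _ : Fin d => r / 2)
      (isOpen_complexNhd fun _ : Fin d => r) hU
      (A := fun _ => ContinuousLinearMap.id ℂ (Fin d → ℂ)) continuousOn_const
      (c := fun θ => Pi.single j (circleMap 0 (r / 2) θ))
      ((ContinuousLinearMap.single ℂ (fun _ : Fin d => ℂ) j).continuous.comp
        (continuous_circleMap 0 (r / 2))).continuousOn
      (φ := fun θ => (2 * Real.pi * Complex.I : ℂ)⁻¹ *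
        (circleMap 0 (r / 2) θ * Complex.I * ((circleMap 0 (r / 2) θ) ^ 2)⁻¹)) ?_ ?_
    · refine h.congr fun z hz => ?_
      rw [← hd0 z hz, ← Complex.two_pi_I_inv_smul_circleIntegral_sub_sq_inv_smul_of_differentiable
        (hopen z) (hsub z hz) (hdiff z) (mem_ball_self hr2), circleIntegral,
        intervalIntegral.integral_of_le (by positivity), integral_Icc_eq_integral_Ioc, smul_eq_mul,
        ← integral_const_mul]
      refine integral_congr_ae (Filter.Eventually.of_forall fun θ => ?_)
      simp only [deriv_circleMap, sub_zero, smul_eq_mul, ContinuousLinearMap.id_apply]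
      ring
    · refine Continuous.continuousOn ?_
      refine continuous_const.mul (((continuous_circleMap 0 (r / 2)).mul continuous_const).mul
        (((continuous_circleMap 0 (r / 2)).pow 2).inv₀ fun θ => pow_ne_zero _ ?_))
      exact circleMap_ne_center hr2.ne'
    · intro z hz θ _
      refine hmem z hz _ ?_
      rw [norm_circleMap_zero, abs_of_pos hr2]
  · intro z hz
    rw [← hd0 z hz]
    refine Complex.norm_deriv_le_of_forall_mem_sphere_norm_le hr2 ?_ fun ζ hζ =>
      hη _ (hsub z hz (sphere_subset_closedBall hζ))
    exact ((hdiff z).mono (hsub z hz)).diffContOnCl_ball subset_rfl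

/-- The inclusion of real vectors into complex ones, as a linear map. -/
def toComplexCLM (d : ℕ) : (Fin d → ℝ) →L[ℝ] (Fin d → ℂ) :=
  ContinuousLinearMap.pi fun j => Complex.ofRealCLM.comp (ContinuousLinearMap.proj j)

theorem toComplexCLM_apply (x : Fin d → ℝ) : toComplexCLM d x = toComplex x := rfl

theorem toComplexCLM_single (j : Fin d) :
    toComplexCLM d (Pi.single j 1) = Pi.single j 1 := by
  ext i
  rcases eq_or_ne i j with rfl | h
  · simp [toComplexCLM_apply, toComplex]
  · simp [toComplexCLM_apply, toComplex, h]

theorem hasFDerivAt_re_comp_toComplex {U : (Fin d → ℂ) → ℂ} {x : Fin d → ℝ}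
    (h : DifferentiableAt ℂ U (toComplex x)) :
    HasFDerivAt (fun y => (U (toComplex y)).re)
      (Complex.reCLM.comp (((fderiv ℂ U (toComplex x)).restrictScalars ℝ).comp (toComplexCLM d)))
      x :=
  Complex.reCLM.hasFDerivAt.comp x
    ((h.hasFDerivAt.restrictScalars ℝ).comp (f := toComplexCLM d) x (toComplexCLM d).hasFDerivAt)

/-- Smooth functions with compact support in the open cube. -/
structure IsTestFunction (φ : (Fin d → ℝ) → ℝ) : Prop where
  contDiff : ContDiff ℝ ∞ φ
  hasCompactSupport : HasCompactSupport φ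
  tsupport_subset : tsupport φ ⊆ openCube d

theorem IsTestFunction.partialDeriv {φ : (Fin d → ℝ) → ℝ} (h : IsTestFunction φ) (j : Fin d) :
    IsTestFunction (partialDeriv j φ) where
  contDiff := (h.contDiff.fderiv_right (m := ∞) (by simp)).clm_apply contDiff_const
  hasCompactSupport := h.hasCompactSupport.fderiv_apply (𝕜 := ℝ) _
  tsupport_subset := (tsupport_fderiv_apply_subset ℝ _).trans h.tsupport_subset

theorem setIntegral_openCube_mul {φ : (Fin d → ℝ) → ℝ} (hφ : tsupport φ ⊆ openCube d)
    (u : (Fin d → ℝ) → ℝ) : ∫ x in openCube d, u x * φ x = ∫ x, u x * φ x := by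
  refine setIntegral_eq_integral_of_forall_compl_eq_zero fun x hx => ?_
  rw [image_eq_zero_of_notMem_tsupport fun h => hx (hφ h), mul_zero]

theorem IsTestFunction.integrable_mul {φ : (Fin d → ℝ) → ℝ} (h : IsTestFunction φ)
    {u : (Fin d → ℝ) → ℝ} (hu : ContinuousOn u (openCube d)) : Integrable fun x => u x * φ x := by
  have hsupp : Function.support (fun x => u x * φ x) ⊆ tsupport φ := fun x hx => by
    by_contra hn
    exact hx (by simp [image_eq_zero_of_notMem_tsupport hn])
  rw [← integrableOn_iff_integrable_of_support_subset hsupp]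
  exact ((hu.mono h.tsupport_subset).mul h.contDiff.continuous.continuousOn).integrableOn_compact
    h.hasCompactSupport

section

variable {r η : ℝ} {U : (Fin d → ℂ) → ℂ}

theorem continuousOn_re_comp_toComplex (hr : 0 < r)
    (hU : ContDiffOn ℂ 1 U (complexNhd fun _ : Fin d => r)) :
    ContinuousOn (fun x => (U (toComplex x)).re) (openCube d) :=
  Complex.continuous_re.comp_continuousOn (hU.continuousOn.comp continuous_toComplex.continuousOn
    fun _ hx => toComplex_mem_complexNhd (fun _ => hr) (openCube_subset_cube d hx))

/-- Integration by parts without boundary terms. The real part of `U` is differentiable only near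
the cube, but every product is supported where the test function is, so it may be integrated over
the whole space. -/
theorem integral_re_mul_partialDeriv (hr : 0 < r)
    (hU : ContDiffOn ℂ 1 U (complexNhd fun _ : Fin d => r)) (j : Fin d)
    {φ : (Fin d → ℝ) → ℝ} (hφ : IsTestFunction φ)
    (hV : ContinuousOn (fun x => (fderiv ℂ U (toComplex x) (Pi.single j 1)).re) (openCube d)) :
    ∫ x in openCube d, (U (toComplex x)).re * partialDeriv j φ x =
      -∫ x in openCube d, (fderiv ℂ U (toComplex x) (Pi.single j 1)).re * φ x := by
  have hd : ∀ x ∈ openCube d, DifferentiableAt ℂ U (toComplex x) := fun x hx =>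
    (hU.differentiableOn one_ne_zero).differentiableAt ((isOpen_complexNhd _).mem_nhds
      (toComplex_mem_complexNhd (fun _ => hr) (openCube_subset_cube d hx)))
  have hf : ∀ x, fderiv ℝ (fun y => (U (toComplex y)).re) x (Pi.single j 1) * φ x =
      (fderiv ℂ U (toComplex x) (Pi.single j 1)).re * φ x := by
    intro x
    by_cases hx : x ∈ tsupport φ
    · rw [(hasFDerivAt_re_comp_toComplex (hd x (hφ.tsupport_subset hx))).fderiv]
      simp [toComplexCLM_single]
    · simp [image_eq_zero_of_notMem_tsupport hx]
  have hcU := continuousOn_re_comp_toComplex hr hU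
  rw [setIntegral_openCube_mul (hφ.partialDeriv j).tsupport_subset,
    setIntegral_openCube_mul hφ.tsupport_subset]
  simp_rw [← hf]
  refine integral_mul_fderiv_eq_neg_fderiv_mul_of_integrable ?_
    ((hφ.partialDeriv j).integrable_mul hcU) (hφ.integrable_mul hcU) ?_ ?_
  · simp_rw [hf]
    exact hφ.integrable_mul hV
  · exact fun x hx =>
      (hasFDerivAt_re_comp_toComplex (hd x (hφ.tsupport_subset hx))).differentiableAt
  · exact fun x _ => (hφ.contDiff.differentiable (by simp)).differentiableAt

end

/-- Each derivative moved from the test function to `U` halves the radius and multiplies the bound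
by `1/(r/2)`. The constant depends on `n` and `r` only, not on `U` or on the order of
differentiation, and the resulting `V` is the candidate weak derivative. -/
theorem exists_iterated_partialDeriv (n : ℕ) : ∀ r : ℝ, 0 < r → ∃ C : ℝ, 0 ≤ C ∧
    ∀ w : List (Fin d), w.length = n → ∀ (U : (Fin d → ℂ) → ℂ) (η : ℝ),
      ContDiffOn ℂ 1 U (complexNhd fun _ : Fin d => r) →
      (∀ z ∈ complexNhd (fun _ : Fin d => r), ‖U z‖ ≤ η) →
      ∃ (V : (Fin d → ℂ) → ℂ) (r' : ℝ), 0 < r' ∧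
        ContDiffOn ℂ 1 V (complexNhd fun _ : Fin d => r') ∧
        (∀ z ∈ complexNhd (fun _ : Fin d => r'), ‖V z‖ ≤ C * η) ∧
        ∀ φ, IsTestFunction φ → ∫ x in openCube d, (U (toComplex x)).re * w.foldr partialDeriv φ x =
          (-1) ^ n * ∫ x in openCube d, (V (toComplex x)).re * φ x := by
  induction n with
  | zero =>
    intro r hr
    refine ⟨1, zero_le_one, fun w hw U η hU hη => ⟨U, r, hr, hU, by simpa using hη, fun φ _ => ?_⟩⟩
    simp [List.length_eq_zero_iff.1 hw]
  | succ n ih =>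
    intro r hr
    obtain ⟨C, hC, h⟩ := ih (r / 2) (by linarith)
    refine ⟨C / (r / 2), by positivity, fun w hw U η hU hη => ?_⟩
    obtain ⟨j, w, rfl⟩ := List.exists_cons_of_length_eq_add_one hw
    obtain ⟨h1, h2⟩ := contDiffOn_fderiv_single hr hU hη j
    obtain ⟨V, r', hr', hV, hVb, hint⟩ := h w (by simpa using hw) _ _ h1 h2
    refine ⟨V, r', hr', hV, fun z hz => (hVb z hz).trans (le_of_eq (by ring)), fun φ hφ => ?_⟩
    have htest : ∀ w : List (Fin d), IsTestFunction (w.foldr partialDeriv φ) := by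
      intro w
      induction w with
      | nil => exact hφ
      | cons j w ih => exact ih.partialDeriv j
    rw [List.foldr_cons, integral_re_mul_partialDeriv hr hU j (htest w)
      (continuousOn_re_comp_toComplex (r := r / 2) (by linarith) h1), hint φ hφ]
    ring

/-- Writing the multi-index as a word in the coordinates allows induction on its length. -/
theorem mixedPartial_eq_foldr (ν : Fin d → ℕ) (φ : (Fin d → ℝ) → ℝ) :
    mixedPartial ν φ =
      ((List.finRange d).flatMap fun j => List.replicate (ν j) j).foldr partialDeriv φ := by
  unfold mixedPartial
  induction List.finRange d with
  | nil => rfl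
  | cons j l ih =>
    rw [List.foldr_cons, List.flatMap_cons, List.foldr_append, ih]
    generalize (l.flatMap fun j => List.replicate (ν j) j).foldr partialDeriv φ = ψ
    induction ν j with
    | zero => rfl
    | succ n ihn => rw [Function.iterate_succ_apply', ihn, List.replicate_succ, List.foldr_cons]

/-- A function with a bounded holomorphic extension is small in all Sobolev norms. -/
theorem exists_sobolevNorm_le (m : ℕ) {r : ℝ} (hr : 0 < r) : ∃ C : ℝ, 0 ≤ C ∧
    ∀ (U : (Fin d → ℂ) → ℂ) (η : ℝ) (u : (Fin d → ℝ) → ℝ),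
      ContDiffOn ℂ 1 U (complexNhd fun _ : Fin d => r) →
      (∀ z ∈ complexNhd (fun _ : Fin d => r), ‖U z‖ ≤ η) →
      (∀ x ∈ openCube d, (U (toComplex x)).re = u x) →
      sobolevNorm m u ≤ ENNReal.ofReal (C * η) := by
  choose C hC h using fun n => exists_iterated_partialDeriv (d := d) n r hr
  refine ⟨∑ n ∈ Finset.range (m + 1), C n, Finset.sum_nonneg fun n _ => hC n,
    fun U η u hU hη hu => ?_⟩
  have hη0 : 0 ≤ η := (norm_nonneg _).trans
    (hη (toComplex 0) (toComplex_mem_complexNhd (fun _ => hr) (by simp [cube])))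
  refine iSup₂_le fun ν hν => ?_
  obtain ⟨V, r', hr', hV, hVb, hint⟩ := h (∑ j, ν j)
    ((List.finRange d).flatMap fun j => List.replicate (ν j) j)
    (by simp [List.length_flatMap, ← List.ofFn_eq_map, List.sum_ofFn]) U η hU hη
  have hmeas : MeasurableSet (openCube d) := (isOpen_openCube d).measurableSet
  have hw : IsWeakDeriv ν u fun x => (V (toComplex x)).re := by
    refine ⟨?_, ?_, fun φ h1 h2 h3 => ?_⟩
    · exact ((continuousOn_re_comp_toComplex hr hU).congr fun x hx => (hu x hx).symm).locallyIntegrableOn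
        hmeas
    · exact (continuousOn_re_comp_toComplex hr' hV).locallyIntegrableOn hmeas
    · rw [mixedPartial_eq_foldr, ← hint φ ⟨h1, h2, h3⟩]
      exact setIntegral_congr_fun hmeas fun x hx => by simp only [hu x hx]
  refine (iInf₂_le _ hw).trans ?_
  rw [eLpNorm_exponent_top]
  refine eLpNormEssSup_le_of_ae_bound ?_
  refine (ae_restrict_iff' hmeas).2 (Filter.Eventually.of_forall fun x hx => ?_)
  have h1 := hVb (toComplex x) (toComplex_mem_complexNhd (fun _ => hr') (openCube_subset_cube d hx))
  refine (Complex.abs_re_le_norm _).trans (h1.trans ?_)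
  gcongr
  exact Finset.single_le_sum (f := C) (fun n _ => hC n) (Finset.mem_range.2 (by omega))

end

section


/-! ### Triangular maps -/

variable {d : ℕ}

/-- Each component is an increasing homeomorphism of `[-1,1]` in its own variable. Injectivity
follows by comparing coordinates in order, surjectivity by solving for one coordinate at a time with
the intermediate value theorem; by triangularity later choices do not disturb earlier equations. -/
theorem isMonotoneTriangularBijection_of_endpoints {T : (Fin d → ℝ) → (Fin d → ℝ)}
    (htri : ∀ k, ∀ x ∈ cube d, ∀ y ∈ cube d, (∀ j ≤ k, x j = y j) → T x k = T y k)
    (hmono : ∀ k, ∀ x ∈ cube d, StrictMonoOn (fun s => T (Function.update x k s) k) (Icc (-1) 1))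
    (hcont : ∀ k, ∀ x ∈ cube d, ContinuousOn (fun s => T (Function.update x k s) k) (Icc (-1) 1))
    (hleft : ∀ k, ∀ x ∈ cube d, T (Function.update x k (-1)) k = -1)
    (hright : ∀ k, ∀ x ∈ cube d, T (Function.update x k 1) k = 1) :
    IsMonotoneTriangularBijection T := by
  refine ⟨htri, hmono, fun x hx k => ?_, fun x hx y hy hxy => ?_, fun y hy => ?_⟩
  · have h := (hmono k x hx).monotoneOn
    have h1 := h (left_mem_Icc.2 (by norm_num)) (hx k) (hx k).1
    have h2 := h (hx k) (right_mem_Icc.2 (by norm_num)) (hx k).2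
    simp only [Function.update_eq_self] at h1 h2
    rw [hleft k x hx] at h1
    rw [hright k x hx] at h2
    exact ⟨h1, h2⟩
  · have key : ∀ n : ℕ, ∀ k : Fin d, (k : ℕ) = n → x k = y k := by
      intro n
      induction n using Nat.strong_induction_on with
      | _ n ih =>
        rintro k rfl
        refine (hmono k x hx).injOn (hx k) (hy k) ?_
        simp only [Function.update_eq_self]
        rw [hxy]
        refine htri k y hy _ (update_mem_cube hx (hy k)) fun j hj => ?_
        rcases eq_or_ne j k with rfl | hjk
        · simp
        · rw [Function.update_of_ne hjk]
          exact (ih j (lt_of_le_of_ne hj (by simpa [Fin.ext_iff] using hjk)) j rfl).symm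
    exact funext fun k => key k k rfl
  · have key : ∀ n : ℕ, ∃ x ∈ cube d, ∀ j : Fin d, (j : ℕ) < n → T x j = y j := by
      intro n
      induction n with
      | zero => exact ⟨y, hy, fun j hj => absurd hj (Nat.not_lt_zero _)⟩
      | succ n ih =>
        obtain ⟨x, hx, hxy⟩ := ih
        by_cases hn : n < d
        · set k : Fin d := ⟨n, hn⟩
          have hsub := intermediate_value_Icc (by norm_num) (hcont k x hx)
          simp only [hleft k x hx, hright k x hx] at hsub
          obtain ⟨s, hs, hsy⟩ := hsub (hy k)
          refine ⟨Function.update x k s, update_mem_cube hx hs, fun j hj => ?_⟩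
          rcases Nat.lt_succ_iff_lt_or_eq.1 hj with hj | hj
          · rw [← hxy j hj]
            refine htri j _ (update_mem_cube hx hs) x hx fun i hi => ?_
            refine Function.update_of_ne ?_ _ _
            rintro rfl
            exact absurd (Fin.le_def.1 hi) (not_le.2 hj)
          · obtain rfl : j = k := Fin.ext hj
            exact hsy
        · exact ⟨x, hx, fun j hj => hxy j (by omega)⟩
    obtain ⟨x, hx, hxy⟩ := key d
    exact ⟨x, hx, funext fun j => hxy j j.isLt⟩

/-! ### The Knothe–Rosenblatt map -/

theorem marginal_congr (f : (Fin d → ℝ) → ℝ) {k : ℕ} {x y : Fin d → ℝ}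
    (h : ∀ j : Fin d, (j : ℕ) < k → x j = y j) : marginal f k x = marginal f k y := by
  unfold marginal
  congr 1
  ext t
  congr 1
  ext j
  split_ifs with hj
  · exact h j hj
  · rfl

theorem condCDF_congr (f : (Fin d → ℝ) → ℝ) {k : Fin d} {x y : Fin d → ℝ}
    (h : ∀ j < k, x j = y j) : condCDF f k x = condCDF f k y := by
  have hu : ∀ t, ∀ j : Fin d, (j : ℕ) < k + 1 → Function.update x k t j = Function.update y k t j := by
    intro t j hj
    rcases eq_or_ne j k with rfl | hjk
    · simp
    · rw [Function.update_of_ne hjk, Function.update_of_ne hjk]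
      exact h j (lt_of_le_of_ne (Nat.lt_succ_iff.1 hj) hjk)
  ext s
  unfold condCDF condDensity
  simp only [marginal_congr f (hu _), marginal_congr f fun j hj => hu _ j (Nat.lt_succ_of_lt hj)]

/-- The conditional distribution functions of `f` are increasing homeomorphisms
from `[-1,1]` to `[0,2]`. -/
structure HasCondCDF (f : (Fin d → ℝ) → ℝ) : Prop where
  continuousOn : ∀ k, ∀ x ∈ cube d, ContinuousOn (condCDF f k x) (Icc (-1) 1)
  strictMonoOn : ∀ k, ∀ x ∈ cube d, StrictMonoOn (condCDF f k x) (Icc (-1) 1)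
  apply_one : ∀ k, ∀ x ∈ cube d, condCDF f k x 1 = 2

theorem condCDF_neg_one (f : (Fin d → ℝ) → ℝ) (k : Fin d) (x : Fin d → ℝ) :
    condCDF f k x (-1) = 0 := intervalIntegral.integral_same

theorem HasCondCDF.mapsTo {f : (Fin d → ℝ) → ℝ} (h : HasCondCDF f) (k : Fin d) {x : Fin d → ℝ}
    (hx : x ∈ cube d) : MapsTo (condCDF f k x) (Icc (-1) 1) (Icc 0 2) := by
  intro s hs
  have hm := (h.strictMonoOn k x hx).monotoneOn
  rw [← condCDF_neg_one f k x, ← h.apply_one k x hx]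
  exact ⟨hm (by norm_num) hs hs.1, hm hs (by norm_num) hs.2⟩

theorem HasCondCDF.surjOn {f : (Fin d → ℝ) → ℝ} (h : HasCondCDF f) (k : Fin d) {x : Fin d → ℝ}
    (hx : x ∈ cube d) : SurjOn (condCDF f k x) (Icc (-1) 1) (Icc 0 2) := by
  have := intermediate_value_Icc (by norm_num) (h.continuousOn k x hx)
  rwa [condCDF_neg_one, h.apply_one k x hx] at this

section

variable {fρ fπ : (Fin d → ℝ) → ℝ}

theorem transportAux_succ_of_ne (x : Fin d → ℝ) {n : ℕ} {j : Fin d} (h : (j : ℕ) ≠ n) :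
    transportAux fρ fπ x (n + 1) j = transportAux fρ fπ x n j := by
  rw [transportAux]
  split_ifs with hn
  · exact Function.update_of_ne (fun e => h (by rw [e])) _ _
  · rfl

theorem transportAux_of_le (x : Fin d → ℝ) {n : ℕ} {j : Fin d} (h : n ≤ j) :
    transportAux fρ fπ x n j = x j := by
  induction n with
  | zero => rfl
  | succ n ih => rw [transportAux_succ_of_ne x (by omega), ih (by omega)]

theorem transportAux_of_lt (x : Fin d → ℝ) {n m : ℕ} {j : Fin d} (h : (j : ℕ) < n) (hnm : n ≤ m) :
    transportAux fρ fπ x m j = transportAux fρ fπ x n j := by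
  induction m, hnm using Nat.le_induction with
  | base => rfl
  | succ m hm ih => rw [transportAux_succ_of_ne x (by omega), ih]

/-- Component `k` is frozen after step `k + 1`, and the target distribution function sees only
earlier components, so the recursion becomes an equation for the finished map. -/
theorem transport_apply (x : Fin d → ℝ) (k : Fin d) :
    transport fρ fπ x k = Function.invFunOn (condCDF fπ k (transport fρ fπ x)) (Icc (-1) 1)
      (condCDF fρ k x (x k)) := by
  have h : condCDF fπ k (transport fρ fπ x) = condCDF fπ k (transportAux fρ fπ x k) :=
    condCDF_congr fπ fun j hj => transportAux_of_lt x hj k.isLt.le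
  rw [h, transport, transportAux_of_lt x (Nat.lt_succ_self k) k.isLt, transportAux,
    dif_pos k.isLt, Function.update_self]

theorem transport_mem_and_condCDF (hρ : HasCondCDF fρ) (hπ : HasCondCDF fπ) {x : Fin d → ℝ}
    (hx : x ∈ cube d) : transport fρ fπ x ∈ cube d ∧ ∀ k,
      condCDF fπ k (transport fρ fπ x) (transport fρ fπ x k) = condCDF fρ k x (x k) := by
  have key : ∀ n : ℕ, transportAux fρ fπ x n ∈ cube d := by
    intro n
    induction n with
    | zero => exact hx
    | succ n ih =>
      rw [transportAux]
      split_ifs with hn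
      · exact update_mem_cube ih (Function.invFunOn_mem (hπ.surjOn _ ih (hρ.mapsTo _ hx (hx _))))
      · exact ih
  refine ⟨key d, fun k => ?_⟩
  conv_lhs => rw [transport_apply]
  exact Function.invFunOn_eq (hπ.surjOn k (key d) (hρ.mapsTo k hx (hx k)))

theorem eq_of_condCDF_eq {f : (Fin d → ℝ) → ℝ} (hf : HasCondCDF f) {x y : Fin d → ℝ}
    (hx : x ∈ cube d) (hy : y ∈ cube d)
    (h : ∀ k, condCDF f k x (x k) = condCDF f k y (y k)) : x = y := by
  have key : ∀ n : ℕ, ∀ k : Fin d, (k : ℕ) = n → x k = y k := by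
    intro n
    induction n using Nat.strong_induction_on with
    | _ n ih =>
      rintro k rfl
      refine (hf.strictMonoOn k x hx).injOn (hx k) (hy k) ?_
      rw [h k, condCDF_congr f (x := x) (y := y) fun j hj => ih j hj j rfl]
  exact funext fun k => key k k rfl

/-- Both points have the same values of all conditional distribution functions of `fρ`, and these
values determine the point coordinate by coordinate. -/
theorem transport_transport (hρ : HasCondCDF fρ) (hπ : HasCondCDF fπ) {x : Fin d → ℝ}
    (hx : x ∈ cube d) : transport fπ fρ (transport fρ fπ x) = x := by
  obtain ⟨h1, h2⟩ := transport_mem_and_condCDF hρ hπ hx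
  obtain ⟨h3, h4⟩ := transport_mem_and_condCDF hπ hρ h1
  exact eq_of_condCDF_eq hρ h3 hx fun k => (h4 k).trans (h2 k)

theorem transport_triangular (k : Fin d) {x y : Fin d → ℝ} (h : ∀ j ≤ k, x j = y j) :
    transport fρ fπ x k = transport fρ fπ y k := by
  have key : ∀ n : ℕ, ∀ i : Fin d, (i : ℕ) = n → i ≤ k →
      transport fρ fπ x i = transport fρ fπ y i := by
    intro n
    induction n using Nat.strong_induction_on with
    | _ n ih =>
      rintro i rfl hi
      rw [transport_apply, transport_apply, h i hi,
        condCDF_congr fρ (x := x) (y := y) fun j hj => h j (hj.le.trans hi),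
        condCDF_congr fπ (x := transport fρ fπ x) (y := transport fρ fπ y)
          fun j hj => ih j hj j rfl (hj.le.trans hi)]
  exact key k k rfl le_rfl

theorem isMonotoneTriangularBijection_transport (hρ : HasCondCDF fρ) (hπ : HasCondCDF fπ) :
    IsMonotoneTriangularBijection (transport fρ fπ) := by
  refine ⟨fun k x _ y _ h => transport_triangular k h, fun k x hx s hs s' hs' hlt => ?_,
    fun x hx => (transport_mem_and_condCDF hρ hπ hx).1, fun x hx y hy hxy => ?_, fun y hy => ?_⟩
  · have hX := update_mem_cube (k := k) hx hs
    have hX' := update_mem_cube (k := k) hx hs'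
    obtain ⟨h1, h2⟩ := transport_mem_and_condCDF hρ hπ hX
    obtain ⟨h3, h4⟩ := transport_mem_and_condCDF hρ hπ hX'
    have e1 : condCDF fρ k (Function.update x k s) = condCDF fρ k x :=
      condCDF_congr fρ fun j hj => Function.update_of_ne hj.ne _ _
    have e2 : condCDF fρ k (Function.update x k s') = condCDF fρ k x :=
      condCDF_congr fρ fun j hj => Function.update_of_ne hj.ne _ _
    have e3 : condCDF fπ k (transport fρ fπ (Function.update x k s)) =
        condCDF fπ k (transport fρ fπ (Function.update x k s')) :=
      condCDF_congr fπ fun j hj => transport_triangular j fun i hi => by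
        rw [Function.update_of_ne (hi.trans_lt hj).ne, Function.update_of_ne (hi.trans_lt hj).ne]
    have h2' := h2 k
    have h4' := h4 k
    rw [e1, Function.update_self, e3] at h2'
    rw [e2, Function.update_self] at h4'
    refine ((hπ.strictMonoOn k _ h3).lt_iff_lt (h1 k) (h3 k)).1 ?_
    rw [h2', h4']
    exact hρ.strictMonoOn k x hx hs hs' hlt
  · rw [← transport_transport hρ hπ hx, hxy, transport_transport hρ hπ hy]
  · exact ⟨transport fπ fρ y, (transport_mem_and_condCDF hπ hρ hy).1, transport_transport hπ hρ hy⟩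

/-- This reduces every statement about `S` to one about a transport with source and target
exchanged. -/
theorem invTransport_eq (hρ : HasCondCDF fρ) (hπ : HasCondCDF fπ) {y : Fin d → ℝ}
    (hy : y ∈ cube d) : invTransport fρ fπ y = transport fπ fρ y := by
  have hbij := (isMonotoneTriangularBijection_transport hρ hπ).bijOn
  have h1 := (transport_mem_and_condCDF hπ hρ hy).1
  have hex : y ∈ transport fρ fπ '' cube d := hbij.surjOn hy
  refine hbij.injOn (Function.invFunOn_mem hex) h1 ?_
  rw [transport_transport hπ hρ hy]
  exact Function.invFunOn_eq hex

end

end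

section


variable {d : ℕ}

/-! ### Marginals -/

/-- The uniform probability measure on `[-1,1]`. -/
def unitMeasure : Measure ℝ := (2 : ℝ≥0)⁻¹ • (volume : Measure ℝ).restrict (Icc (-1) 1)

theorem unitMeasure_univ : unitMeasure univ = 1 := by
  have h : (volume : Measure ℝ) (Icc (-1) 1) = 2 := by
    rw [Real.volume_Icc]; norm_num
  simp only [unitMeasure, Measure.smul_apply, Measure.restrict_apply_univ, h]
  rw [ENNReal.smul_def, smul_eq_mul, ENNReal.coe_inv two_ne_zero]
  exact ENNReal.inv_mul_cancel (by simp) (by simp)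

instance : IsProbabilityMeasure unitMeasure := ⟨unitMeasure_univ⟩

theorem cubeMeasure_eq (d : ℕ) : cubeMeasure d = Measure.pi fun _ => unitMeasure := rfl

instance (d : ℕ) : IsProbabilityMeasure (cubeMeasure d) := by
  rw [cubeMeasure_eq]; infer_instance

theorem ae_unitMeasure : ∀ᵐ s ∂unitMeasure, s ∈ Icc (-1 : ℝ) 1 :=
  Measure.ae_smul_measure (ae_restrict_mem measurableSet_Icc) _

theorem ae_cubeMeasure (d : ℕ) : ∀ᵐ t ∂(cubeMeasure d), t ∈ cube d := by
  rw [cubeMeasure_eq]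
  exact Filter.eventually_all.2 fun j => Measure.tendsto_eval_ae_ae.eventually ae_unitMeasure

theorem restrict_cubeMeasure (d : ℕ) : (cubeMeasure d).restrict (cube d) = cubeMeasure d :=
  Measure.restrict_eq_self_of_ae_mem (ae_cubeMeasure d)

theorem integral_unitMeasure (g : ℝ → ℝ) :
    ∫ s, g s ∂unitMeasure = 2⁻¹ * ∫ s in (-1 : ℝ)..1, g s := by
  rw [unitMeasure, integral_smul_nnreal_measure, intervalIntegral.integral_of_le (by norm_num),
    integral_Icc_eq_integral_Ioc, NNReal.smul_def]
  simp

/-- Resampling one coordinate by an independent uniform variable preserves the product law. Fubini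
in this form relates consecutive marginals without splitting the cube into factors. -/
theorem measurePreserving_update (k : Fin d) :
    MeasurePreserving (fun q : (Fin d → ℝ) × ℝ => Function.update q.1 k q.2)
      ((cubeMeasure d).prod unitMeasure) (cubeMeasure d) := by
  have hm : Measurable fun q : (Fin d → ℝ) × ℝ => Function.update q.1 k q.2 := measurable_update'
  refine ⟨hm, ?_⟩
  rw [cubeMeasure_eq]
  symm
  refine Measure.pi_eq fun s hs => ?_
  rw [Measure.map_apply hm (MeasurableSet.univ_pi hs)]
  have hpre : (fun q : (Fin d → ℝ) × ℝ => Function.update q.1 k q.2) ⁻¹' (univ.pi s) =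
      (univ.pi (Function.update s k univ)) ×ˢ s k := by
    ext ⟨t, u⟩
    simp only [mem_preimage, mem_univ_pi, mem_prod]
    constructor
    · intro h
      refine ⟨fun j => ?_, by simpa using h k⟩
      rcases eq_or_ne j k with rfl | hj
      · simp
      · simpa [hj] using h j
    · rintro ⟨h1, h2⟩ j
      rcases eq_or_ne j k with rfl | hj
      · simpa using h2
      · simpa [hj] using h1 j
  rw [hpre, Measure.prod_prod, Measure.pi_pi]
  rw [← Finset.prod_erase_mul _ _ (Finset.mem_univ k),
    ← Finset.prod_erase_mul _ (fun i => unitMeasure (s i)) (Finset.mem_univ k),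
    Function.update_self, unitMeasure_univ, mul_one]
  congr 1
  refine Finset.prod_congr rfl fun j hj => ?_
  rw [Function.update_of_ne (Finset.ne_of_mem_erase hj)]

/-- The first `k` coordinates of `z`, completed by those of `t`. -/
def mix {R : Type*} (k : ℕ) (z t : Fin d → R) : Fin d → R := fun j => if (j : ℕ) < k then z j else t j

theorem mix_mem_cube (k : ℕ) {x t : Fin d → ℝ} (hx : x ∈ cube d) (ht : t ∈ cube d) :
    mix k x t ∈ cube d := by
  intro j
  unfold mix
  split_ifs
  exacts [hx j, ht j]

theorem mix_mem_complexNhd {δ : Fin d → ℝ} (k : ℕ) {z t : Fin d → ℂ} (hz : z ∈ complexNhd δ)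
    (ht : t ∈ complexNhd δ) : mix k z t ∈ complexNhd δ := by
  rw [mem_complexNhd_iff] at *
  intro j
  unfold mix
  split_ifs
  exacts [hz j, ht j]

theorem toComplex_mix (k : ℕ) (x t : Fin d → ℝ) :
    toComplex (mix k x t) = mix k (toComplex x) (toComplex t) := by
  ext j
  simp only [toComplex, mix]
  split_ifs <;> rfl

/-- Marginals of a function of complex variables: the first `k` variables are kept. -/
def cmarginal (F : (Fin d → ℂ) → ℂ) (k : ℕ) (z : Fin d → ℂ) : ℂ :=
  ∫ t, F (mix k z (toComplex t)) ∂(cubeMeasure d)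

/-- The properties of the marginals `a k` of a density that enter the construction. -/
structure MarginalExtension (M L C : ℝ) (δ : Fin d → ℝ) (f : (Fin d → ℝ) → ℝ)
    (a : ℕ → (Fin d → ℂ) → ℂ) : Prop where
  contDiffOn : ∀ k, ContDiffOn ℂ 1 (a k) (complexNhd δ)
  congr : ∀ (k : ℕ) (z w : Fin d → ℂ), (∀ j : Fin d, (j : ℕ) < k → z j = w j) → a k z = a k w
  norm_le : ∀ k, ∀ z ∈ complexNhd δ, ‖a k z‖ ≤ L
  le_re : ∀ k, ∀ z ∈ complexNhd δ, M / 2 ≤ (a k z).re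
  ofReal : ∀ k, ∀ x ∈ cube d, a k (toComplex x) = marginal f k x
  near : ∀ k : Fin d, ∀ z ∈ complexNhd δ, ∀ x ∈ cube d, (∀ j, ‖z j - x j‖ < δ j) →
    ‖a k z - a k (toComplex x)‖ ≤ C * δ k
  near_succ : ∀ k : Fin d, ∀ z ∈ complexNhd δ, ∀ x ∈ cube d, (∀ j, ‖z j - x j‖ < δ j) →
    ∀ t ∈ Icc (-1 : ℝ) 1,
      ‖a (k + 1) (Function.update z k t) - a (k + 1) (Function.update (toComplex x) k t)‖ ≤ C * δ k
  integral_eq : ∀ k : Fin d, ∀ x ∈ cube d,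
    ∫ t in (-1 : ℝ)..1, marginal f (k + 1) (Function.update x k t) = 2 * marginal f k x

section

variable {δ : Fin d → ℝ} {F : (Fin d → ℂ) → ℂ}

/-- The projection to the first `k` coordinates. -/
def maskCLM (d k : ℕ) : (Fin d → ℂ) →L[ℂ] (Fin d → ℂ) :=
  ContinuousLinearMap.pi fun j => if (j : ℕ) < k then ContinuousLinearMap.proj j else 0

theorem maskCLM_add (k : ℕ) (z t : Fin d → ℂ) : maskCLM d k z + mix k 0 t = mix k z t := by
  ext j
  by_cases h : (j : ℕ) < k <;> simp [maskCLM, mix, h]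

theorem continuous_mix_zero (k : ℕ) :
    Continuous fun t : Fin d → ℝ => mix k (0 : Fin d → ℂ) (toComplex t) := by
  refine continuous_pi fun j => ?_
  unfold mix toComplex
  split_ifs <;> fun_prop

theorem contDiffOn_cmarginal (hδ : ∀ j, 0 < δ j) (hF : ContDiffOn ℂ 1 F (complexNhd δ)) (k : ℕ) :
    ContDiffOn ℂ 1 (cmarginal F k) (complexNhd δ) := by
  have h := contDiffOn_setIntegral_comp_affine (μ := cubeMeasure d) (isCompact_cube d)
    (measurableSet_cube d) (isOpen_complexNhd δ) (isOpen_complexNhd δ) hF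
    (A := fun _ => maskCLM d k) continuousOn_const
    (c := fun t => mix k 0 (toComplex t)) (continuous_mix_zero k).continuousOn
    (φ := fun _ => 1) continuousOn_const ?_
  · simp only [restrict_cubeMeasure, maskCLM_add, one_mul] at h
    exact h
  · intro z hz t ht
    rw [maskCLM_add]
    exact mix_mem_complexNhd k hz (toComplex_mem_complexNhd hδ ht)

theorem continuousOn_comp_mix (hδ : ∀ j, 0 < δ j) (hF : ContDiffOn ℂ 1 F (complexNhd δ)) (k : ℕ)
    {z : Fin d → ℂ} (hz : z ∈ complexNhd δ) :
    ContinuousOn (fun t => F (mix k z (toComplex t))) (cube d) := by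
  refine hF.continuousOn.comp ?_ fun t ht =>
    mix_mem_complexNhd k hz (toComplex_mem_complexNhd hδ ht)
  simp_rw [← maskCLM_add k z]
  exact (continuous_const.add (continuous_mix_zero k)).continuousOn

theorem integrable_comp_mix (hδ : ∀ j, 0 < δ j) (hF : ContDiffOn ℂ 1 F (complexNhd δ)) (k : ℕ)
    {z : Fin d → ℂ} (hz : z ∈ complexNhd δ) :
    Integrable (fun t => F (mix k z (toComplex t))) (cubeMeasure d) := by
  rw [← restrict_cubeMeasure]
  exact (continuousOn_comp_mix hδ hF k hz).integrableOn_compact' (isCompact_cube d)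
    (measurableSet_cube d)

theorem norm_cmarginal_sub_le (hδ : ∀ j, 0 < δ j) (hF : ContDiffOn ℂ 1 F (complexNhd δ)) (k : ℕ)
    {z w : Fin d → ℂ} (hz : z ∈ complexNhd δ) (hw : w ∈ complexNhd δ) {C : ℝ}
    (h : ∀ t ∈ cube d, ‖F (mix k z (toComplex t)) - F (mix k w (toComplex t))‖ ≤ C) :
    ‖cmarginal F k z - cmarginal F k w‖ ≤ C := by
  unfold cmarginal
  rw [← integral_sub (integrable_comp_mix hδ hF k hz) (integrable_comp_mix hδ hF k hw)]
  refine (norm_integral_le_of_norm_le_const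
    ((ae_cubeMeasure d).mono fun t ht => h t ht)).trans ?_
  simp

/-- Marginals average `F` over real values of the later variables, so pointwise bounds on `F` pass
to them. The lower bound on the real part combines `f ≥ M` on the cube with a variation of at most
`C ≤ M / 2`. -/
theorem marginalExtension_cmarginal {M L C : ℝ} (hδ : ∀ j, 0 < δ j) {f : (Fin d → ℝ) → ℝ}
    (hC0 : 0 < C) (hC : C ≤ M / 2) (hpos : ∀ x ∈ cube d, 0 < f x)
    (hFf : ∀ x ∈ cube d, F (toComplex x) = (f x : ℂ)) (hF : ContDiffOn ℂ 1 F (complexNhd δ))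
    (hbd : ∀ z ∈ complexNhd δ, M ≤ ‖F z‖ ∧ ‖F z‖ ≤ L)
    (hvar : ∀ x ∈ cube d, ∀ y : Fin d → ℂ, (∀ j, ‖y j‖ < δ j) →
      ‖F (toComplex x + y) - F (toComplex x)‖ ≤ C)
    (hvar' : ∀ k : Fin d, 0 < (k : ℕ) → ∀ x ∈ cube d, ∀ y : Fin d → ℂ,
      (∀ j, j < k → ‖y j‖ < δ j) → (∀ j, k ≤ j → y j = 0) →
        ‖F (toComplex x + y) - F (toComplex x)‖ ≤ C * δ k) :
    MarginalExtension M L C δ f (cmarginal F) := by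
  have hcx : ∀ {x : Fin d → ℝ}, x ∈ cube d → toComplex x ∈ complexNhd δ :=
    fun hx => toComplex_mem_complexNhd hδ hx
  have hfM : ∀ x ∈ cube d, M ≤ f x := by
    intro x hx
    have h := (hbd _ (hcx hx)).1
    rwa [hFf x hx, Complex.norm_real, Real.norm_of_nonneg (hpos x hx).le] at h
  have hreal : ∀ k, ∀ x ∈ cube d, ∀ t ∈ cube d,
      F (mix k (toComplex x) (toComplex t)) = (f (mix k x t) : ℂ) := by
    intro k x hx t ht
    rw [← toComplex_mix, hFf _ (mix_mem_cube k hx ht)]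
  have hvark : ∀ k : Fin d, ∀ z : Fin d → ℂ, ∀ x ∈ cube d, (∀ j, ‖z j - x j‖ < δ j) →
      ∀ t ∈ cube d, ‖F (mix k z (toComplex t)) - F (mix k (toComplex x) (toComplex t))‖ ≤
        C * δ k := by
    intro k z x hx hzx t ht
    -- The hypothesis says nothing at `k = 0`, but there no coordinate is perturbed and the
    -- difference vanishes.
    rcases Nat.eq_zero_or_pos (k : ℕ) with h0 | h0
    · have : mix k z (toComplex t) = mix k (toComplex x) (toComplex t) := by
        ext j; simp [mix, h0]
      rw [this, sub_self, norm_zero]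
      exact (mul_pos hC0 (hδ k)).le
    · have e : mix k z (toComplex t) = toComplex (mix k x t) + mix k (z - toComplex x) 0 := by
        ext j
        simp only [mix, toComplex, Pi.add_apply, Pi.sub_apply]
        split_ifs <;> simp
      rw [e, ← toComplex_mix]
      refine hvar' k h0 _ (mix_mem_cube k hx ht) _ (fun j hj => ?_) fun j hj => ?_
      · have hj' : (j : ℕ) < k := hj
        simpa [mix, hj', toComplex] using hzx j
      · have hj' : ¬ (j : ℕ) < k := not_lt.2 hj
        simp [mix, hj']
  refine ⟨contDiffOn_cmarginal hδ hF, ?_, ?_, ?_, ?_, ?_, ?_, ?_⟩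
  · intro k z w h
    unfold cmarginal
    congr 1
    ext t
    congr 1
    ext j
    unfold mix
    split_ifs with hj
    exacts [h j hj, rfl]
  · intro k z hz
    unfold cmarginal
    refine (norm_integral_le_of_norm_le_const ((ae_cubeMeasure d).mono fun t ht =>
      (hbd _ (mix_mem_complexNhd k hz (hcx ht))).2)).trans ?_
    simp
  · intro k z hz
    obtain ⟨x, hx, hxz⟩ := exists_cube_near hz
    have hint := integrable_comp_mix hδ hF k hz
    have h1 : (cmarginal F k z).re = ∫ t, (F (mix k z (toComplex t))).re ∂(cubeMeasure d) := by
      unfold cmarginal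
      exact (Complex.reCLM.integral_comp_comm hint).symm
    have h2 : ∫ _ : Fin d → ℝ, M / 2 ∂(cubeMeasure d) = M / 2 := by simp
    rw [h1, ← h2]
    refine integral_mono_ae (integrable_const _) hint.re ?_
    filter_upwards [ae_cubeMeasure d] with t ht
    have e : mix k z (toComplex t) = toComplex (mix k x t) + mix k (z - toComplex x) 0 := by
      ext j
      simp only [mix, toComplex, Pi.add_apply, Pi.sub_apply]
      split_ifs <;> simp
    have h3 := hvar _ (mix_mem_cube k hx ht) (mix k (z - toComplex x) 0) fun j => by
      simp only [mix, toComplex, Pi.sub_apply, Pi.zero_apply]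
      split_ifs
      · exact hxz j
      · simpa using hδ j
    rw [← e, hFf _ (mix_mem_cube k hx ht)] at h3
    have h4 := (Complex.abs_re_le_norm _).trans h3
    rw [Complex.sub_re, Complex.ofReal_re] at h4
    have h5 := hfM _ (mix_mem_cube k hx ht)
    have h6 := (abs_le.1 h4).1
    linarith
  · intro k x hx
    unfold cmarginal marginal
    rw [← integral_complex_ofReal]
    refine integral_congr_ae ?_
    filter_upwards [ae_cubeMeasure d] with t ht
    exact hreal k x hx t ht
  · intro k z hz x hx hzx
    exact norm_cmarginal_sub_le hδ hF k hz (hcx hx) (hvark k z x hx hzx)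
  · intro k z hz x hx hzx t ht
    have htm : (t : ℂ) ∈ intervalNhd (δ k) := ofReal_mem_intervalNhd (hδ k) ht
    refine norm_cmarginal_sub_le hδ hF _ (update_mem_complexNhd hz htm)
      (update_mem_complexNhd (hcx hx) htm) fun s hs => ?_
    -- With coordinate `k` fixed at the real value `t`, only coordinates below `k` are perturbed, so
    -- the bound `C δ_k` still applies although `k + 1` variables are kept.
    have e : ∀ w : Fin d → ℂ, mix ((k : ℕ) + 1) (Function.update w k t) (toComplex s) =
        mix k w (toComplex (Function.update s k t)) := by
      intro w
      ext j
      rcases eq_or_ne j k with rfl | hjk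
      · simp [mix, toComplex]
      · have : (j : ℕ) ≠ k := fun h => hjk (Fin.ext h)
        have h2 : ((j : ℕ) < k + 1) = ((j : ℕ) < k) := by
          rw [eq_iff_iff]; omega
        simp only [mix, toComplex, Function.update_of_ne hjk, h2]
    rw [e, e]
    exact hvark k z x hx hzx _ (update_mem_cube hs ht)
  · intro k x hx
    have hfi : Integrable (fun t => f (mix k x t)) (cubeMeasure d) := by
      refine (integrable_comp_mix hδ hF k (hcx hx)).re.congr ?_
      filter_upwards [ae_cubeMeasure d] with t ht
      simp [hreal k x hx t ht]
    have hmp := measurePreserving_update k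
    have e : ∀ t : Fin d → ℝ, ∀ s : ℝ,
        (fun j : Fin d => if (j : ℕ) < k + 1 then Function.update x k s j else t j) =
        mix k x (Function.update t k s) := by
      intro t s
      ext j
      rcases eq_or_ne j k with rfl | hjk
      · simp [mix]
      · have : (j : ℕ) ≠ k := fun h => hjk (Fin.ext h)
        have h2 : ((j : ℕ) < k + 1) = ((j : ℕ) < k) := by
          rw [eq_iff_iff]; omega
        simp only [mix, Function.update_of_ne hjk, h2]
    have hprod : Integrable (fun q : (Fin d → ℝ) × ℝ => f (mix k x (Function.update q.1 k q.2)))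
        ((cubeMeasure d).prod unitMeasure) := by
      have := hfi
      rw [← hmp.map_eq] at this
      exact this.comp_measurable hmp.measurable
    have h1 : marginal f k x = ∫ s, marginal f (k + 1) (Function.update x k s) ∂unitMeasure := by
      unfold marginal
      simp_rw [e]
      rw [← integral_prod_symm _ hprod]
      have hm2 : AEStronglyMeasurable (fun t => f (mix k x t))
          (Measure.map (fun q : (Fin d → ℝ) × ℝ => Function.update q.1 k q.2)
            ((cubeMeasure d).prod unitMeasure)) := by
        rw [hmp.map_eq]; exact hfi.aestronglyMeasurable
      rw [← integral_map hmp.measurable.aemeasurable hm2, hmp.map_eq]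
      rfl
    rw [integral_unitMeasure] at h1
    linarith

end

theorem DensityAssumption.exists_marginalExtension {M L C : ℝ} {δ : Fin d → ℝ}
    {f : (Fin d → ℝ) → ℝ} (h : DensityAssumption M L C δ f) (hδ : ∀ j, 0 < δ j)
    (hC0 : 0 < C) (hC : C ≤ M / 2) : ∃ a, MarginalExtension M L C δ f a := by
  obtain ⟨hf, F, hFf, hF, hbd, hvar, hvar'⟩ := h
  exact ⟨_, marginalExtension_cmarginal hδ hC0 hC hf.pos hFf hF hbd hvar hvar'⟩

namespace MarginalExtension

variable {M L C : ℝ} {δ : Fin d → ℝ} {f : (Fin d → ℝ) → ℝ} {a : ℕ → (Fin d → ℂ) → ℂ}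

theorem marginal_pos (h : MarginalExtension M L C δ f a) (hM : 0 < M) (hδ : ∀ j, 0 < δ j) (k : ℕ)
    {x : Fin d → ℝ} (hx : x ∈ cube d) : 0 < marginal f k x := by
  have h1 := h.le_re k _ (toComplex_mem_complexNhd hδ hx)
  rw [h.ofReal k x hx, Complex.ofReal_re] at h1
  linarith

theorem continuousOn_marginal (h : MarginalExtension M L C δ f a) (hδ : ∀ j, 0 < δ j) (k : ℕ) :
    ContinuousOn (marginal f k) (cube d) := by
  have : ContinuousOn (fun x => (a k (toComplex x)).re) (cube d) :=
    Complex.continuous_re.comp_continuousOn ((h.contDiffOn k).continuousOn.comp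
      continuous_toComplex.continuousOn fun x hx => toComplex_mem_complexNhd hδ hx)
  exact this.congr fun x hx => by simp only [h.ofReal k x hx, Complex.ofReal_re]

theorem continuousOn_marginal_update (h : MarginalExtension M L C δ f a) (hδ : ∀ j, 0 < δ j)
    (l : ℕ) (k : Fin d) {x : Fin d → ℝ} (hx : x ∈ cube d) :
    ContinuousOn (fun t => marginal f l (Function.update x k t)) (Icc (-1) 1) :=
  (h.continuousOn_marginal hδ l).comp
    (continuous_const.update k continuous_id :
      Continuous fun t : ℝ => Function.update x k t).continuousOn fun _ ht => update_mem_cube hx ht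

theorem condCDF_eq (f : (Fin d → ℝ) → ℝ) (k : Fin d) (x : Fin d → ℝ) (s : ℝ) :
    condCDF f k x s =
      (∫ t in (-1 : ℝ)..s, marginal f (k + 1) (Function.update x k t)) / marginal f k x := by
  unfold condCDF condDensity
  rw [← intervalIntegral.integral_div]
  congr 1
  ext t
  rw [marginal_congr f (k := k) (x := Function.update x k t) (y := x) fun j hj =>
    Function.update_of_ne (fun e => by rw [e] at hj; exact lt_irrefl _ hj) _ _]

/-- Positivity of the marginals gives strict monotonicity. The total mass is `2` because densities
are taken with respect to `λ/2` while the distribution function integrates `dt`. -/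
theorem hasCondCDF (h : MarginalExtension M L C δ f a) (hM : 0 < M) (hδ : ∀ j, 0 < δ j) :
    HasCondCDF f := by
  have hint : ∀ (k : Fin d), ∀ x ∈ cube d, ∀ s ∈ Icc (-1 : ℝ) 1, ∀ s' ∈ Icc (-1 : ℝ) 1,
      IntervalIntegrable (fun t => marginal f (k + 1) (Function.update x k t)) volume s s' := by
    intro k x hx s hs s' hs'
    refine ContinuousOn.intervalIntegrable
      ((h.continuousOn_marginal_update hδ _ k hx).mono ?_)
    exact uIcc_subset_Icc hs hs'
  refine ⟨fun k x hx => ?_, fun k x hx s hs s' hs' hlt => ?_, fun k x hx => ?_⟩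
  · simp_rw [funext (condCDF_eq f k x)]
    refine ContinuousOn.div_const ?_ _
    have h1 := hint k x hx (-1) (by norm_num) 1 (by norm_num)
    have h2 := intervalIntegral.continuousOn_primitive_interval'
      (a := (-1 : ℝ)) h1 (by simp)
    rwa [uIcc_of_le (by norm_num)] at h2
  · rw [condCDF_eq, condCDF_eq]
    refine div_lt_div_of_pos_right ?_ (h.marginal_pos hM hδ k hx)
    rw [← sub_pos, intervalIntegral.integral_interval_sub_left
      (hint k x hx _ (by norm_num) _ hs') (hint k x hx _ (by norm_num) _ hs)]
    refine intervalIntegral.intervalIntegral_pos_of_pos_on (hint k x hx _ hs _ hs') ?_ hlt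
    intro t ht
    exact h.marginal_pos hM hδ _ (update_mem_cube hx ⟨hs.1.trans ht.1.le, ht.2.le.trans hs'.2⟩)
  · rw [condCDF_eq, h.integral_eq k x hx, mul_div_assoc, div_self (h.marginal_pos hM hδ k hx).ne',
      mul_one]

end MarginalExtension

end

section


variable {d : ℕ}

/-! ### Primitives in one coordinate -/

/-- The integral of `a` in the coordinate `k` along the segment from `-1` to `z k`. -/
def segPrimitive (k : Fin d) (a : (Fin d → ℂ) → ℂ) (z : Fin d → ℂ) : ℂ :=
  (z k + 1) * ∫ r in Icc (0 : ℝ) 1, a (Function.update z k (-1 + r * (z k + 1)))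

theorem segment_mem_intervalNhd {δ : ℝ} (hδ : 0 < δ) {ζ : ℂ} (hζ : ζ ∈ intervalNhd δ) {r : ℝ}
    (hr : r ∈ Icc (0 : ℝ) 1) : -1 + (r : ℂ) * (ζ + 1) ∈ intervalNhd δ := by
  have h1 : ((-1 : ℝ) : ℂ) ∈ intervalNhd δ := ofReal_mem_intervalNhd hδ (by norm_num)
  have h := convex_intervalNhd δ h1 hζ (sub_nonneg.2 hr.2) hr.1 (by ring)
  convert h using 1
  simp only [Complex.real_smul]
  push_cast
  ring

theorem segPrimitive_congr {k : Fin d} {a : (Fin d → ℂ) → ℂ}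
    (ha : ∀ z w : Fin d → ℂ, (∀ j : Fin d, (j : ℕ) < k + 1 → z j = w j) → a z = a w)
    {z w : Fin d → ℂ} (h : ∀ j ≤ k, z j = w j) : segPrimitive k a z = segPrimitive k a w := by
  unfold segPrimitive
  rw [h k le_rfl]
  congr 2
  ext r
  refine ha _ _ fun j hj => ?_
  rcases eq_or_ne j k with rfl | hjk
  · simp
  · rw [Function.update_of_ne hjk, Function.update_of_ne hjk]
    exact h j (Nat.lt_succ_iff.1 hj)

section

variable {δ : Fin d → ℝ} {a : (Fin d → ℂ) → ℂ} {k : Fin d}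

theorem contDiffOn_segPrimitive (hδ : ∀ j, 0 < δ j) (ha : ContDiffOn ℂ 1 a (complexNhd δ))
    (k : Fin d) : ContDiffOn ℂ 1 (segPrimitive k a) (complexNhd δ) := by
  set A : ℝ → (Fin d → ℂ) →L[ℂ] (Fin d → ℂ) := fun r =>
    ContinuousLinearMap.id ℂ (Fin d → ℂ) + ((r - 1 : ℝ) : ℂ) •
      (ContinuousLinearMap.single ℂ (fun _ : Fin d => ℂ) k).comp (ContinuousLinearMap.proj k)
      with hA
  have e : ∀ (z : Fin d → ℂ) (r : ℝ), A r z + Pi.single k ((r - 1 : ℝ) : ℂ) =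
      Function.update z k (-1 + r * (z k + 1)) := by
    intro z r
    ext j
    rcases eq_or_ne j k with rfl | hjk
    · simp [hA]; ring
    · simp [hA, hjk]
  have h := contDiffOn_setIntegral_comp_affine (μ := volume) (K := Icc (0 : ℝ) 1)
    isCompact_Icc measurableSet_Icc (isOpen_complexNhd δ) (isOpen_complexNhd δ) ha
    (A := A) (Continuous.continuousOn (by fun_prop))
    (c := fun r => Pi.single k ((r - 1 : ℝ) : ℂ))
    ((ContinuousLinearMap.single ℂ (fun _ : Fin d => ℂ) k).continuous.comp
      (by fun_prop : Continuous fun r : ℝ => ((r - 1 : ℝ) : ℂ))).continuousOn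
    (φ := fun _ => 1) continuousOn_const ?_
  · simp only [e, one_mul] at h
    have h2 : ContDiff ℂ 1 fun z : Fin d → ℂ => z k + 1 :=
      (contDiff_apply ℂ ℂ k).add contDiff_const
    exact h2.contDiffOn.mul h
  · intro z hz r hr
    rw [e]
    exact update_mem_complexNhd hz (segment_mem_intervalNhd (hδ k) (hz k) hr)

/-- A holomorphic function on a convex set has a primitive `G`, and the segment integral equals `G ζ
- G (-1)`. The segment formula is kept as the definition because it is visibly holomorphic in all
variables. -/
theorem hasDerivAt_segPrimitive (hδ : ∀ j, 0 < δ j) (ha : ContDiffOn ℂ 1 a (complexNhd δ))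
    {z : Fin d → ℂ} (hz : z ∈ complexNhd δ) {ζ : ℂ} (hζ : ζ ∈ intervalNhd (δ k)) :
    HasDerivAt (fun ζ => segPrimitive k a (Function.update z k ζ)) (a (Function.update z k ζ)) ζ := by
  have hV := isOpen_intervalNhd (δ k)
  have hd : DifferentiableOn ℂ (fun ζ => a (Function.update z k ζ)) (intervalNhd (δ k)) :=
    (ha.differentiableOn one_ne_zero).comp
      (fun ζ _ => (hasDerivAt_update z k ζ).differentiableAt.differentiableWithinAt)
      fun ζ hζ => update_mem_complexNhd hz hζ
  obtain ⟨G, hG⟩ := (convex_intervalNhd (δ k)).exists_forall_hasDerivWithinAt hd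
  have hG' : ∀ ζ ∈ intervalNhd (δ k), HasDerivAt G (a (Function.update z k ζ)) ζ := fun ζ hζ =>
    (hG ζ hζ).hasDerivAt (hV.mem_nhds hζ)
  have heq : ∀ ζ ∈ intervalNhd (δ k), segPrimitive k a (Function.update z k ζ) = G ζ - G (-1) := by
    intro ζ hζ
    have hmem : ∀ r ∈ uIcc (0 : ℝ) 1, -1 + (r : ℂ) * (ζ + 1) ∈ intervalNhd (δ k) := by
      intro r hr
      rw [uIcc_of_le zero_le_one] at hr
      exact segment_mem_intervalNhd (hδ k) hζ hr
    have hder : ∀ r ∈ uIcc (0 : ℝ) 1, HasDerivAt (fun r : ℝ => G (-1 + (r : ℂ) * (ζ + 1)))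
        (a (Function.update z k (-1 + r * (ζ + 1))) * (ζ + 1)) r := by
      intro r hr
      have h1 : HasDerivAt (fun r : ℝ => -1 + (r : ℂ) * (ζ + 1)) (ζ + 1) r := by
        simpa using ((Complex.ofRealCLM.hasDerivAt (x := r)).mul_const (ζ + 1)).const_add (-1)
      exact (hG' _ (hmem r hr)).comp r h1
    have hint : IntervalIntegrable
        (fun r : ℝ => a (Function.update z k (-1 + r * (ζ + 1))) * (ζ + 1)) volume 0 1 := by
      refine ContinuousOn.intervalIntegrable (ContinuousOn.mul ?_ continuousOn_const)
      exact hd.continuousOn.comp (f := fun r : ℝ => -1 + (r : ℂ) * (ζ + 1))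
        (Continuous.continuousOn (by fun_prop)) hmem
    have h2 := intervalIntegral.integral_eq_sub_of_hasDerivAt hder hint
    unfold segPrimitive
    rw [Function.update_self, integral_Icc_eq_integral_Ioc,
      ← intervalIntegral.integral_of_le zero_le_one, mul_comm,
      ← intervalIntegral.integral_mul_const]
    simp only [Function.update_idem]
    rw [h2]
    congr 2 <;> push_cast <;> ring
  exact ((hG' ζ hζ).sub_const (G (-1))).congr_of_eventuallyEq
    (Filter.mem_of_superset (hV.mem_nhds hζ) heq)

theorem segPrimitive_neg_one (z : Fin d → ℂ) :
    segPrimitive k a (Function.update z k (-1)) = 0 := by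
  simp [segPrimitive]

theorem segPrimitive_ofReal (hδ : ∀ j, 0 < δ j) (ha : ContDiffOn ℂ 1 a (complexNhd δ))
    {z : Fin d → ℂ} (hz : z ∈ complexNhd δ) {s : ℝ} (hs : s ∈ Icc (-1 : ℝ) 1) :
    segPrimitive k a (Function.update z k s) = ∫ t in (-1 : ℝ)..s, a (Function.update z k t) := by
  have hmem : ∀ t ∈ uIcc (-1 : ℝ) s, (t : ℂ) ∈ intervalNhd (δ k) := by
    intro t ht
    rw [uIcc_of_le hs.1] at ht
    exact ofReal_mem_intervalNhd (hδ k) ⟨ht.1, ht.2.trans hs.2⟩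
  have hcont : ContinuousOn (fun ζ : ℂ => a (Function.update z k ζ)) (intervalNhd (δ k)) :=
    ha.continuousOn.comp (continuous_const.update k continuous_id :
      Continuous fun ζ : ℂ => Function.update z k ζ).continuousOn
      fun ζ hζ => update_mem_complexNhd hz hζ
  have h := intervalIntegral.integral_eq_sub_of_hasDerivAt
    (f := fun t : ℝ => segPrimitive k a (Function.update z k (t : ℂ)))
    (fun t ht => (hasDerivAt_segPrimitive hδ ha hz (hmem t ht)).comp_ofReal)
    (hcont.comp Complex.continuous_ofReal.continuousOn hmem).intervalIntegrable
  rw [h, Complex.ofReal_neg, Complex.ofReal_one, segPrimitive_neg_one, sub_zero]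

theorem norm_segPrimitive_sub_le (hδ : ∀ j, 0 < δ j) (ha : ContDiffOn ℂ 1 a (complexNhd δ))
    {L : ℝ} (hL : ∀ z ∈ complexNhd δ, ‖a z‖ ≤ L)
    {z : Fin d → ℂ} (hz : z ∈ complexNhd δ) {ζ ζ' : ℂ} (hζ : ζ ∈ intervalNhd (δ k))
    (hζ' : ζ' ∈ intervalNhd (δ k)) :
    ‖segPrimitive k a (Function.update z k ζ) - segPrimitive k a (Function.update z k ζ')‖ ≤
      L * ‖ζ - ζ'‖ :=
  (convex_intervalNhd (δ k)).norm_image_sub_le_of_norm_hasDerivWithin_le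
    (fun _ hw => (hasDerivAt_segPrimitive hδ ha hz hw).hasDerivWithinAt)
    (fun _ hw => hL _ (update_mem_complexNhd hz hw)) hζ' hζ

/-- A lower bound on the real part of the derivative makes the primitive expanding: along the
segment in direction `v`, the real part of the primitive times `conj v` grows at rate at least `c
‖v‖²`. -/
theorem le_norm_segPrimitive_sub (hδ : ∀ j, 0 < δ j) (ha : ContDiffOn ℂ 1 a (complexNhd δ))
    {c : ℝ} (hc : ∀ z ∈ complexNhd δ, c ≤ (a z).re)
    {z : Fin d → ℂ} (hz : z ∈ complexNhd δ) {ζ ζ' : ℂ} (hζ : ζ ∈ intervalNhd (δ k))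
    (hζ' : ζ' ∈ intervalNhd (δ k)) :
    c * ‖ζ - ζ'‖ ≤
      ‖segPrimitive k a (Function.update z k ζ) - segPrimitive k a (Function.update z k ζ')‖ := by
  rcases eq_or_ne ζ ζ' with rfl | hne
  · simp
  set P : ℂ → ℂ := fun ζ => segPrimitive k a (Function.update z k ζ) with hP
  set v := ζ - ζ' with hv
  have hv0 : 0 < ‖v‖ := norm_pos_iff.2 (sub_ne_zero.2 hne)
  set h : ℝ → ℝ := fun r => (P (ζ' + r * v) * (starRingEnd ℂ) v).re with hh
  have hmem : ∀ r ∈ Icc (0 : ℝ) 1, ζ' + (r : ℂ) * v ∈ intervalNhd (δ k) := by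
    intro r hr
    have := convex_intervalNhd (δ k) hζ' hζ (sub_nonneg.2 hr.2) hr.1 (by ring)
    convert this using 1
    simp only [Complex.real_smul, hv]
    push_cast
    ring
  have hder : ∀ r ∈ Icc (0 : ℝ) 1, HasDerivAt h
      ((a (Function.update z k (ζ' + r * v)) * v * (starRingEnd ℂ) v).re) r := by
    intro r hr
    have h1 : HasDerivAt (fun r : ℝ => ζ' + (r : ℂ) * v) v r := by
      simpa using ((Complex.ofRealCLM.hasDerivAt (x := r)).mul_const v).const_add ζ'
    have h2 : HasDerivAt (fun r : ℝ => P (ζ' + (r : ℂ) * v))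
        (a (Function.update z k (ζ' + r * v)) * v) r :=
      HasDerivAt.comp (h₂ := P) r (hasDerivAt_segPrimitive hδ ha hz (hmem r hr)) h1
    exact Complex.reCLM.hasFDerivAt.comp_hasDerivAt r (h2.mul_const _)
  have hmv := (convex_Icc (0 : ℝ) 1).mul_sub_le_image_sub_of_le_deriv (f := h) (C := c * ‖v‖ ^ 2)
    (fun r hr => (hder r hr).continuousAt.continuousWithinAt)
    (fun r hr => (hder r (interior_subset hr)).differentiableAt.differentiableWithinAt) ?_
    0 (by norm_num) 1 (by norm_num) zero_le_one
  · have e : h 1 - h 0 = ((P ζ - P ζ') * (starRingEnd ℂ) v).re := by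
      simp only [hh, Complex.ofReal_one, one_mul, Complex.ofReal_zero, zero_mul, add_zero, hv,
        add_sub_cancel, sub_mul, Complex.sub_re]
    have h3 : ((P ζ - P ζ') * (starRingEnd ℂ) v).re ≤ ‖P ζ - P ζ'‖ * ‖v‖ := by
      refine (Complex.re_le_norm _).trans (le_of_eq ?_)
      rw [norm_mul, Complex.norm_conj]
    rw [e] at hmv
    have h4 : c * ‖v‖ * ‖v‖ ≤ ‖P ζ - P ζ'‖ * ‖v‖ := by
      calc _ = c * ‖v‖ ^ 2 * (1 - 0) := by ring
        _ ≤ _ := hmv.trans h3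
    exact le_of_mul_le_mul_right h4 hv0
  · intro r hr
    have hr' := interior_subset hr
    rw [(hder r hr').deriv, mul_assoc, Complex.mul_conj, Complex.re_mul_ofReal,
      Complex.normSq_eq_norm_sq]
    exact mul_le_mul_of_nonneg_right (hc _ (update_mem_complexNhd hz (hmem r hr'))) (by positivity)

theorem injOn_segPrimitive (hδ : ∀ j, 0 < δ j) (ha : ContDiffOn ℂ 1 a (complexNhd δ))
    {c : ℝ} (hc0 : 0 < c) (hc : ∀ z ∈ complexNhd δ, c ≤ (a z).re)
    {z : Fin d → ℂ} (hz : z ∈ complexNhd δ) :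
    InjOn (fun ζ => segPrimitive k a (Function.update z k ζ)) (intervalNhd (δ k)) := by
  intro ζ hζ ζ' hζ' h
  have h1 := le_norm_segPrimitive_sub hδ ha hc hz hζ hζ'
  simp only at h
  rw [h, sub_self, norm_zero] at h1
  have : ‖ζ - ζ'‖ ≤ 0 := by
    by_contra! hlt
    nlinarith
  exact sub_eq_zero.1 (norm_le_zero_iff.1 this)

/-- Quantitative open mapping: on the circle of radius `δ_k / 2` about `s` the primitive is at least
`c δ_k / 2` away from its central value, so the image of the closed disc contains the disc of half
that radius. -/
theorem exists_segPrimitive_eq (hδ : ∀ j, 0 < δ j) (ha : ContDiffOn ℂ 1 a (complexNhd δ))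
    {c : ℝ} (hc0 : 0 < c) (hc : ∀ z ∈ complexNhd δ, c ≤ (a z).re)
    {z : Fin d → ℂ} (hz : z ∈ complexNhd δ) {s : ℝ} (hs : s ∈ Icc (-1 : ℝ) 1) {v : ℂ}
    (hv : ‖v - segPrimitive k a (Function.update z k s)‖ < c * (δ k / 2) / 2) :
    ∃ ζ ∈ intervalNhd (δ k), segPrimitive k a (Function.update z k ζ) = v := by
  have hδ2 : 0 < δ k / 2 := by linarith [hδ k]
  have hsub : closedBall (s : ℂ) (δ k / 2) ⊆ intervalNhd (δ k) := fun ζ hζ =>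
    ⟨s, hs, by rw [mem_closedBall, dist_eq_norm] at hζ; linarith⟩
  have hsm : (s : ℂ) ∈ intervalNhd (δ k) := hsub (mem_closedBall_self hδ2.le)
  have hd : DifferentiableOn ℂ (fun ζ => segPrimitive k a (Function.update z k ζ))
      (intervalNhd (δ k)) := fun ζ hζ =>
    (hasDerivAt_segPrimitive hδ ha hz hζ).differentiableAt.differentiableWithinAt
  have h := DiffContOnCl.ball_subset_image_closedBall
    (f := fun ζ => segPrimitive k a (Function.update z k ζ)) (z₀ := (s : ℂ)) (r := δ k / 2)
    (ε := c * (δ k / 2)) ((hd.mono hsub).diffContOnCl_ball subset_rfl) hδ2 ?_ ?_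
  · obtain ⟨ζ, hζ, hζv⟩ := h (show v ∈ _ by rw [mem_ball, dist_eq_norm]; exact hv)
    exact ⟨ζ, hsub hζ, hζv⟩
  · intro ζ hζ
    have h1 := le_norm_segPrimitive_sub hδ ha hc hz (hsub (sphere_subset_closedBall hζ)) hsm
    rwa [mem_sphere_iff_norm.1 hζ] at h1
  · have hne : ∀ᶠ ζ in 𝓝[≠] (s : ℂ), segPrimitive k a (Function.update z k ζ) ≠
        segPrimitive k a (Function.update z k (s : ℂ)) := by
      filter_upwards [self_mem_nhdsWithin,
        nhdsWithin_le_nhds ((isOpen_intervalNhd _).mem_nhds hsm)] with ζ h1 h2 h3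
      exact h1 (injOn_segPrimitive hδ ha hc0 hc hz h2 hsm h3)
    exact hne.frequently.filter_mono nhdsWithin_le_nhds

end

end

section


variable {d : ℕ}

/-! ### Holomorphic extension of the transport -/

namespace MarginalExtension

variable {M L C : ℝ} {δ : Fin d → ℝ} {f : (Fin d → ℝ) → ℝ} {a : ℕ → (Fin d → ℂ) → ℂ}

theorem le_norm (h : MarginalExtension M L C δ f a) (k : ℕ) {z : Fin d → ℂ}
    (hz : z ∈ complexNhd δ) : M / 2 ≤ ‖a k z‖ :=
  (h.le_re k z hz).trans (Complex.re_le_norm _)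

theorem ne_zero (h : MarginalExtension M L C δ f a) (hM : 0 < M) (k : ℕ) {z : Fin d → ℂ}
    (hz : z ∈ complexNhd δ) : a k z ≠ 0 :=
  norm_pos_iff.1 (lt_of_lt_of_le (by linarith) (h.le_norm k hz))

theorem segPrimitive_toComplex (h : MarginalExtension M L C δ f a) (hM : 0 < M)
    (hδ : ∀ j, 0 < δ j) (k : Fin d) {x : Fin d → ℝ} (hx : x ∈ cube d) {s : ℝ}
    (hs : s ∈ Icc (-1 : ℝ) 1) :
    segPrimitive k (a (k + 1)) (Function.update (toComplex x) k s) =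
      condCDF f k x s * a k (toComplex x) := by
  rw [segPrimitive_ofReal hδ (h.contDiffOn _) (toComplex_mem_complexNhd hδ hx) hs,
    h.ofReal k x hx, condCDF_eq, ← Complex.ofReal_mul,
    div_mul_cancel₀ _ (h.marginal_pos hM hδ k hx).ne', ← intervalIntegral.integral_ofReal]
  refine intervalIntegral.integral_congr fun t ht => ?_
  rw [uIcc_of_le hs.1] at ht
  rw [← toComplex_update, h.ofReal _ _ (update_mem_cube hx ⟨ht.1, ht.2.trans hs.2⟩)]

/-- The factor `2` is the length of the interval of integration. Coordinate `k` is real and equal on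
both sides, so only earlier coordinates contribute. -/
theorem norm_segPrimitive_sub_toComplex_le (h : MarginalExtension M L C δ f a)
    (hC : 0 ≤ C) (hδ : ∀ j, 0 < δ j) (k : Fin d) {z : Fin d → ℂ} (hz : z ∈ complexNhd δ)
    {x : Fin d → ℝ} (hx : x ∈ cube d) (hzx : ∀ j, ‖z j - x j‖ < δ j) {s : ℝ}
    (hs : s ∈ Icc (-1 : ℝ) 1) :
    ‖segPrimitive k (a (k + 1)) (Function.update z k s) -
      segPrimitive k (a (k + 1)) (Function.update (toComplex x) k s)‖ ≤ 2 * (C * δ k) := by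
  have hx' := toComplex_mem_complexNhd hδ hx
  have hint : ∀ w ∈ complexNhd δ, IntervalIntegrable
      (fun t : ℝ => a (k + 1) (Function.update w k (t : ℂ))) volume (-1) s := by
    intro w hw
    refine ContinuousOn.intervalIntegrable ((h.contDiffOn _).continuousOn.comp
      (continuous_const.update k Complex.continuous_ofReal :
        Continuous fun t : ℝ => Function.update w k (t : ℂ)).continuousOn fun t ht => ?_)
    rw [uIcc_of_le hs.1] at ht
    exact update_mem_complexNhd hw (ofReal_mem_intervalNhd (hδ k) ⟨ht.1, ht.2.trans hs.2⟩)
  rw [segPrimitive_ofReal hδ (h.contDiffOn _) hz hs, segPrimitive_ofReal hδ (h.contDiffOn _) hx' hs,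
    ← intervalIntegral.integral_sub (hint z hz) (hint _ hx')]
  refine (intervalIntegral.norm_integral_le_of_norm_le_const (C := C * δ k) fun t ht => ?_).trans ?_
  · rw [uIoc_of_le hs.1] at ht
    exact h.near_succ k z hz x hx hzx t ⟨ht.1.le, ht.2.trans hs.2⟩
  · have h0 : 0 ≤ C * δ k := mul_nonneg hC (hδ k).le
    rw [abs_of_nonneg (by linarith [hs.1]), mul_comm]
    exact mul_le_mul_of_nonneg_right (by linarith [hs.2]) h0

end MarginalExtension

section

variable {M L C₆ C₇ : ℝ} {δ : Fin d → ℝ} {fρ fπ : (Fin d → ℝ) → ℝ} {a b : ℕ → (Fin d → ℂ) → ℂ}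

/-- The equation for the component `k` of the transport is solvable near the interval. -/
theorem exists_near_target (ha : MarginalExtension M L C₆ δ fρ a)
    (hb : MarginalExtension M L C₆ δ fπ b) (hM : 0 < M) (hML : M < L) (hδ : ∀ j, 0 < δ j)
    (hC₆ : 0 < C₆) (hC₇ : 0 < C₇) (hC₇1 : C₇ ≤ 1)
    (hsmall : 2 * L * (L * C₇ + 4 * C₆) / M + 4 * C₆ < M / 8) (k : Fin d) {z w : Fin d → ℂ}
    (hz : z ∈ complexNhd fun j => C₇ * δ j) (hw : w ∈ complexNhd δ) :
    ∃ s ∈ Icc (-1 : ℝ) 1, ‖b k w * segPrimitive k (a (k + 1)) z / a k z -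
      segPrimitive k (b (k + 1)) (Function.update w k s)‖ < M / 2 * (δ k / 2) / 2 := by
  have hL0 : 0 < L := hM.trans hML
  have hδle : ∀ j, C₇ * δ j ≤ δ j := fun j => by nlinarith [hδ j]
  have hzδ : z ∈ complexNhd δ := complexNhd_mono hδle hz
  obtain ⟨x, hx, hzx⟩ := exists_cube_near hz
  obtain ⟨y, hy, hwy⟩ := exists_cube_near hw
  have hzx' : ∀ j, ‖z j - x j‖ < δ j := fun j => (hzx j).trans_le (hδle j)
  have hCρ := ha.hasCondCDF hM hδ
  have hCπ := hb.hasCondCDF hM hδ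
  -- The comparison point: replace `z`, `w` by real neighbours `x`, `y` and take `s` with the same
  -- conditional probability as `x_k`. At real points the equation then holds exactly, both sides
  -- being `θ b_k(y)`.
  set θ := condCDF fρ k x (x k) with hθ
  have hθ02 : θ ∈ Icc (0 : ℝ) 2 := hCρ.mapsTo k hx (hx k)
  obtain ⟨s, hs, hsθ⟩ := hCπ.surjOn k hy hθ02
  refine ⟨s, hs, ?_⟩
  have hxk : (x k : ℂ) ∈ intervalNhd (δ k) := ofReal_mem_intervalNhd (hδ k) (hx k)
  have A1 : ‖segPrimitive k (a (k + 1)) z - segPrimitive k (a (k + 1)) (Function.update z k (x k))‖ ≤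
      L * (C₇ * δ k) := by
    have h := norm_segPrimitive_sub_le (k := k) hδ (ha.contDiffOn (k + 1)) (ha.norm_le (k + 1)) hzδ
      (hzδ k) hxk
    rw [Function.update_eq_self] at h
    exact h.trans (mul_le_mul_of_nonneg_left (hzx k).le hL0.le)
  have A2 := ha.norm_segPrimitive_sub_toComplex_le hC₆.le hδ k hzδ hx hzx' (hx k)
  rw [ha.segPrimitive_toComplex hM hδ k hx (hx k), ← hθ] at A2
  have A3 := ha.near k z hzδ x hx hzx'
  have B2 := hb.norm_segPrimitive_sub_toComplex_le hC₆.le hδ k hw hy hwy hs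
  rw [hb.segPrimitive_toComplex hM hδ k hy hs, hsθ] at B2
  have B3 := hb.near k w hw y hy hwy
  have hθn : ‖(θ : ℂ)‖ ≤ 2 := by
    rw [Complex.norm_real, Real.norm_of_nonneg hθ02.1]; exact hθ02.2
  have haz := ha.ne_zero hM k hzδ
  set D := δ k with hD
  have hD0 : 0 < D := hδ k
  set Pz := segPrimitive k (a (k + 1)) z
  set Pzx := segPrimitive k (a (k + 1)) (Function.update z k (x k))
  set Pw := segPrimitive k (b (k + 1)) (Function.update w k s)
  -- `C₇` enters only through moving `z_k` to `x_k`, where the primitive has slope at most `L`. The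
  -- term `4 C₆` collects the perturbation of the earlier variables in the primitive and in `a_k`,
  -- twice each.
  have E1 : ‖Pz - θ * a k z‖ ≤ (L * C₇ + 4 * C₆) * D := by
    have e : Pz - θ * a k z = (Pz - Pzx) + (Pzx - θ * a k (toComplex x)) -
        θ * (a k z - a k (toComplex x)) := by ring
    rw [e]
    refine (norm_sub_le _ _).trans ?_
    have h1 := norm_add_le (Pz - Pzx) (Pzx - θ * a k (toComplex x))
    have h2 : ‖(θ : ℂ) * (a k z - a k (toComplex x))‖ ≤ 2 * (C₆ * D) := by
      rw [norm_mul]; exact mul_le_mul hθn A3 (norm_nonneg _) (by norm_num)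
    linarith
  have E2 : ‖b k w * ((Pz - θ * a k z) / a k z)‖ ≤ L * ((L * C₇ + 4 * C₆) * D / (M / 2)) := by
    rw [norm_mul, norm_div]
    refine mul_le_mul (hb.norm_le k w hw) ?_ (by positivity) hL0.le
    exact div_le_div₀ (by positivity) E1 (by positivity) (ha.le_norm k hzδ)
  have E3 : ‖(θ : ℂ) * (b k w - b k (toComplex y))‖ ≤ 2 * (C₆ * D) := by
    rw [norm_mul]; exact mul_le_mul hθn B3 (norm_nonneg _) (by norm_num)
  have e : b k w * Pz / a k z - Pw = b k w * ((Pz - θ * a k z) / a k z) +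
      θ * (b k w - b k (toComplex y)) - (Pw - θ * b k (toComplex y)) := by
    field_simp; ring
  rw [e]
  have h1 := norm_sub_le (b k w * ((Pz - θ * a k z) / a k z) + θ * (b k w - b k (toComplex y)))
    (Pw - θ * b k (toComplex y))
  have h2 := norm_add_le (b k w * ((Pz - θ * a k z) / a k z)) (θ * (b k w - b k (toComplex y)))
  have h3 : L * ((L * C₇ + 4 * C₆) * D / (M / 2)) + 4 * C₆ * D =
      (2 * L * (L * C₇ + 4 * C₆) / M + 4 * C₆) * D := by
    field_simp
  have h4 := mul_lt_mul_of_pos_right hsmall hD0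
  linarith

/-- A holomorphic extension of the first `n` components of the transport. -/
structure PartialExtension (C₇ : ℝ) (δ : Fin d → ℝ) (fρ fπ : (Fin d → ℝ) → ℝ)
    (a b : ℕ → (Fin d → ℂ) → ℂ) (n : ℕ) (W : (Fin d → ℂ) → (Fin d → ℂ)) : Prop where
  contDiffOn : ContDiffOn ℂ 1 W (complexNhd fun j => C₇ * δ j)
  mapsTo : MapsTo W (complexNhd fun j => C₇ * δ j) (complexNhd δ)
  triangular : ∀ z ∈ complexNhd (fun j => C₇ * δ j), ∀ z' ∈ complexNhd (fun j => C₇ * δ j),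
    ∀ j, (∀ i ≤ j, z i = z' i) → W z j = W z' j
  apply_toComplex : ∀ x ∈ cube d, W (toComplex x) = toComplex (transportAux fρ fπ x n)
  equation : ∀ k : Fin d, (k : ℕ) < n → ∀ z ∈ complexNhd (fun j => C₇ * δ j),
    segPrimitive k (b (k + 1)) (W z) = b k (W z) * segPrimitive k (a (k + 1)) z / a k z

theorem isInvertible_smulRight {c : ℂ} (hc : c ≠ 0) {A : ℂ →L[ℂ] ℂ} (hA : A 1 = c) :
    A.IsInvertible := by
  refine ⟨ContinuousLinearEquiv.unitsEquivAut ℂ (Units.mk0 c hc), ?_⟩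
  ext
  simp [hA]

/-- Solutions of a holomorphic equation with unique solutions depend holomorphically on the
parameters. -/
theorem contDiffAt_of_unique_solution {E : Type*} [NormedAddCommGroup E] [NormedSpace ℂ E]
    [CompleteSpace E] {Ψ : E × ℂ → ℂ} {D : Set E} {V : Set ℂ} (hD : IsOpen D) (hV : IsOpen V)
    {s : E → ℂ} (hsV : ∀ z ∈ D, s z ∈ V)
    (hs : ∀ z ∈ D, ∀ ζ ∈ V, Ψ (z, ζ) = 0 ↔ ζ = s z)
    {z : E} (hz : z ∈ D) (hΨ : ContDiffAt ℂ 1 Ψ (z, s z)) {c : ℂ} (hc : c ≠ 0)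
    (hder : HasDerivAt (fun ζ => Ψ (z, ζ)) c (s z)) : ContDiffAt ℂ 1 s z := by
  have hfd : HasFDerivAt Ψ (fderiv ℂ Ψ (z, s z)) (z, s z) :=
    (hΨ.differentiableAt one_ne_zero).hasFDerivAt
  have hA : (fderiv ℂ Ψ (z, s z) ∘L .inr ℂ E ℂ) 1 = c := by
    have h1 : HasDerivAt (fun ζ : ℂ => (z, ζ)) ((0 : E), (1 : ℂ)) (s z) :=
      (hasDerivAt_const _ _).prodMk (hasDerivAt_id _)
    have h2 : HasDerivAt (fun ζ => Ψ (z, ζ)) (fderiv ℂ Ψ (z, s z) ((0 : E), (1 : ℂ))) (s z) :=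
      hfd.comp_hasDerivAt (s z) h1
    simpa using h2.unique hder
  have hinv := isInvertible_smulRight hc hA
  have hφ := hΨ.contDiffAt_implicitFunction one_ne_zero hinv
  have hev := hΨ.eventually_apply_implicitFunction one_ne_zero hinv
  have hself := hΨ.implicitFunction_apply_self one_ne_zero hinv
  simp only at hφ hev hself
  refine hφ.congr_of_eventuallyEq ?_
  have hcont := hφ.continuousAt
  have hmem : ∀ᶠ w in 𝓝 z, hΨ.implicitFunction one_ne_zero hinv w ∈ V := by
    refine hcont.eventually_mem (hV.mem_nhds ?_)
    rw [hself]
    exact hsV z hz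
  filter_upwards [hev, hmem, hD.mem_nhds hz] with w h1 h2 h3
  refine ((hs w h3 _ h2).1 ?_).symm
  rw [h1]
  exact (hs z hz _ (hsV z hz)).2 rfl

theorem contDiff_update_pair (k : Fin d) :
    ContDiff ℂ 1 fun q : (Fin d → ℂ) × ℂ => Function.update q.1 k q.2 := by
  refine contDiff_pi.2 fun j => ?_
  rcases eq_or_ne j k with rfl | hjk
  · simpa using contDiff_snd
  · simp only [Function.update_of_ne hjk]
    exact (contDiff_apply ℂ ℂ j).comp contDiff_fst

/-- The new component is the solution of the scalar equation for the already constructed earlier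
ones. Uniqueness of the solution does the rest: it gives holomorphic dependence, triangularity, and
agreement with the real transport on the cube. -/
theorem PartialExtension.exists_succ (ha : MarginalExtension M L C₆ δ fρ a)
    (hb : MarginalExtension M L C₆ δ fπ b) (hM : 0 < M) (hML : M < L) (hδ : ∀ j, 0 < δ j)
    (hC₆ : 0 < C₆) (hC₇ : 0 < C₇) (hC₇1 : C₇ ≤ 1)
    (hsmall : 2 * L * (L * C₇ + 4 * C₆) / M + 4 * C₆ < M / 8) {n : ℕ}
    {W : (Fin d → ℂ) → (Fin d → ℂ)} (h : PartialExtension C₇ δ fρ fπ a b n W) :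
    ∃ W', PartialExtension C₇ δ fρ fπ a b (n + 1) W' := by
  by_cases hn : n < d
  swap
  · refine ⟨W, h.contDiffOn, h.mapsTo, h.triangular, fun x hx => ?_, fun k _ => h.equation k ?_⟩
    · rw [h.apply_toComplex x hx, transportAux, dif_neg hn]
    · exact k.isLt.trans_le (not_lt.1 hn)
  set k : Fin d := ⟨n, hn⟩ with hk
  set D := complexNhd fun j => C₇ * δ j with hDdef
  have hD : IsOpen D := isOpen_complexNhd _
  have hDδ : D ⊆ complexNhd δ := complexNhd_mono fun j => by nlinarith [hδ j]
  have hC₇δ : ∀ j, 0 < C₇ * δ j := fun j => mul_pos hC₇ (hδ j)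
  have hM2 : 0 < M / 2 := by linarith
  set v : (Fin d → ℂ) → ℂ := fun z => b k (W z) * segPrimitive k (a (k + 1)) z / a k z with hv
  have hex : ∀ z ∈ D, ∃ ζ ∈ intervalNhd (δ k),
      segPrimitive k (b (k + 1)) (Function.update (W z) k ζ) = v z := by
    intro z hz
    obtain ⟨s, hs, hsv⟩ := exists_near_target ha hb hM hML hδ hC₆ hC₇ hC₇1 hsmall k hz (h.mapsTo hz)
    exact exists_segPrimitive_eq hδ (hb.contDiffOn _) hM2 (hb.le_re _) (h.mapsTo hz) hs hsv
  have hinj : ∀ z ∈ D, InjOn (fun ζ => segPrimitive k (b (k + 1)) (Function.update (W z) k ζ))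
      (intervalNhd (δ k)) := fun z hz =>
    injOn_segPrimitive hδ (hb.contDiffOn _) hM2 (hb.le_re _) (h.mapsTo hz)
  choose! s hsV hsv using hex
  have hcongr_b : ∀ {z w : Fin d → ℂ}, (∀ j < k, z j = w j) → b k z = b k w := fun hzw =>
    hb.congr k _ _ fun j hj => hzw j hj
  have hvd : ContDiffOn ℂ 1 v D := by
    refine ContDiffOn.div (ContDiffOn.mul ((hb.contDiffOn k).comp h.contDiffOn h.mapsTo)
      ((contDiffOn_segPrimitive hδ (ha.contDiffOn _) k).mono hDδ)) ((ha.contDiffOn k).mono hDδ)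
      fun z hz => ha.ne_zero hM k (hDδ hz)
  have hsd : ContDiffOn ℂ 1 s D := by
    intro z hz
    refine ContDiffAt.contDiffWithinAt ?_
    refine contDiffAt_of_unique_solution
      (Ψ := fun q => segPrimitive k (b (k + 1)) (Function.update (W q.1) k q.2) - v q.1)
      (V := intervalNhd (δ k)) hD (isOpen_intervalNhd _) hsV ?_ hz ?_
      (c := b (k + 1) (Function.update (W z) k (s z))) ?_ ?_
    · intro z hz ζ hζ
      simp only [sub_eq_zero]
      constructor
      · intro h1
        exact hinj z hz hζ (hsV z hz) (h1.trans (hsv z hz).symm)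
      · rintro rfl
        exact hsv z hz
    · have hfst : ContDiffAt ℂ 1 (Prod.fst : (Fin d → ℂ) × ℂ → Fin d → ℂ) (z, s z) :=
        contDiffAt_fst
      have hW : ContDiffAt ℂ 1 W z := h.contDiffOn.contDiffAt (hD.mem_nhds hz)
      have h1 : ContDiffAt ℂ 1 (fun q : (Fin d → ℂ) × ℂ => (W q.1, q.2)) (z, s z) :=
        (ContDiffAt.comp (z, s z) hW hfst).prodMk contDiffAt_snd
      have h2 : ContDiffAt ℂ 1 (fun q : (Fin d → ℂ) × ℂ => Function.update (W q.1) k q.2)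
          (z, s z) := ContDiffAt.comp (z, s z) (contDiff_update_pair k).contDiffAt h1
      have h3 : ContDiffAt ℂ 1 (segPrimitive k (b (k + 1))) (Function.update (W z) k (s z)) :=
        (contDiffOn_segPrimitive hδ (hb.contDiffOn _) k).contDiffAt
          ((isOpen_complexNhd δ).mem_nhds (update_mem_complexNhd (h.mapsTo hz) (hsV z hz)))
      have h4 : ContDiffAt ℂ 1 v z := hvd.contDiffAt (hD.mem_nhds hz)
      exact (ContDiffAt.comp (z, s z) h3 h2).sub (ContDiffAt.comp (z, s z) h4 hfst)
    -- The derivative of the equation in the unknown is `b_{k+1}`, which does not vanish; this is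
    -- the nondegeneracy needed for the implicit function theorem.
    · exact hb.ne_zero hM _ (update_mem_complexNhd (h.mapsTo hz) (hsV z hz))
    · exact (hasDerivAt_segPrimitive (a := b (k + 1)) hδ (hb.contDiffOn (k + 1)) (h.mapsTo hz)
        (hsV z hz)).sub_const (v z)
  refine ⟨fun z => Function.update (W z) k (s z), ?_, ?_, ?_, ?_, ?_⟩
  · exact (contDiff_update_pair k).comp_contDiffOn (h.contDiffOn.prodMk hsd)
  · exact fun z hz => update_mem_complexNhd (h.mapsTo hz) (hsV z hz)
  · intro z hz z' hz' j hj
    rcases eq_or_ne j k with rfl | hjk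
    · simp only [Function.update_self]
      have hWW : ∀ i ≤ k, W z i = W z' i := fun i hi =>
        h.triangular z hz z' hz' i fun l hl => hj l (hl.trans hi)
      refine hinj z hz (hsV z hz) (hsV z' hz') ?_
      simp only
      rw [hsv z hz]
      have e1 : segPrimitive k (b (k + 1)) (Function.update (W z) k (s z')) = v z' := by
        rw [← hsv z' hz']
        refine segPrimitive_congr (hb.congr _) fun i hi => ?_
        rcases eq_or_ne i k with hik | hij
        · simp [hik]
        · rw [Function.update_of_ne hij, Function.update_of_ne hij, hWW i hi]
      rw [e1]
      simp only [hv]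
      rw [hcongr_b fun i hi => hWW i hi.le, segPrimitive_congr (ha.congr _) hj,
        ha.congr k z z' fun i hi => hj i (le_of_lt hi)]
    · simp only [Function.update_of_ne hjk]
      exact h.triangular z hz z' hz' j hj
  · intro x hx
    have hxD : toComplex x ∈ D := toComplex_mem_complexNhd hC₇δ hx
    have hCρ := ha.hasCondCDF hM hδ
    have hCπ := hb.hasCondCDF hM hδ
    rw [transportAux, dif_pos hn, toComplex_update, h.apply_toComplex x hx]
    set y := transportAux fρ fπ x n with hy
    have hyc : y ∈ cube d := by
      intro j
      have := (transport_mem_and_condCDF hCρ hCπ hx).1 j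
      by_cases hj : (j : ℕ) < n
      · rwa [transport, transportAux_of_lt x hj hn.le] at this
      · rw [hy, transportAux_of_le x (not_lt.1 hj)]
        exact hx j
    have hθ := hCρ.mapsTo k hx (hx k)
    have hmem := Function.invFunOn_mem (hCπ.surjOn k hyc hθ)
    have heq := Function.invFunOn_eq (hCπ.surjOn k hyc hθ)
    congr 1
    refine hinj _ hxD (hsV _ hxD) (ofReal_mem_intervalNhd (hδ k) hmem) ?_
    simp only
    rw [hsv _ hxD, h.apply_toComplex x hx]
    rw [hb.segPrimitive_toComplex hM hδ k hyc hmem, heq]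
    simp only [hv]
    rw [h.apply_toComplex x hx, ← hy]
    have e := ha.segPrimitive_toComplex hM hδ k hx (hx k)
    have e2 : Function.update (toComplex x) k (x k : ℂ) = toComplex x := Function.update_eq_self _ _
    rw [e2] at e
    rw [e]
    have := ha.ne_zero hM k (hDδ hxD)
    field_simp
  · intro l hl z hz
    rcases Nat.lt_succ_iff_lt_or_eq.1 hl with hl | hl
    · have hlk : l < k := hl
      have hne : ∀ j ≤ l, j ≠ k := fun j hj => (hj.trans_lt hlk).ne
      rw [segPrimitive_congr (hb.congr _) (z := Function.update (W z) k (s z)) (w := W z)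
        fun j hj => Function.update_of_ne (hne j hj) _ _,
        hb.congr l (Function.update (W z) k (s z)) (W z) fun j hj =>
          Function.update_of_ne (hne j (le_of_lt hj)) _ _]
      exact h.equation l hl z hz
    · obtain rfl : l = k := Fin.ext hl
      rw [hsv z hz, hcongr_b (z := Function.update (W z) k (s z)) (w := W z)
        fun j hj => Function.update_of_ne hj.ne _ _]

theorem exists_partialExtension (ha : MarginalExtension M L C₆ δ fρ a)
    (hb : MarginalExtension M L C₆ δ fπ b) (hM : 0 < M) (hML : M < L) (hδ : ∀ j, 0 < δ j)
    (hC₆ : 0 < C₆) (hC₇ : 0 < C₇) (hC₇1 : C₇ ≤ 1)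
    (hsmall : 2 * L * (L * C₇ + 4 * C₆) / M + 4 * C₆ < M / 8) (n : ℕ) :
    ∃ W, PartialExtension C₇ δ fρ fπ a b n W := by
  induction n with
  | zero =>
    refine ⟨id, contDiffOn_id, fun z hz => complexNhd_mono (fun j => ?_) hz,
      fun z _ z' _ j hj => hj j le_rfl, fun x _ => rfl, fun k hk => absurd hk (Nat.not_lt_zero _)⟩
    nlinarith [hδ j]
  | succ n ih =>
    obtain ⟨W, hW⟩ := ih
    exact hW.exists_succ ha hb hM hML hδ hC₆ hC₇ hC₇1 hsmall

end

end

/-! ### The square root of the partial derivative `∂_k T_k` -/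

section


variable {d : ℕ}

/-- A holomorphic square root on the right half-plane. -/
def csqrt (z : ℂ) : ℂ := Complex.exp (Complex.log z / 2)

theorem csqrt_sq {z : ℂ} (hz : z ≠ 0) : csqrt z ^ 2 = z := by
  rw [csqrt, ← Complex.exp_nat_mul]
  push_cast
  rw [mul_div_cancel₀ _ two_ne_zero, Complex.exp_log hz]

theorem csqrt_ne_zero (z : ℂ) : csqrt z ≠ 0 := Complex.exp_ne_zero _

theorem csqrt_ofReal {x : ℝ} (hx : 0 < x) : csqrt x = (Real.exp (Real.log x / 2) : ℝ) := by
  rw [csqrt, ← Complex.ofReal_log hx.le]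
  push_cast
  rfl

theorem contDiffOn_csqrt {E : Type*} [NormedAddCommGroup E] [NormedSpace ℂ E] {g : E → ℂ}
    {s : Set E} (hg : ContDiffOn ℂ 1 g s) (h : ∀ z ∈ s, 0 < (g z).re) :
    ContDiffOn ℂ 1 (fun z => csqrt (g z)) s := by
  unfold csqrt
  refine ContDiffOn.cexp (ContDiffOn.div_const (fun z hz => ?_) 2)
  exact (Complex.contDiffAt_log (Or.inl (h z hz))).comp_contDiffWithinAt z (hg z hz)

/-- A holomorphic extension `R` of the square root of the derivative of the component `k` of `T`
in the direction `k`. -/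
structure RootExtension (η : Fin d → ℝ) (T : (Fin d → ℝ) → (Fin d → ℝ)) (k : Fin d)
    (R : (Fin d → ℂ) → ℂ) : Prop where
  contDiffOn : ContDiffOn ℂ 1 R (complexNhd η)
  bounded : ∃ B, ∀ z ∈ complexNhd η, ‖R z‖ ≤ B
  triangular : ∀ z ∈ complexNhd η, ∀ z' ∈ complexNhd η, (∀ i ≤ k, z i = z' i) → R z = R z'
  pos : ∀ x ∈ cube d, ∃ y : ℝ, 0 < y ∧ R (toComplex x) = y
  formula : ∀ x ∈ cube d, (T x k : ℂ) = -1 + segPrimitive k (fun z => R z ^ 2) (toComplex x)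
  apply_one : ∀ x ∈ cube d, T (Function.update x k 1) k = 1

/-- Only values on the cube matter, so the extension transfers to `S`, which is identified with a
transport only there. -/
theorem RootExtension.congr {η : Fin d → ℝ} {T T' : (Fin d → ℝ) → (Fin d → ℝ)} {k : Fin d}
    {R : (Fin d → ℂ) → ℂ} (h : RootExtension η T k R) (hT : ∀ x ∈ cube d, T' x = T x) :
    RootExtension η T' k R :=
  ⟨h.contDiffOn, h.bounded, h.triangular, h.pos, fun x hx => by rw [hT x hx, h.formula x hx],
    fun x hx => by rw [hT _ (update_mem_cube hx (by norm_num)), h.apply_one x hx]⟩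

section

variable {fρ fπ : (Fin d → ℝ) → ℝ}

theorem transport_update_of_endpoint (hρ : HasCondCDF fρ) (hπ : HasCondCDF fπ) {x : Fin d → ℝ}
    (hx : x ∈ cube d) (k : Fin d) {s : ℝ} (hs : s = -1 ∨ s = 1) :
    transport fρ fπ (Function.update x k s) k = s := by
  have hsI : s ∈ Icc (-1 : ℝ) 1 := by rcases hs with rfl | rfl <;> norm_num
  have hX := update_mem_cube (k := k) hx hsI
  obtain ⟨h1, h2⟩ := transport_mem_and_condCDF hρ hπ hX
  refine (hπ.strictMonoOn k _ h1).injOn (h1 k) hsI ?_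
  rw [h2 k, Function.update_self]
  rcases hs with rfl | rfl
  · rw [condCDF_neg_one, condCDF_neg_one]
  · rw [hρ.apply_one k _ hX, hπ.apply_one k _ h1]

end

section

variable {M L C₆ C₇ : ℝ} {δ : Fin d → ℝ} {fρ fπ : (Fin d → ℝ) → ℝ} {a b : ℕ → (Fin d → ℂ) → ℂ}

/-- When only `z_k` varies, the components of `W` below `k` and the factors `a_k`, `b_k` stay
constant. The defining equation then has one unknown function of one variable, and differentiating
it gives the quotient. -/
theorem hasDerivAt_extension (ha : MarginalExtension M L C₆ δ fρ a)
    (hb : MarginalExtension M L C₆ δ fπ b) (hM : 0 < M) (hδ : ∀ j, 0 < δ j) (hC₇1 : C₇ ≤ 1)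
    {W : (Fin d → ℂ) → (Fin d → ℂ)} (h : PartialExtension C₇ δ fρ fπ a b d W) (k : Fin d)
    {z : Fin d → ℂ} (hz : z ∈ complexNhd fun j => C₇ * δ j) {ζ : ℂ}
    (hζ : ζ ∈ intervalNhd (C₇ * δ k)) :
    HasDerivAt (fun ζ => W (Function.update z k ζ) k)
      (a (k + 1) (Function.update z k ζ) * b k (W (Function.update z k ζ)) /
        (a k (Function.update z k ζ) * b (k + 1) (W (Function.update z k ζ)))) ζ := by
  set D := complexNhd fun j => C₇ * δ j with hD
  have hDo : IsOpen D := isOpen_complexNhd _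
  have hDδ : D ⊆ complexNhd δ := complexNhd_mono fun j => by nlinarith [hδ j]
  have hVδ : intervalNhd (C₇ * δ k) ⊆ intervalNhd (δ k) := intervalNhd_mono (by nlinarith [hδ k])
  have hup : ∀ ζ ∈ intervalNhd (C₇ * δ k), Function.update z k ζ ∈ D := fun ζ hζ =>
    update_mem_complexNhd hz hζ
  set z₀ := Function.update z k ζ with hz₀
  have hz₀D : z₀ ∈ D := hup ζ hζ
  set w := W z₀ with hw
  have hwδ : w ∈ complexNhd δ := h.mapsTo hz₀D
  set g : ℂ → ℂ := fun ζ => W (Function.update z k ζ) k with hg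
  have hgd : DifferentiableAt ℂ g ζ := by
    have h1 : DifferentiableAt ℂ W z₀ :=
      (h.contDiffOn.contDiffAt (hDo.mem_nhds hz₀D)).differentiableAt one_ne_zero
    have h2 : DifferentiableAt ℂ (fun ζ => W (Function.update z k ζ)) ζ :=
      DifferentiableAt.comp ζ h1 (hasDerivAt_update z k ζ).differentiableAt
    exact differentiableAt_pi.1 h2 k
  have hgw : g ζ = w k := rfl
  have heq : ∀ ζ' ∈ intervalNhd (C₇ * δ k),
      segPrimitive k (b (k + 1)) (Function.update w k (g ζ')) =
        b k w * segPrimitive k (a (k + 1)) (Function.update z k ζ') / a k z₀ := by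
    intro ζ' hζ'
    have hlt : ∀ j < k, W (Function.update z k ζ') j = w j := by
      intro j hj
      refine h.triangular _ (hup ζ' hζ') _ hz₀D j fun i hi => ?_
      have hik : i ≠ k := (hi.trans_lt hj).ne
      rw [hz₀, Function.update_of_ne hik, Function.update_of_ne hik]
    have e := h.equation k k.isLt _ (hup ζ' hζ')
    rw [hb.congr k (W (Function.update z k ζ')) w fun j hj => hlt j hj,
      ha.congr k (Function.update z k ζ') z₀ fun j hj => ?_] at e
    · rw [← e]
      refine segPrimitive_congr (hb.congr _) fun j hj => ?_
      rcases eq_or_ne j k with rfl | hjk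
      · simp [hg]
      · rw [Function.update_of_ne hjk, hlt j (lt_of_le_of_ne hj hjk)]
    · have hjk : j ≠ k := fun e => by rw [e] at hj; exact lt_irrefl _ hj
      rw [hz₀, Function.update_of_ne hjk, Function.update_of_ne hjk]
  have hwk : g ζ ∈ intervalNhd (δ k) := hwδ k
  have hl : HasDerivAt (fun ζ' => segPrimitive k (b (k + 1)) (Function.update w k (g ζ')))
      (b (k + 1) (Function.update w k (g ζ)) * deriv g ζ) ζ :=
    HasDerivAt.comp (h₂ := fun s => segPrimitive k (b (k + 1)) (Function.update w k s)) ζ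
      (hasDerivAt_segPrimitive hδ (hb.contDiffOn _) hwδ hwk) hgd.hasDerivAt
  have hr : HasDerivAt
      (fun ζ' => b k w * segPrimitive k (a (k + 1)) (Function.update z k ζ') / a k z₀)
      (b k w * a (k + 1) z₀ / a k z₀) ζ :=
    ((hasDerivAt_segPrimitive hδ (ha.contDiffOn _) (hDδ hz) (hVδ hζ)).const_mul _).div_const _
  have hu := hl.unique (hr.congr_of_eventuallyEq
    (Filter.mem_of_superset ((isOpen_intervalNhd _).mem_nhds hζ) heq))
  rw [hgw, Function.update_eq_self] at hu
  have h1 := hb.ne_zero hM (k + 1) hwδ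
  have h2 := ha.ne_zero hM k (hDδ hz₀D)
  have h3 : deriv g ζ = a (k + 1) z₀ * b k w / (a k z₀ * b (k + 1) w) := by
    field_simp at hu ⊢
    linear_combination hu
  rw [← h3]
  exact hgd.hasDerivAt

/-- The derivative formula displays `∂_k W_k` as a quotient of products of marginals, each bounded
above by `L` and with real part at least `M / 2`; hence the root is holomorphic, bounded by `L / (M
/ 2)`, and positive on the cube. -/
theorem exists_rootExtension (ha : MarginalExtension M L C₆ δ fρ a)
    (hb : MarginalExtension M L C₆ δ fπ b) (hM : 0 < M) (hML : M < L) (hδ : ∀ j, 0 < δ j)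
    (hC₆ : 0 < C₆) (hC₇ : 0 < C₇) (hC₇1 : C₇ ≤ 1)
    (hsmall : 2 * L * (L * C₇ + 4 * C₆) / M + 4 * C₆ < M / 8) (k : Fin d) :
    ∃ R, RootExtension (fun j => C₇ * δ j) (transport fρ fπ) k R := by
  obtain ⟨W, h⟩ := exists_partialExtension ha hb hM hML hδ hC₆ hC₇ hC₇1 hsmall d
  have hCρ := ha.hasCondCDF hM hδ
  have hCπ := hb.hasCondCDF hM hδ
  set D := complexNhd fun j => C₇ * δ j with hD
  have hDδ : D ⊆ complexNhd δ := complexNhd_mono fun j => by nlinarith [hδ j]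
  have hC₇δ : ∀ j, 0 < C₇ * δ j := fun j => mul_pos hC₇ (hδ j)
  have hM2 : 0 < M / 2 := by linarith
  have hpa : ∀ l, ∀ z ∈ D, 0 < (a l z).re := fun l z hz => hM2.trans_le (ha.le_re l z (hDδ hz))
  have hpb : ∀ l, ∀ z ∈ D, 0 < (b l (W z)).re := fun l z hz =>
    hM2.trans_le (hb.le_re l _ (h.mapsTo hz))
  -- The roots are taken factor by factor: each factor lies in the right half-plane, whereas the
  -- quotient itself need not avoid the cut of the logarithm.
  set R : (Fin d → ℂ) → ℂ := fun z => csqrt (a (k + 1) z) * csqrt (b k (W z)) /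
    (csqrt (a k z) * csqrt (b (k + 1) (W z))) with hR
  have hRsq : ∀ z ∈ D, R z ^ 2 = a (k + 1) z * b k (W z) / (a k z * b (k + 1) (W z)) := by
    intro z hz
    simp only [hR]
    rw [div_pow, mul_pow, mul_pow, csqrt_sq (ha.ne_zero hM _ (hDδ hz)),
      csqrt_sq (ha.ne_zero hM _ (hDδ hz)), csqrt_sq (hb.ne_zero hM _ (h.mapsTo hz)),
      csqrt_sq (hb.ne_zero hM _ (h.mapsTo hz))]
  have hRd : ContDiffOn ℂ 1 R D := by
    have hca : ∀ l, ContDiffOn ℂ 1 (fun z => csqrt (a l z)) D := fun l =>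
      contDiffOn_csqrt ((ha.contDiffOn l).mono hDδ) (hpa l)
    have hcb : ∀ l, ContDiffOn ℂ 1 (fun z => csqrt (b l (W z))) D := fun l =>
      contDiffOn_csqrt ((hb.contDiffOn l).comp h.contDiffOn h.mapsTo) (hpb l)
    exact ((hca _).mul (hcb _)).div ((hca _).mul (hcb _)) fun z _ =>
      mul_ne_zero (csqrt_ne_zero _) (csqrt_ne_zero _)
  refine ⟨R, hRd, ⟨L / (M / 2), fun z hz => ?_⟩, fun z hz z' hz' hzz => ?_, fun x hx => ?_,
    fun x hx => ?_, fun x hx => transport_update_of_endpoint hCρ hCπ hx k (Or.inr rfl)⟩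
  · have hL0 : 0 < L := hM.trans hML
    refine le_of_sq_le_sq ?_ (by positivity)
    rw [← norm_pow, hRsq z hz, norm_div, norm_mul, norm_mul, div_pow, sq, sq]
    exact div_le_div₀ (by positivity)
      (mul_le_mul (ha.norm_le _ _ (hDδ hz)) (hb.norm_le _ _ (h.mapsTo hz)) (norm_nonneg _) hL0.le)
      (by positivity)
      (mul_le_mul (ha.le_norm _ (hDδ hz)) (hb.le_norm _ (h.mapsTo hz)) hM2.le (norm_nonneg _))
  · have hWW : ∀ j ≤ k, W z j = W z' j := fun j hj =>
      h.triangular z hz z' hz' j fun i hi => hzz i (hi.trans hj)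
    simp only [hR]
    rw [ha.congr (k + 1) z z' fun j hj => hzz j (Nat.lt_succ_iff.1 hj),
      ha.congr k z z' fun j hj => hzz j (le_of_lt hj),
      hb.congr (k + 1) (W z) (W z') fun j hj => hWW j (Nat.lt_succ_iff.1 hj),
      hb.congr k (W z) (W z') fun j hj => hWW j (le_of_lt hj)]
  · have hT := (transport_mem_and_condCDF hCρ hCπ hx).1
    have hWx : W (toComplex x) = toComplex (transport fρ fπ x) := h.apply_toComplex x hx
    simp only [hR]
    rw [hWx, ha.ofReal _ x hx, ha.ofReal _ x hx, hb.ofReal _ _ hT, hb.ofReal _ _ hT,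
      csqrt_ofReal (ha.marginal_pos hM hδ _ hx), csqrt_ofReal (ha.marginal_pos hM hδ _ hx),
      csqrt_ofReal (hb.marginal_pos hM hδ _ hT), csqrt_ofReal (hb.marginal_pos hM hδ _ hT),
      ← Complex.ofReal_mul, ← Complex.ofReal_mul, ← Complex.ofReal_div]
    exact ⟨_, by positivity, rfl⟩
  · have hxD : toComplex x ∈ D := toComplex_mem_complexNhd hC₇δ hx
    have hR2 : ContDiffOn ℂ 1 (fun z => R z ^ 2) D := hRd.pow 2
    have e0 : Function.update (toComplex x) k (x k : ℂ) = toComplex x := Function.update_eq_self _ _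
    have e1 := segPrimitive_ofReal (k := k) hC₇δ hR2 hxD (hx k)
    rw [e0] at e1
    have hmem : ∀ t ∈ uIcc (-1 : ℝ) (x k), (t : ℂ) ∈ intervalNhd (C₇ * δ k) := by
      intro t ht
      rw [uIcc_of_le (hx k).1] at ht
      exact ofReal_mem_intervalNhd (hC₇δ k) ⟨ht.1, ht.2.trans (hx k).2⟩
    have hcont : ContinuousOn (fun t : ℝ => R (Function.update (toComplex x) k (t : ℂ)) ^ 2)
        (uIcc (-1 : ℝ) (x k)) :=
      hR2.continuousOn.comp (continuous_const.update k Complex.continuous_ofReal :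
        Continuous fun t : ℝ => Function.update (toComplex x) k (t : ℂ)).continuousOn
        fun t ht => update_mem_complexNhd hxD (hmem t ht)
    have h2 := intervalIntegral.integral_eq_sub_of_hasDerivAt
      (f := fun t : ℝ => W (Function.update (toComplex x) k (t : ℂ)) k)
      (f' := fun t : ℝ => R (Function.update (toComplex x) k (t : ℂ)) ^ 2)
      (fun t ht => by
        have := (hasDerivAt_extension ha hb hM hδ hC₇1 h k hxD (hmem t ht)).comp_ofReal
        rw [← hRsq _ (update_mem_complexNhd hxD (hmem t ht))] at this
        exact this) hcont.intervalIntegrable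
    rw [e1, h2, e0, ← toComplex_update, h.apply_toComplex x hx,
      h.apply_toComplex _ (update_mem_cube hx (by norm_num))]
    have e3 : transportAux fρ fπ (Function.update x k (-1)) d k = -1 :=
      transport_update_of_endpoint hCρ hCπ hx k (Or.inl rfl)
    simp only [toComplex, e3, transport]
    push_cast
    ring

end

end

section


/-! ### Rational maps -/

variable {d : ℕ}

theorem squareIntegral_congr {k : Fin d} (p : MvPolynomial (Fin ((k : ℕ) + 1)) ℝ)
    {x y : Fin d → ℝ} (h : ∀ j < k, x j = y j) (s : ℝ) :
    squareIntegral k p x s = squareIntegral k p y s := by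
  unfold squareIntegral
  congr 1
  ext t
  congr 4
  ext j
  simp only [initialSegment]
  rcases eq_or_ne (Fin.castLE k.isLt j) k with hj | hj
  · rw [hj, Function.update_self, Function.update_self]
  · rw [Function.update_of_ne hj, Function.update_of_ne hj]
    refine h _ (lt_of_le_of_ne ?_ hj)
    rw [Fin.le_def]
    exact Nat.lt_succ_iff.1 j.isLt

theorem continuous_squareIntegrand (k : Fin d) (p : MvPolynomial (Fin ((k : ℕ) + 1)) ℝ)
    (x : Fin d → ℝ) : Continuous fun t : ℝ =>
      (1 + MvPolynomial.eval (initialSegment k (Function.update x k t)) p) ^ 2 := by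
  have h1 : Continuous fun t : ℝ => initialSegment k (Function.update x k t) :=
    continuous_pi fun j =>
      (continuous_apply (Fin.castLE k.isLt j)).comp (continuous_const.update k continuous_id)
  exact (continuous_const.add ((MvPolynomial.continuous_eval p).comp h1)).pow 2

theorem strictMonoOn_squareIntegral {k : Fin d} {p : MvPolynomial (Fin ((k : ℕ) + 1)) ℝ}
    (hp : ∀ x ∈ cube d, 0 < 1 + MvPolynomial.eval (initialSegment k x) p) {x : Fin d → ℝ}
    (hx : x ∈ cube d) : StrictMonoOn (squareIntegral k p x) (Icc (-1) 1) := by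
  intro s hs t ht hst
  have hc := continuous_squareIntegrand k p x
  have h := intervalIntegral.intervalIntegral_pos_of_pos_on (hc.intervalIntegrable s t)
    (fun u hu => pow_pos (hp _ (update_mem_cube hx
      ⟨hs.1.trans hu.1.le, hu.2.le.trans ht.2⟩)) 2) hst
  have h2 := intervalIntegral.integral_add_adjacent_intervals (μ := volume) (hc.intervalIntegrable (-1) s)
    (hc.intervalIntegrable s t)
  simp only [squareIntegral]
  linarith

/-- Positivity of `1 + p_k` makes the primitive strictly increasing, and the normalisation by `c_k`
fixes both endpoints. -/
theorem isMonotoneTriangularBijection_rationalMap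
    {p : (k : Fin d) → MvPolynomial (Fin ((k : ℕ) + 1)) ℝ}
    (hp : ∀ k, ∀ x ∈ cube d, 0 < 1 + MvPolynomial.eval (initialSegment k x) (p k)) :
    IsMonotoneTriangularBijection (rationalMap p) := by
  have hpos : ∀ k, ∀ x ∈ cube d, 0 < squareIntegral k (p k) x 1 := fun k x hx => by
    have h := strictMonoOn_squareIntegral (hp k) hx (a := -1) (b := 1) (by norm_num) (by norm_num)
      (by norm_num)
    simpa [squareIntegral] using h
  have hup : ∀ (k : Fin d) (x : Fin d → ℝ) (s : ℝ), rationalMap p (Function.update x k s) k =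
      -1 + 2 / squareIntegral k (p k) x 1 * squareIntegral k (p k) x s := by
    intro k x s
    have h : ∀ j < k, Function.update x k s j = x j := fun j hj => Function.update_of_ne hj.ne _ _
    simp only [rationalMap, Function.update_self]
    rw [squareIntegral_congr (p k) h, squareIntegral_congr (p k) h]
  refine isMonotoneTriangularBijection_of_endpoints (fun k x _ y _ hxy => ?_)
    (fun k x hx s hs t ht hst => ?_) (fun k x hx => ?_) (fun k x hx => ?_) (fun k x hx => ?_)
  · have h : ∀ j < k, x j = y j := fun j hj => hxy j hj.le
    simp only [rationalMap]
    rw [squareIntegral_congr (p k) h, squareIntegral_congr (p k) h, hxy k le_rfl]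
  · simp only [hup]
    have := strictMonoOn_squareIntegral (hp k) hx hs ht hst
    have := mul_lt_mul_of_pos_left this (div_pos two_pos (hpos k x hx))
    linarith
  · simp only [hup]
    have hc := (intervalIntegral.continuous_primitive (μ := volume)
      (fun a b => (continuous_squareIntegrand k (p k) x).intervalIntegrable a b) (-1))
    exact (continuous_const.add (continuous_const.mul hc)).continuousOn
  · rw [hup]
    simp [squareIntegral]
  · rw [hup, div_mul_cancel₀ _ (hpos k x hx).ne']
    norm_num

theorem contDiff_aeval {n : ℕ} (p : MvPolynomial (Fin n) ℝ) :
    ContDiff ℂ 1 fun z : Fin n → ℂ => MvPolynomial.aeval z p := by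
  induction p using MvPolynomial.induction_on with
  | C a => simpa using contDiff_const
  | add p q hp hq => simpa using hp.add hq
  | mul_X p j hp => simpa using hp.mul (contDiff_apply ℂ ℂ j)

/-- The extension of `1 + p` to complex arguments. -/
def shiftedEval (k : Fin d) (p : MvPolynomial (Fin ((k : ℕ) + 1)) ℝ) (z : Fin d → ℂ) : ℂ :=
  1 + MvPolynomial.aeval (fun j => z (Fin.castLE k.isLt j)) p

theorem contDiff_shiftedEval (k : Fin d) (p : MvPolynomial (Fin ((k : ℕ) + 1)) ℝ) :
    ContDiff ℂ 1 (shiftedEval k p) := by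
  have h : ContDiff ℂ 1 fun (z : Fin d → ℂ) (j : Fin ((k : ℕ) + 1)) => z (Fin.castLE k.isLt j) :=
    contDiff_pi.2 fun j => contDiff_apply ℂ ℂ _
  exact contDiff_const.add ((contDiff_aeval p).comp h)

theorem shiftedEval_toComplex (k : Fin d) (p : MvPolynomial (Fin ((k : ℕ) + 1)) ℝ)
    (x : Fin d → ℝ) : shiftedEval k p (toComplex x) =
      ((1 + MvPolynomial.eval (initialSegment k x) p : ℝ) : ℂ) := by
  have h := MvPolynomial.aeval_algebraMap_apply ℂ (initialSegment k x) p
  simp only [shiftedEval]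
  push_cast
  congr 1

theorem segPrimitive_shiftedEval {k : Fin d} (p : MvPolynomial (Fin ((k : ℕ) + 1)) ℝ)
    {x : Fin d → ℝ} (hx : x ∈ cube d) {s : ℝ} (hs : s ∈ Icc (-1 : ℝ) 1) :
    segPrimitive k (fun z => shiftedEval k p z ^ 2) (Function.update (toComplex x) k s) =
      (squareIntegral k p x s : ℂ) := by
  have h1 : ∀ _ : Fin d, (0 : ℝ) < 1 := fun _ => one_pos
  rw [segPrimitive_ofReal h1 ((contDiff_shiftedEval k p).pow 2).contDiffOn
    (toComplex_mem_complexNhd h1 hx) hs, squareIntegral, ← intervalIntegral.integral_ofReal]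
  congr 1
  ext t
  rw [← toComplex_update, shiftedEval_toComplex]
  push_cast
  rfl

/-- In the variable `k` the difference of the primitives has derivative `a - b` and vanishes at
`-1`. -/
theorem norm_segPrimitive_sub_segPrimitive_le {k : Fin d} {δ : Fin d → ℝ}
    {a b : (Fin d → ℂ) → ℂ} (hδ : ∀ j, 0 < δ j) (ha : ContDiffOn ℂ 1 a (complexNhd δ))
    (hb : ContDiffOn ℂ 1 b (complexNhd δ)) {κ : ℝ} (hab : ∀ z ∈ complexNhd δ, ‖a z - b z‖ ≤ κ)
    {z : Fin d → ℂ} (hz : z ∈ complexNhd δ) :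
    ‖segPrimitive k a z - segPrimitive k b z‖ ≤ κ * ‖z k + 1‖ := by
  have h1 : (-1 : ℂ) ∈ intervalNhd (δ k) := by
    have := ofReal_mem_intervalNhd (hδ k) (x := -1) (by norm_num)
    simpa using this
  have h := (convex_intervalNhd (δ k)).norm_image_sub_le_of_norm_hasDerivWithin_le
    (f := fun ζ => segPrimitive k a (Function.update z k ζ) -
      segPrimitive k b (Function.update z k ζ))
    (fun ζ hζ => ((hasDerivAt_segPrimitive hδ ha hz hζ).sub
      (hasDerivAt_segPrimitive hδ hb hz hζ)).hasDerivWithinAt)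
    (fun ζ hζ => hab _ (update_mem_complexNhd hz hζ)) h1 (hz k)
  simpa only [segPrimitive_neg_one, Function.update_eq_self, sub_zero, sub_neg_eq_add] using h

theorem norm_segPrimitive_le {k : Fin d} {δ : Fin d → ℝ}
    {a : (Fin d → ℂ) → ℂ} (hδ : ∀ j, 0 < δ j) (ha : ContDiffOn ℂ 1 a (complexNhd δ))
    {κ : ℝ} (hκ : ∀ z ∈ complexNhd δ, ‖a z‖ ≤ κ) {z : Fin d → ℂ} (hz : z ∈ complexNhd δ) :
    ‖segPrimitive k a z‖ ≤ κ * ‖z k + 1‖ := by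
  have h := norm_segPrimitive_sub_segPrimitive_le (k := k) (b := fun _ => 0) hδ ha contDiffOn_const
    (by simpa using hκ) hz
  simpa [segPrimitive] using h

theorem norm_div_sub_div_le {a b c e : ℂ} {A κ : ℝ} (ha : ‖a‖ ≤ A) (hc : 1 ≤ ‖c‖)
    (he : 1 / 2 ≤ ‖e‖) (hab : ‖a - b‖ ≤ κ) (hce : ‖c - e‖ ≤ κ) :
    ‖a / c - b / e‖ ≤ 2 * κ * (A + 1) := by
  have hA : 0 ≤ A := (norm_nonneg _).trans ha
  have hκ : 0 ≤ κ := (norm_nonneg _).trans hab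
  have hc0 : c ≠ 0 := norm_pos_iff.1 (by linarith)
  have he0 : e ≠ 0 := norm_pos_iff.1 (by linarith)
  have e1 : a / c - b / e = (a / c * (e - c) + (a - b)) / e := by
    field_simp
    ring
  have h1 : ‖a / c‖ ≤ A := by
    rw [norm_div]
    exact (div_le_self (norm_nonneg _) hc).trans ha
  have h2 : ‖a / c * (e - c) + (a - b)‖ ≤ κ * (A + 1) := by
    refine (norm_add_le _ _).trans ?_
    rw [norm_mul, norm_sub_rev e c]
    nlinarith [mul_le_mul h1 hce (norm_nonneg _) hA]
  rw [e1, norm_div, div_le_iff₀ (by linarith)]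
  nlinarith [mul_nonneg hκ (by linarith : 0 ≤ A + 1)]

theorem norm_add_one_le {r : ℝ} (hr : r ≤ 1) {ζ : ℂ} (hζ : ζ ∈ intervalNhd r) : ‖ζ + 1‖ ≤ 4 := by
  obtain ⟨y, hy, h⟩ := hζ
  have e : ζ + 1 = (ζ - y) + ((y + 1 : ℝ) : ℂ) := by push_cast; ring
  rw [e]
  refine (norm_add_le _ _).trans ?_
  rw [Complex.norm_real, Real.norm_of_nonneg (by linarith [hy.1])]
  linarith [hy.2]

end

section


/-! ### Approximation of triangular maps -/

section

variable {d : ℕ} {η : Fin d → ℝ} {T : (Fin d → ℝ) → (Fin d → ℝ)} {k : Fin d}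
  {R : (Fin d → ℂ) → ℂ}

/-- The extension by zero of a vector of length `k + 1`. -/
def zeroExtend (k : Fin d) (z : Fin ((k : ℕ) + 1) → ℂ) : Fin d → ℂ :=
  fun j => if h : (j : ℕ) < k + 1 then z ⟨j, h⟩ else 0

theorem contDiff_zeroExtend (k : Fin d) : ContDiff ℂ 1 (zeroExtend k) := by
  refine contDiff_pi.2 fun j => ?_
  simp only [zeroExtend]
  split_ifs with h
  · exact contDiff_apply ℂ ℂ _
  · exact contDiff_const

theorem zeroExtend_mem_complexNhd (hη : ∀ j, 0 < η j) {z : Fin ((k : ℕ) + 1) → ℂ}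
    (hz : z ∈ complexNhd (initialSegment k η)) : zeroExtend k z ∈ complexNhd η := by
  intro j
  simp only [zeroExtend]
  split_ifs with h
  · exact hz ⟨j, h⟩
  · exact ⟨0, by norm_num, by simpa using hη j⟩

theorem zeroExtend_toComplex (k : Fin d) (x : Fin ((k : ℕ) + 1) → ℝ) : zeroExtend k (toComplex x) =
    toComplex (fun j => if h : (j : ℕ) < k + 1 then x ⟨j, h⟩ else 0) := by
  ext j
  simp only [zeroExtend, toComplex]
  split_ifs <;> simp

/-- The approximated function is `R - 1`, so that `1 + p` is close to `R`. As `R` does not depend on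
the variables after `k`, they are set to `0` and the approximation takes place in `k + 1` variables.
-/
theorem RootExtension.exists_norm_sub_shiftedEval_le (h : RootExtension η T k R)
    (hη : ∀ j, 0 < η j) {τ : ℝ} (hτ0 : 0 < τ) (hτ1 : τ < 1) :
    ∃ r > (0 : ℝ), ∃ K : ℝ, 0 ≤ K ∧ ∀ ℓ : ℝ, 0 ≤ ℓ →
      ∃ p ∈ MvPolynomial.restrictSupport ℝ
          (weightedSimplex (initialSegment k fun j => 1 + η j) ℓ),
        ∀ z ∈ complexNhd (fun _ : Fin d => r),
          ‖R z - shiftedEval k p z‖ ≤ K * Real.exp (-(τ * ℓ)) := by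
  obtain ⟨B, hB⟩ := h.bounded
  obtain ⟨C, hC, r, hr, -, H⟩ := exists_polynomial_approx hτ0 hτ1 (k + 1)
    (initialSegment k fun j => 1 + η j) fun j => by simpa [initialSegment] using hη _
  obtain ⟨r', hr', hsub⟩ := exists_complexNhd_subset (isOpen_complexNhd η)
    fun x hx => toComplex_mem_complexNhd hη hx
  have e : (fun j => initialSegment k (fun j => 1 + η j) j - 1) = initialSegment k η := by
    ext j
    simp [initialSegment]
  rw [e] at H
  have hB0 : 0 ≤ B := (norm_nonneg _).trans
    (hB (toComplex 0) (toComplex_mem_complexNhd hη fun j => by simp))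
  refine ⟨min r r', lt_min hr hr', C * (B + 1), by positivity, fun ℓ hℓ => ?_⟩
  obtain ⟨p, hp, happ⟩ := H (fun z => R (zeroExtend k z) - 1) (B + 1)
    ((h.contDiffOn.comp (contDiff_zeroExtend k).contDiffOn
      fun z hz => zeroExtend_mem_complexNhd hη hz).sub contDiffOn_const)
    (fun z hz => (norm_sub_le _ _).trans (by
      rw [norm_one]
      linarith [hB _ (zeroExtend_mem_complexNhd hη hz)]))
    (fun x hx => by
      rw [zeroExtend_toComplex]
      obtain ⟨y, -, hy⟩ := h.pos (fun j => if h : (j : ℕ) < k + 1 then x ⟨j, h⟩ else 0) (fun j => by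
        dsimp only
        split_ifs with hj
        · exact hx _
        · norm_num)
      exact ⟨y - 1, by rw [hy]; push_cast; rfl⟩) ℓ hℓ
  refine ⟨p, hp, fun z hz => ?_⟩
  have hz1 : (fun j : Fin ((k : ℕ) + 1) => z (Fin.castLE k.isLt j)) ∈
      complexNhd fun _ : Fin ((k : ℕ) + 1) => r := fun j =>
    complexNhd_mono (fun _ => min_le_left r r') hz (Fin.castLE k.isLt j)
  have hz2 : z ∈ complexNhd η := hsub (complexNhd_mono (fun _ => min_le_right r r') hz)
  have e2 : R z = R (zeroExtend k fun j => z (Fin.castLE k.isLt j)) := by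
    refine h.triangular _ hz2 _ (zeroExtend_mem_complexNhd hη fun j => hz2 _) fun i hi => ?_
    have : (i : ℕ) < k + 1 := Nat.lt_succ_iff.2 hi
    simp [zeroExtend, this]
  have e3 := happ _ hz1
  rw [e2, shiftedEval, ← sub_sub]
  exact e3

theorem RootExtension.segPrimitive_one (h : RootExtension η T k R) {x : Fin d → ℝ}
    (hx : x ∈ cube d) :
    segPrimitive k (fun z => R z ^ 2) (Function.update (toComplex x) k 1) = 2 := by
  have h1 := h.formula _ (update_mem_cube (k := k) hx (s := 1) (by norm_num))
  rw [h.apply_one x hx, toComplex_update] at h1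
  push_cast at h1
  linear_combination -h1

theorem RootExtension.exists_pos_le_re (h : RootExtension η T k R) (hη : ∀ j, 0 < η j) :
    ∃ c > (0 : ℝ), ∀ x ∈ cube d, c ≤ (R (toComplex x)).re := by
  have hc : ContinuousOn (fun x => (R (toComplex x)).re) (cube d) :=
    Complex.continuous_re.comp_continuousOn (h.contDiffOn.continuousOn.comp
      continuous_toComplex.continuousOn fun x hx => toComplex_mem_complexNhd hη hx)
  obtain ⟨x₀, hx₀, hmin⟩ := (isCompact_cube d).exists_isMinOn ⟨0, fun j => by simp⟩ hc
  refine ⟨_, ?_, fun x hx => hmin hx⟩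
  obtain ⟨y, hy, e⟩ := h.pos x₀ hx₀
  simpa [e] using hy

/-- A polynomial close to the square root of the derivative yields a rational function close to the
component itself. -/
theorem RootExtension.exists_stability (h : RootExtension η T k R) (hη : ∀ j, 0 < η j) (m : ℕ)
    {r : ℝ} (hr : 0 < r) : ∃ C : ℝ, 0 ≤ C ∧ ∃ e₀ > (0 : ℝ),
      ∀ (e : ℝ) (p : MvPolynomial (Fin ((k : ℕ) + 1)) ℝ), e ≤ e₀ →
      (∀ z ∈ complexNhd (fun _ : Fin d => r), ‖R z - shiftedEval k p z‖ ≤ e) →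
      (∀ x ∈ cube d, 0 < 1 + MvPolynomial.eval (initialSegment k x) p) ∧
      sobolevNorm m (fun x => T x k -
        (-1 + 2 / squareIntegral k p x 1 * squareIntegral k p x (x k))) ≤
          ENNReal.ofReal (C * e) := by
  obtain ⟨B, hB⟩ := h.bounded
  have hB0 : 0 ≤ B := (norm_nonneg _).trans
    (hB (toComplex 0) (toComplex_mem_complexNhd hη fun j => by simp))
  obtain ⟨c, hc, hcR⟩ := h.exists_pos_le_re hη
  have hup : ContDiff ℂ 1 fun z : Fin d → ℂ => Function.update z k 1 :=
    (contDiff_update_pair k).comp (contDiff_id.prodMk contDiff_const)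
  have hone : ∀ {δ : ℝ}, 0 < δ → (1 : ℂ) ∈ intervalNhd δ := fun hδ => by
    simpa using ofReal_mem_intervalNhd hδ (x := 1) (by norm_num)
  set P : (Fin d → ℂ) → ℂ := segPrimitive k fun z => R z ^ 2 with hP
  have hR2 : ContDiffOn ℂ 1 (fun z => R z ^ 2) (complexNhd η) := h.contDiffOn.pow 2
  have hPd : ContDiffOn ℂ 1 P (complexNhd η) := contDiffOn_segPrimitive hη hR2 k
  have hP1d : ContDiffOn ℂ 1 (fun z => P (Function.update z k 1)) (complexNhd η) :=
    hPd.comp hup.contDiffOn fun z hz => update_mem_complexNhd hz (hone (hη k))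
  -- On the cube the normalising integral `P(…, 1)` equals `2`; by continuity it stays within
  -- distance `1` of `2`, hence at least `1` in modulus, on a complex neighbourhood.
  obtain ⟨r₁, hr₁, hsub⟩ := exists_complexNhd_subset
    (hP1d.continuousOn.isOpen_inter_preimage (isOpen_complexNhd η) (isOpen_ball (x := 2) (ε := 1)))
    fun x hx => ⟨toComplex_mem_complexNhd hη hx, by
      simp only [mem_preimage, hP, h.segPrimitive_one hx]
      exact mem_ball_self one_pos⟩
  set s := min r (min r₁ 1) with hs
  have hs0 : 0 < s := lt_min hr (lt_min hr₁ one_pos)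
  have hs1 : s ≤ 1 := (min_le_right _ _).trans (min_le_right _ _)
  set N := complexNhd fun _ : Fin d => s with hN
  have hNr : N ⊆ complexNhd fun _ : Fin d => r := complexNhd_mono fun _ => min_le_left _ _
  have hN1 := (complexNhd_mono fun _ : Fin d => (min_le_right r _).trans (min_le_left r₁ 1)).trans
    hsub
  have hNη : N ⊆ complexNhd η := fun z hz => (hN1 hz).1
  have hup1 : ∀ z ∈ N, Function.update z k 1 ∈ N := fun z hz =>
    update_mem_complexNhd hz (hone hs0)
  have hcN : ∀ z ∈ N, 1 ≤ ‖P (Function.update z k 1)‖ := fun z hz => by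
    have h1 : ‖P (Function.update z k 1) - 2‖ < 1 := by
      simpa [dist_eq_norm] using (hN1 hz).2
    have h2 := norm_sub_norm_le (2 : ℂ) (2 - P (Function.update z k 1))
    rw [norm_sub_rev 2, sub_sub_cancel] at h2
    norm_num at h2
    linarith
  obtain ⟨C, hC, H⟩ := exists_sobolevNorm_le (d := d) m hs0
  -- Lipschitz constant of the map from the root to the primitive: `2B + 1` bounds `‖R + (1 + p)‖`,
  -- and `4` bounds `‖z_k + 1‖`.
  set κ := 4 * (2 * B + 1) with hκ
  have hκ0 : 0 < κ := by positivity
  refine ⟨C * (2 * (2 * κ * (4 * B ^ 2 + 1))), by positivity,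
    -- The three thresholds keep the perturbed normalisation at least `1/2`, bound `1 + p` by `B +
    -- 1`, and keep `1 + p` positive on the cube.
    min (1 / (2 * κ)) (min 1 (c / 2)), by positivity, fun e p he hp => ?_⟩
  have he1 : κ * e ≤ 1 / 2 := by
    have := mul_le_mul_of_nonneg_left (he.trans (min_le_left _ _)) hκ0.le
    refine this.trans (le_of_eq ?_)
    field_simp
  have he2 : e ≤ 1 := he.trans ((min_le_right _ _).trans (min_le_left _ _))
  have he3 : e ≤ c / 2 := he.trans ((min_le_right _ _).trans (min_le_right _ _))
  have he0 : 0 ≤ e := (norm_nonneg _).trans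
    (hp (toComplex 0) (toComplex_mem_complexNhd (fun _ => hr) fun j => by simp))
  set Q : (Fin d → ℂ) → ℂ := segPrimitive k fun z => shiftedEval k p z ^ 2 with hQ
  have hQ2 : ContDiffOn ℂ 1 (fun z => shiftedEval k p z ^ 2) N :=
    ((contDiff_shiftedEval k p).pow 2).contDiffOn
  have hQd : ContDiffOn ℂ 1 Q N := contDiffOn_segPrimitive (fun _ => hs0) hQ2 k
  have hsq : ∀ z ∈ N, ‖R z ^ 2 - shiftedEval k p z ^ 2‖ ≤ (2 * B + 1) * e := by
    intro z hz
    have h1 := hp z (hNr hz)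
    have h2 := hB z (hNη hz)
    have h3 : ‖R z + shiftedEval k p z‖ ≤ 2 * B + 1 := by
      have e1 : R z + shiftedEval k p z = R z + R z - (R z - shiftedEval k p z) := by ring
      rw [e1]
      refine (norm_sub_le _ _).trans ?_
      linarith [norm_add_le (R z) (R z)]
    rw [sq_sub_sq, norm_mul]
    exact mul_le_mul h3 h1 (norm_nonneg _) (by positivity)
  have hPQ : ∀ z ∈ N, ‖P z - Q z‖ ≤ κ * e := fun z hz => by
    have h1 := norm_segPrimitive_sub_segPrimitive_le (k := k) (fun _ => hs0) (hR2.mono hNη) hQ2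
      hsq hz
    have h2 := norm_add_one_le hs1 (hz k)
    refine h1.trans ?_
    rw [hκ]
    nlinarith [mul_le_mul_of_nonneg_left h2 (by positivity : 0 ≤ (2 * B + 1) * e)]
  have hPB : ∀ z ∈ N, ‖P z‖ ≤ 4 * B ^ 2 := fun z hz => by
    have h1 := norm_segPrimitive_le (k := k) (κ := B ^ 2) (fun _ => hs0) (hR2.mono hNη)
      (fun w hw => by
        rw [norm_pow]
        exact pow_le_pow_left₀ (norm_nonneg _) (hB w (hNη hw)) 2) hz
    have h2 := norm_add_one_le hs1 (hz k)
    refine h1.trans ?_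
    nlinarith [sq_nonneg B]
  have hQN : ∀ z ∈ N, 1 / 2 ≤ ‖Q (Function.update z k 1)‖ := fun z hz => by
    have h1 := hcN z hz
    have h2 := hPQ _ (hup1 z hz)
    have h3 := norm_sub_norm_le (P (Function.update z k 1))
      (P (Function.update z k 1) - Q (Function.update z k 1))
    rw [sub_sub_cancel] at h3
    linarith
  refine ⟨fun x hx => ?_, ?_⟩
  · have h1 := hp _ (toComplex_mem_complexNhd (fun _ => hr) hx)
    rw [shiftedEval_toComplex] at h1
    have h2 := (Complex.abs_re_le_norm _).trans h1
    rw [Complex.sub_re, Complex.ofReal_re] at h2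
    linarith [hcR x hx, (abs_le.1 h2).2]
  · rw [mul_assoc]
    refine (H (fun z => 2 * (P z / P (Function.update z k 1) - Q z / Q (Function.update z k 1)))
      (2 * (2 * (κ * e) * (4 * B ^ 2 + 1))) _ ?_ ?_ ?_).trans
      (ENNReal.ofReal_le_ofReal (le_of_eq (by ring)))
    · exact contDiffOn_const.mul (((hPd.mono hNη).div (hP1d.mono hNη) fun z hz =>
        norm_pos_iff.1 (one_pos.trans_le (hcN z hz))).sub
        (hQd.div (hQd.comp hup.contDiffOn hup1) fun z hz =>
        norm_pos_iff.1 (one_half_pos.trans_le (hQN z hz))))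
    · intro z hz
      rw [norm_mul, Complex.norm_ofNat]
      exact mul_le_mul_of_nonneg_left (norm_div_sub_div_le (hPB z hz) (hcN z hz) (hQN z hz)
        (hPQ z hz) (hPQ _ (hup1 z hz))) two_pos.le
    · intro x hx
      have hx' := openCube_subset_cube d hx
      have e1 : P (toComplex x) = ((T x k + 1 : ℝ) : ℂ) := by
        push_cast
        rw [h.formula x hx']
        ring
      have e2 : Q (Function.update (toComplex x) k 1) = (squareIntegral k p x 1 : ℂ) := by
        simpa using segPrimitive_shiftedEval p hx' (s := 1) (by norm_num)
      have e3 : Q (toComplex x) = (squareIntegral k p x (x k) : ℂ) := by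
        rw [← segPrimitive_shiftedEval p hx' (hx' k)]
        exact congrArg Q (Function.update_eq_self k (toComplex x)).symm
      have e0 : P (Function.update (toComplex x) k 1) = 2 := h.segPrimitive_one hx'
      rw [e0, e1, e2, e3]
      have e4 : (2 : ℂ) * (((T x k + 1 : ℝ) : ℂ) / 2 -
          (squareIntegral k p x (x k) : ℂ) / (squareIntegral k p x 1 : ℂ)) =
          ((T x k - (-1 + 2 / squareIntegral k p x 1 * squareIntegral k p x (x k)) : ℝ) : ℂ) := by
        push_cast
        ring
      rw [e4, Complex.ofReal_re]

theorem RootExtension.exists_rational_approx (h : RootExtension η T k R)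
    (hη : ∀ j, 0 < η j) (m : ℕ) {τ : ℝ} (hτ0 : 0 < τ) (hτ1 : τ < 1) :
    ∃ C : ℝ, 0 ≤ C ∧ ∃ ℓ₀ : ℝ, 0 ≤ ℓ₀ ∧ ∀ ℓ : ℝ, ℓ₀ ≤ ℓ →
      ∃ p ∈ MvPolynomial.restrictSupport ℝ
          (weightedSimplex (initialSegment k fun j => 1 + η j) ℓ),
        (∀ x ∈ cube d, 0 < 1 + MvPolynomial.eval (initialSegment k x) p) ∧
        sobolevNorm m (fun x => T x k -
          (-1 + 2 / squareIntegral k p x 1 * squareIntegral k p x (x k))) ≤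
            ENNReal.ofReal (C * Real.exp (-(τ * ℓ))) := by
  obtain ⟨r, hr, K, hK, happ⟩ := h.exists_norm_sub_shiftedEval_le hη hτ0 hτ1
  obtain ⟨C, hC, e₀, he₀, hst⟩ := h.exists_stability hη m hr
  -- From this level on, `exp(τℓ) ≥ τℓ ≥ K / e₀`, so the polynomial error is below the stability
  -- threshold.
  refine ⟨C * K, by positivity, K / e₀ / τ, by positivity, fun ℓ hℓ => ?_⟩
  have hℓ0 : 0 ≤ ℓ := le_trans (by positivity) hℓ
  obtain ⟨p, hp, hpR⟩ := happ ℓ hℓ0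
  have hle : K * Real.exp (-(τ * ℓ)) ≤ e₀ := by
    rw [Real.exp_neg, ← div_eq_mul_inv, div_le_iff₀ (Real.exp_pos _)]
    rw [div_le_iff₀ hτ0, div_le_iff₀ he₀] at hℓ
    have h1 := mul_le_mul_of_nonneg_left (Real.add_one_le_exp (τ * ℓ)) he₀.le
    nlinarith
  obtain ⟨h1, h2⟩ := hst _ p hle hpR
  exact ⟨p, hp, h1, by rwa [mul_assoc]⟩

/-- With `p = 0` the rational component is the identity. This covers the values of `ε` too large for
the asymptotic approximation, where any finite bound suffices. -/
theorem RootExtension.exists_sobolevNorm_sub_zero_le (h : RootExtension η T k R)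
    (hη : ∀ j, 0 < η j) (m : ℕ) : ∃ C : ℝ, 0 ≤ C ∧
      sobolevNorm m (fun x => T x k - (-1 + 2 / squareIntegral k 0 x 1 *
        squareIntegral k 0 x (x k))) ≤ ENNReal.ofReal C := by
  obtain ⟨B, hB⟩ := h.bounded
  have hR2 : ContDiffOn ℂ 1 (fun z => R z ^ 2) (complexNhd η) := h.contDiffOn.pow 2
  obtain ⟨r, hr, hsub⟩ := exists_complexNhd_subset (isOpen_complexNhd η)
    fun x hx => toComplex_mem_complexNhd hη hx
  set s := min r 1 with hs
  have hs0 : 0 < s := lt_min hr one_pos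
  have hNη : complexNhd (fun _ : Fin d => s) ⊆ complexNhd η :=
    (complexNhd_mono fun _ => min_le_left _ _).trans hsub
  obtain ⟨C, hC, H⟩ := exists_sobolevNorm_le (d := d) m hs0
  refine ⟨C * (B ^ 2 * 4 + 4), by positivity, H (fun z => segPrimitive k (fun z => R z ^ 2) z -
    (z k + 1)) _ _ ?_ (fun z hz => ?_) fun x hx => ?_⟩
  · exact ((contDiffOn_segPrimitive hη hR2 k).mono hNη).sub
      ((contDiff_apply ℂ ℂ k).add contDiff_const).contDiffOn
  · have h1 := norm_segPrimitive_le (k := k) (κ := B ^ 2) (fun _ => hs0) (hR2.mono hNη)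
      (fun w hw => by
        rw [norm_pow]
        exact pow_le_pow_left₀ (norm_nonneg _) (hB w (hNη hw)) 2) hz
    have h2 := norm_add_one_le (min_le_right _ _) (hz k)
    refine (norm_sub_le _ _).trans (add_le_add (h1.trans ?_) h2)
    exact mul_le_mul_of_nonneg_left h2 (sq_nonneg B)
  · have e1 : segPrimitive k (fun z => R z ^ 2) (toComplex x) - (toComplex x k + 1) =
        ((T x k - x k : ℝ) : ℂ) := by
      push_cast
      rw [h.formula x (openCube_subset_cube d hx)]
      simp only [toComplex]
      ring
    rw [e1, Complex.ofReal_re]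
    simp only [squareIntegral, map_zero, add_zero, one_pow, intervalIntegral.integral_const,
      smul_eq_mul, mul_one]
    ring

end

/-! ### From levels `ℓ` to the parameter `ε` and the rate in `N_ε` -/

section

variable {d : ℕ}

theorem HasRationalApprox.mono {ξ : Fin d → ℝ} {m : ℕ} {τ C C' : ℝ}
    {T : (Fin d → ℝ) → (Fin d → ℝ)} (h : HasRationalApprox ξ m τ C T) (hC : C ≤ C') :
    HasRationalApprox ξ m τ C' T := by
  intro ε hε
  obtain ⟨p, h1, h2, h3⟩ := h ε hε
  exact ⟨p, h1, h2, fun k => (h3 k).trans (ENNReal.ofReal_le_ofReal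
    (mul_le_mul_of_nonneg_right hC (Real.exp_pos _).le))⟩

theorem exists_hasRationalApprox (hd : 1 ≤ d) {η : Fin d → ℝ} (hη : ∀ j, 0 < η j)
    {T : (Fin d → ℝ) → (Fin d → ℝ)} (hT : ∀ k, ∃ R, RootExtension η T k R) (m : ℕ) {τ : ℝ}
    (hτ0 : 0 < τ) (hτ1 : τ < 1) :
    ∃ C > (0 : ℝ), HasRationalApprox (fun j => 1 + η j) m τ C T := by
  choose R hR using hT
  choose A hA ℓ₀ hℓ₀ happ using fun k => (hR k).exists_rational_approx hη m hτ0 hτ1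
  choose A' hA' hzero using fun k => (hR k).exists_sobolevNorm_sub_zero_le hη m
  have hξ : ∀ j, 1 < 1 + η j := fun j => by linarith [hη j]
  have hlog : ∀ j, 0 < Real.log (1 + η j) := fun j => Real.log_pos (hξ j)
  obtain ⟨K, hK⟩ := exists_rate_mul_le hd hξ
  -- A sum of nonnegative terms serves as a common threshold: `log(1/ε) ≥ t` makes the level
  -- `log(1/ε) - log ξ_k` admissible for every `k`.
  set t := ∑ k, (ℓ₀ k + Real.log (1 + η k)) with ht
  -- The first summand absorbs the shift `log ξ_k` and the counting constant `K`; the second covers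
  -- `log(1/ε) ≤ t`, where the right-hand exponential is bounded below.
  set D : Fin d → ℝ := fun k => A k * Real.exp (τ * (Real.log (1 + η k) + K)) +
    A' k * Real.exp (τ * (t + K)) with hD
  have hA0 : ∀ k, 0 ≤ A k * Real.exp (τ * (Real.log (1 + η k) + K)) := fun k =>
    mul_nonneg (hA k) (Real.exp_pos _).le
  have hA0' : ∀ k, 0 ≤ A' k * Real.exp (τ * (t + K)) := fun k =>
    mul_nonneg (hA' k) (Real.exp_pos _).le
  have hD0 : ∀ k, 0 ≤ D k := fun k => add_nonneg (hA0 k) (hA0' k)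
  have hDle : ∀ k, D k ≤ 1 + ∑ k, D k := fun k => by
    linarith [Finset.single_le_sum (fun i _ => hD0 i) (Finset.mem_univ k)]
  refine ⟨1 + ∑ k, D k, by linarith [Finset.sum_nonneg fun k (_ : k ∈ Finset.univ) => hD0 k],
    fun ε hε => ?_⟩
  set X := rate (fun j => 1 + η j) * (totalCard (fun j => 1 + η j) ε : ℝ) ^ (1 / (d : ℝ)) with hX
  have hXle : X ≤ -Real.log ε + K := hK ε hε
  have hgoal : ∀ k (c : ℝ), c ≤ D k * Real.exp (-(τ * X)) →
      ENNReal.ofReal c ≤ ENNReal.ofReal ((1 + ∑ k, D k) * Real.exp (-(τ *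
        rate (fun j => 1 + η j) * (totalCard (fun j => 1 + η j) ε : ℝ) ^ (1 / (d : ℝ))))) := by
    intro k c hc
    refine ENNReal.ofReal_le_ofReal (hc.trans ?_)
    rw [mul_assoc τ]
    exact mul_le_mul_of_nonneg_right (hDle k) (Real.exp_pos _).le
  rcases le_total t (-Real.log ε) with hcase | hcase
  · have hlev : ∀ k, ℓ₀ k ≤ -Real.log ε - Real.log (1 + η k) := fun k => by
      have := Finset.single_le_sum (f := fun k => ℓ₀ k + Real.log (1 + η k))
        (fun i _ => add_nonneg (hℓ₀ i) (hlog i).le) (Finset.mem_univ k)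
      linarith
    choose p hp hpos hnorm using fun k => happ k _ (hlev k)
    refine ⟨p, fun k => MvPolynomial.restrictSupport_mono ℝ
      (weightedSimplex_subset_indexSet hξ k hε.1) (hp k),
      isMonotoneTriangularBijection_rationalMap hpos, fun k => (hnorm k).trans (hgoal k _ ?_)⟩
    have h1 : A k * Real.exp (-(τ * (-Real.log ε - Real.log (1 + η k)))) ≤
        A k * Real.exp (τ * (Real.log (1 + η k) + K)) * Real.exp (-(τ * X)) := by
      rw [mul_assoc, ← Real.exp_add]
      refine mul_le_mul_of_nonneg_left (Real.exp_le_exp.2 ?_) (hA k)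
      nlinarith [mul_le_mul_of_nonneg_left hXle hτ0.le]
    refine h1.trans (mul_le_mul_of_nonneg_right ?_ (Real.exp_pos _).le)
    linarith [hA0' k]
  · refine ⟨fun _ => 0, fun k => Submodule.zero_mem _,
      isMonotoneTriangularBijection_rationalMap fun k x _ => by simp,
      fun k => (hzero k).trans (hgoal k _ ?_)⟩
    have h1 : A' k ≤ A' k * Real.exp (τ * (t + K)) * Real.exp (-(τ * X)) := by
      rw [mul_assoc, ← Real.exp_add]
      refine le_mul_of_one_le_right (hA' k) (Real.one_le_exp ?_)
      nlinarith [mul_le_mul_of_nonneg_left hXle hτ0.le, mul_le_mul_of_nonneg_left hcase hτ0.le]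
    refine h1.trans (mul_le_mul_of_nonneg_right ?_ (Real.exp_pos _).le)
    linarith [hA0 k]

end

end

end KRApprox

end

/-! ### The main theorem: choice of the constants -/

theorem mainTheorem2 (M L : ℝ) (hM : 0 < M) (hML : M < L) :
    ∃ C₆ > (0 : ℝ), ∃ C₇ > (0 : ℝ),
      ∀ (d : ℕ), 1 ≤ d → ∀ (δ : Fin d → ℝ), (∀ j, 0 < δ j) →
      ∀ (fρ fπ : (Fin d → ℝ) → ℝ),
        KRApprox.DensityAssumption M L C₆ δ fρ → KRApprox.DensityAssumption M L C₆ δ fπ →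
        KRApprox.IsMonotoneTriangularBijection (KRApprox.transport fρ fπ) ∧
        ∀ (m : ℕ) (τ : ℝ), 0 < τ → τ < 1 →
          ∃ C > (0 : ℝ),
            KRApprox.HasRationalApprox (fun j => 1 + C₇ * δ j) m τ C
              (KRApprox.transport fρ fπ) ∧
            KRApprox.HasRationalApprox (fun j => 1 + C₇ * δ j) m τ C
              (KRApprox.invTransport fρ fπ) := by
  have hL : 0 < L := hM.trans hML
  -- The constants must keep the error in the equation for `T_k` below the covering radius `M δ_k /
  -- 8`; with these choices it is at most `3M/50 + M/50` times `δ_k`. They also satisfy `C₆ ≤ M /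
  -- 2`, for the real parts, and `C₇ ≤ 1`.
  have hC₆ : 0 < M ^ 2 / (200 * L) := by positivity
  have hC₇ : 0 < M ^ 2 / (100 * L ^ 2) := by positivity
  have hC₆M : M ^ 2 / (200 * L) ≤ M / 2 := by
    rw [div_le_div_iff₀ (by positivity) two_pos]
    nlinarith
  have hC₇1 : M ^ 2 / (100 * L ^ 2) ≤ 1 := by
    rw [div_le_one (by positivity)]
    nlinarith
  have hsmall : 2 * L * (L * (M ^ 2 / (100 * L ^ 2)) + 4 * (M ^ 2 / (200 * L))) / M +
      4 * (M ^ 2 / (200 * L)) < M / 8 := by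
    have e : 2 * L * (L * (M ^ 2 / (100 * L ^ 2)) + 4 * (M ^ 2 / (200 * L))) / M = 3 * M / 50 := by
      field_simp
      ring
    have h : 4 * (M ^ 2 / (200 * L)) ≤ M / 50 := by
      rw [← mul_div_assoc, div_le_div_iff₀ (by positivity) (by norm_num)]
      nlinarith
    rw [e]
    linarith
  refine ⟨_, hC₆, _, hC₇, fun d hd δ hδ fρ fπ hρ hπ => ?_⟩
  obtain ⟨a, ha⟩ := hρ.exists_marginalExtension hδ hC₆ hC₆M
  obtain ⟨b, hb⟩ := hπ.exists_marginalExtension hδ hC₆ hC₆M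
  have hCρ := ha.hasCondCDF hM hδ
  have hCπ := hb.hasCondCDF hM hδ
  have hη : ∀ j, 0 < M ^ 2 / (100 * L ^ 2) * δ j := fun j => mul_pos hC₇ (hδ j)
  refine ⟨KRApprox.isMonotoneTriangularBijection_transport hCρ hCπ, fun m τ hτ0 hτ1 => ?_⟩
  obtain ⟨C, hC, h⟩ := KRApprox.exists_hasRationalApprox hd hη
    (KRApprox.exists_rootExtension ha hb hM hML hδ hC₆ hC₇ hC₇1 hsmall) m hτ0 hτ1
  -- For `S` the two densities exchange roles; the smallness condition is symmetric, so the same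
  -- constants serve.
  obtain ⟨C', _, h'⟩ := KRApprox.exists_hasRationalApprox hd hη
    (T := KRApprox.invTransport fρ fπ) (fun k => by
      obtain ⟨R, hR⟩ := KRApprox.exists_rootExtension hb ha hM hML hδ hC₆ hC₇ hC₇1 hsmall k
      exact ⟨R, hR.congr fun y hy => KRApprox.invTransport_eq hCρ hCπ hy⟩) m hτ0 hτ1
  exact ⟨max C C', lt_max_of_lt_left hC, h.mono (le_max_left _ _), h'.mono (le_max_right _ _)⟩
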